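/- **Setting.** An oriented virtual link diagram is an oriented link diagram in the plane whose double points are positive, negative or virtual crossings; an oriented virtual link $K$ is a class of such diagrams modulo planar isotopy and the generalized Reidemeister moves (r1), (r2), (r3), (v1), (v2), (v3), (v4). (The moves (r1)--(r3) are the classical ones, (v1)--(v3) are the same moves with all crossings virtual, and (v4) moves a strand with two virtual crossings across a classical crossing.) A short arc is an arc that runs from one crossing, classical or virtual, to the next, or a closed component without crossings. The Wirtinger-like presentation $P_D$ of a diagram $D$ has one meridional generator for each short arc and two further generators $s,q$; its relators are $[s,q]$ and two for each crossing, as follows. Draw the crossing with both strands pointing up, with incoming arcs $x$ (bottom left) and $y$ (bottom right) and outgoing arcs $z$ (top left) and $w$ (top right). * Positive crossing (the strand from $x$ to $w$ is over): $w=sxs^{-1}$, $z=xysx^{-1}s^{-1}$. * Negative crossing (the strand from $y$ to $z$ is over): $z=s^{-1}ys$, $w=s^{-1}y^{-1}sxy$. * Virtual crossing: $w=qxq^{-1}$, $z=q^{-1}yq$. The relator of an equation $u=v$ is $uv^{-1}$. Let $VG_D$ be the group with the presentation $P_D$. Every generalized Reidemeister move $D\to D'$ induces an isomorphism $VG_D\cong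 VG_{D'}$ that fixes $s$ and $q$ and sends the generator of each short arc outside the disc of the move to the generator of the corresponding arc; in this sense $VG_K=VG_D$ depends only on $K$. Let $\alpha\colon VG_D\to\mathbb Z^3=\langle s,t,q\rangle$ send every meridional generator to $t$, $s$ to $s$ and $q$ to $q$. Let $R$ be a unique factorization domain, $n\ge 1$, $\mathcal L_R=R[s^{\pm1},t^{\pm1},q^{\pm1}]$, and let $\varrho\colon VG_K\to GL_n(R)$ be a representation. Let $\Omega\colon\mathbb ZF\to M_n(\mathcal L_R)$ be the ring homomorphism on the integral group ring of the free group on the generators of $P_D$ with $\Omega(w)=\alpha(w)\varrho(w)$ for words $w$, and let $M=\left(\Omega(\partial r_i/\partial a_j)\right)$ be the block matrix formed from the Fox derivatives of all relators $r_i$ with respect to all generators $a_j$ (including $s$ and $q$). For a generator $a_j$ with $\det\Omega(1-a_j)\neq0$ put $$H_K^{\varrho}(s,t,q)=\frac{Q_j}{\det\Omega(1-a_j)}.$$ Here $Q_j$ is the determinant of $M$ with the $j$-th block column removed, for some ordering of the relators and of the remaining generators, if this matrix is square (that is, if $D$ has no closed component without crossings), and $Q_j=0$ otherwise (there are then fewer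 rows than columns). **Theorem.** Let $D$ and $D'$ be diagrams of the same oriented virtual link $K$. There is at least one isomorphism $VG_D\cong VG_{D'}$ induced by a sequence of generalized Reidemeister moves and their inverses, and the following holds for each such isomorphism. Let $\varrho\colon VG_D\to GL_n(R)$ and $\varrho'\colon VG_{D'}\to GL_n(R)$ be representations that correspond to each other under it. Then $H^\varrho$ computed from $D$ and $H^{\varrho'}$ computed from $D'$ exist. Let $f$ and $f'$ be any values of them, for arbitrary admissible choices of $a_j$ and of the orderings in $D$ and in $D'$. Then $$f'=\varepsilon\,(s^{e_1}t^{e_2}q^{e_3})^n f\qquad\text{for a unit }\varepsilon\text{ of }R\text{ and some }e_1,e_2,e_3\in\mathbb Z .$$ If $\varrho$ is unimodular, that is, if it takes values in $SL_n(R)$, then $f'=\pm(s^{e_1}t^{e_2}q^{e_3})^n f$ if $n$ is odd, and $f'=(s^{e_1}t^{e_2}q^{e_3})^n f$ if $n$ is even, for some $e_1,e_2,e_3\in\mathbb Z$. -/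

import Mathlib

/-! ### Fox calculus and twisted Alexander invariants of finite presentations -/

section Twisted

/-- The Fox derivative with respect to the generator `j` of the group element spelled by a word. -/
noncomputable def foxWord {X : Type} [DecidableEq X] (j : X) :
    List (X × Bool) → MonoidAlgebra ℤ (FreeGroup X)
  | [] => 0
  | (i, true) :: w =>
      (if i = j then 1 else 0) + MonoidAlgebra.of ℤ (FreeGroup X) (FreeGroup.of i) * foxWord j w
  | (i, false) :: w =>
      MonoidAlgebra.of ℤ (FreeGroup X) (FreeGroup.of i)⁻¹ *
        (foxWord j w - (if i = j then 1 else 0))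

/-- The Fox derivative `∂ w / ∂ j` in the integral group ring of the free group. -/
noncomputable def foxDeriv {X : Type} [DecidableEq X] (j : X) (w : FreeGroup X) :
    MonoidAlgebra ℤ (FreeGroup X) :=
  foxWord j w.toWord

/-- Laurent polynomials in `d` variables over `R`: the group ring of `ℤ ^ d`. -/
abbrev LaurentRing (d : ℕ) (R : Type*) [CommRing R] : Type _ :=
  AddMonoidAlgebra R (Fin d → ℤ)

/-- The Laurent monomial with exponent vector `e`. -/
noncomputable def laurentMonomial {d : ℕ} (R : Type*) [CommRing R] (e : Fin d → ℤ) :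
    LaurentRing d R :=
  AddMonoidAlgebra.single e 1

theorem laurentMonomial_zero {d : ℕ} (R : Type*) [CommRing R] :
    laurentMonomial R (0 : Fin d → ℤ) = 1 := rfl

theorem laurentMonomial_add {d : ℕ} (R : Type*) [CommRing R] (e e' : Fin d → ℤ) :
    laurentMonomial R (e + e') = laurentMonomial R e * laurentMonomial R e' := by
  simp [laurentMonomial, AddMonoidAlgebra.single_mul_single]

variable {Γ : Type} [Group Γ] {d n : ℕ} {R : Type*} [CommRing R]

/-- `g ↦ α(g) • ρ(g)`, with values in the `n × n` matrices over the Laurent polynomials. -/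
noncomputable def rhoTensorAlpha (α : Γ →* Multiplicative (Fin d → ℤ))
    (ρ : Γ →* GL (Fin n) R) : Γ →* Matrix (Fin n) (Fin n) (LaurentRing d R) where
  toFun g := laurentMonomial R (Multiplicative.toAdd (α g)) •
    (algebraMap R (LaurentRing d R)).mapMatrix (ρ g : Matrix (Fin n) (Fin n) R)
  map_one' := by
    simp only [map_one, Units.val_one, toAdd_one, laurentMonomial_zero, one_smul]
  map_mul' g h := by
    simp only [map_mul, Units.val_mul, toAdd_mul, laurentMonomial_add]
    rw [smul_mul_smul_comm]

variable {X Y : Type} [Fintype X] [DecidableEq X] [Fintype Y] [DecidableEq Y]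

/-- The ring homomorphism `Ω = (ρ ⊗ α) ∘ φ` from the integral group ring of the free group on the
generators, where `φ` is the projection of the free group to the presented group. -/
noncomputable def Omega (φ : FreeGroup X →* Γ) (α : Γ →* Multiplicative (Fin d → ℤ))
    (ρ : Γ →* GL (Fin n) R) :
    MonoidAlgebra ℤ (FreeGroup X) →ₐ[ℤ] Matrix (Fin n) (Fin n) (LaurentRing d R) :=
  (MonoidAlgebra.lift ℤ (Matrix (Fin n) (Fin n) (LaurentRing d R)) Γ (rhoTensorAlpha α ρ)).comp
    (MonoidAlgebra.mapDomainAlgHom ℤ ℤ φ)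

/-- The twisted presentation matrix `M = Ω(∂ r_y / ∂ a_x)`, a block matrix with `n × n` blocks,
written as a matrix over the Laurent polynomials. -/
noncomputable def twistedMatrix (r : Y → FreeGroup X) (φ : FreeGroup X →* Γ)
    (α : Γ →* Multiplicative (Fin d → ℤ)) (ρ : Γ →* GL (Fin n) R) :
    Matrix (Y × Fin n) (X × Fin n) (LaurentRing d R) :=
  Matrix.of fun y x => Omega φ α ρ (foxDeriv x.1 (r y.1)) y.2 x.2

/-- `det Ω(1 - a_j)`. -/
noncomputable def twistedDenominator (φ : FreeGroup X →* Γ)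
    (α : Γ →* Multiplicative (Fin d → ℤ)) (ρ : Γ →* GL (Fin n) R) (j : X) : LaurentRing d R :=
  (Omega φ α ρ (1 - MonoidAlgebra.of ℤ (FreeGroup X) (FreeGroup.of j))).det

/-- `Q` is a numerator `Q_j`: a greatest common divisor of the maximal minors of the matrix obtained
from the twisted presentation matrix by deleting the block column `j`.
* If there is one relator less than there are generators, the remaining matrix is square, and `Q` is
  its determinant, for some way of matching the block rows with the block columns
  (that is, for some ordering of the relators and of the generators).
* If there are fewer relators, then `Q = 0`.
* If there are more, then `Q` is a greatest common divisor of the minors given by the row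
  multi-indices `I`. -/
def IsTwistedNumerator (r : Y → FreeGroup X) (φ : FreeGroup X →* Γ)
    (α : Γ →* Multiplicative (Fin d → ℤ)) (ρ : Γ →* GL (Fin n) R) (j : X)
    (Q : LaurentRing d R) : Prop :=
  (∃ e : Y ≃ {x : X // x ≠ j},
    Q = ((twistedMatrix r φ α ρ).submatrix id
      (fun p : Y × Fin n => ((e p.1 : X), p.2))).det) ∨
  (Fintype.card Y + 1 < Fintype.card X ∧ Q = 0) ∨
  (Fintype.card X < Fintype.card Y + 1 ∧
    ∀ m : LaurentRing d R, m ∣ Q ↔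
      ∀ I : {x : X // x ≠ j} × Fin n → Y × Fin n,
        m ∣ ((twistedMatrix r φ α ρ).submatrix I
          (fun p : {x : X // x ≠ j} × Fin n => ((p.1 : X), p.2))).det)

/-- `f` is (a representative of) the twisted Alexander polynomial: the quotient of a numerator `Q_j`
by `det Ω(1 - a_j)`, for some generator `a_j` for which the latter does not vanish. -/
def IsTwistedAlexander [IsDomain R] (r : Y → FreeGroup X) (φ : FreeGroup X →* Γ)
    (α : Γ →* Multiplicative (Fin d → ℤ)) (ρ : Γ →* GL (Fin n) R)
    (f : FractionRing (LaurentRing d R)) : Prop :=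
  ∃ (j : X) (Q : LaurentRing d R), twistedDenominator φ α ρ j ≠ 0 ∧
    IsTwistedNumerator r φ α ρ j Q ∧
    f = algebraMap (LaurentRing d R) (FractionRing (LaurentRing d R)) Q /
      algebraMap (LaurentRing d R) (FractionRing (LaurentRing d R)) (twistedDenominator φ α ρ j)

end Twisted

/-! ### Oriented virtual link diagrams -/

/-- A crossing is positive (right-handed), negative (left-handed) or virtual. -/
inductive CrossingKind : Type
  | pos
  | neg
  | virt

/-- An oriented link diagram on some closed oriented surface, as a combinatorial object. Draw each
crossing with both strands pointing up. Strand `0` runs from the bottom left to the top right and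
strand `1` from the bottom right to the top left; `inc c i` and `out c i` are the short arcs by which
strand `i` enters and leaves the crossing `c`. Every arc either starts at exactly one crossing and
ends at exactly one, or is a closed component without crossings. In a positive crossing strand `0`
is the overcrossing one, in a negative crossing strand `1`. -/
structure SurfaceDiagram : Type 1 where
  Crossing : Type
  Arc : Type
  [fintypeCrossing : Fintype Crossing]
  [decEqCrossing : DecidableEq Crossing]
  [fintypeArc : Fintype Arc]
  [decEqArc : DecidableEq Arc]
  [nonemptyArc : Nonempty Arc]
  kind : Crossing → CrossingKind
  inc : Crossing → Fin 2 → Arc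
  out : Crossing → Fin 2 → Arc
  inc_injective : Function.Injective (fun p : Crossing × Fin 2 => inc p.1 p.2)
  out_injective : Function.Injective (fun p : Crossing × Fin 2 => out p.1 p.2)
  range_eq : Set.range (fun p : Crossing × Fin 2 => inc p.1 p.2) =
    Set.range (fun p : Crossing × Fin 2 => out p.1 p.2)

namespace SurfaceDiagram

attribute [instance] fintypeCrossing decEqCrossing fintypeArc decEqArc nonemptyArc

variable (D : SurfaceDiagram)

/-- Half-edges: at each crossing, counterclockwise from the bottom left, number `0` is the incoming
half of strand `0`, `1` the incoming half of strand `1`, `2` the outgoing half of strand `0`,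
`3` the outgoing half of strand `1`. -/
abbrev HalfEdge : Type := D.Crossing × Fin 4

/-- The arc that a half-edge belongs to. -/
def arcAt (h : D.HalfEdge) : D.Arc :=
  ![D.inc h.1 0, D.inc h.1 1, D.out h.1 0, D.out h.1 1] h.2

/-- One step along the boundary of a region of the diagram: follow the arc of `h` to its other end,
and turn there to the next half-edge in counterclockwise order. -/
def FaceStep (h h' : D.HalfEdge) : Prop :=
  ∃ k : D.HalfEdge, k ≠ h ∧ D.arcAt k = D.arcAt h ∧ h' = (k.1, k.2 + 1)

/-- The regions of the connected pieces with crossings, as cycles of half-edges. -/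
def Face : Type := Quot D.FaceStep

/-- The connected pieces that contain a crossing. -/
def Piece : Type :=
  Quot (fun c c' : D.Crossing => ∃ i j : Fin 4, D.arcAt (c, i) = D.arcAt (c', j))

/-- The diagram can be drawn on the sphere (equivalently, in the plane): every connected piece has
Euler characteristic `2`. The numbers of vertices, edges and faces are those of the `4`-valent graph
formed by the crossings. Since the Euler characteristic of every piece is at most `2`, it is enough
to sum over all the pieces. -/
def IsPlanar : Prop :=
  (Fintype.card D.Crossing : ℤ) - Fintype.card (D.Crossing × Fin 2) + Nat.card D.Face =
    2 * Nat.card D.Piece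

/-- The strand `i` is the overcrossing strand at the classical crossing `c`. -/
def IsOver (c : D.Crossing) (i : Fin 2) : Prop :=
  (D.kind c = .pos ∧ i = 0) ∨ (D.kind c = .neg ∧ i = 1)

/-- The generators of the virtual link group: one for every short arc, and `s` and `q`. -/
abbrev Gen : Type := D.Arc ⊕ Fin 2

/-- The word of the generator of an arc. -/
def arcWord (a : D.Arc) : FreeGroup D.Gen := FreeGroup.of (Sum.inl a)

/-- The word of the generator `s`. -/
def sWord : FreeGroup D.Gen := FreeGroup.of (Sum.inr 0)

/-- The word of the generator `q`. -/
def qWord : FreeGroup D.Gen := FreeGroup.of (Sum.inr 1)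

/-- The generator of the outgoing arc of strand `i` at `c`, in terms of the incoming arcs. -/
def outWord (c : D.Crossing) (i : Fin 2) : FreeGroup D.Gen :=
  let x := D.arcWord (D.inc c 0)
  let y := D.arcWord (D.inc c 1)
  let s := D.sWord
  let q := D.qWord
  match D.kind c with
  | .pos => ![s * x * s⁻¹, x * y * s * x⁻¹ * s⁻¹] i
  | .neg => ![s⁻¹ * y⁻¹ * s * x * y, s⁻¹ * y * s] i
  | .virt => ![q * x * q⁻¹, q⁻¹ * y * q] i

/-- The relators: `[s, q]`, and two for every crossing. -/
def relator : Option (D.Crossing × Fin 2) → FreeGroup D.Gen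
  | none => D.sWord * D.qWord * D.sWord⁻¹ * D.qWord⁻¹
  | some p => D.arcWord (D.out p.1 p.2) * (D.outWord p.1 p.2)⁻¹

/-- The virtual link group, given by the Wirtinger-like presentation of the diagram. -/
abbrev VG : Type := PresentedGroup (Set.range D.relator)

/-- The element of the virtual link group given by a short arc. -/
def arcGen (a : D.Arc) : D.VG := PresentedGroup.of (Sum.inl a)

/-- The element `s` of the virtual link group. -/
def sGen : D.VG := PresentedGroup.of (Sum.inr 0)

/-- The element `q` of the virtual link group. -/
def qGen : D.VG := PresentedGroup.of (Sum.inr 1)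

/-- Exponent vectors are in the order `s`, `t`, `q`; every meridional generator goes to `t`. -/
def alphaGen : D.Gen → Multiplicative (Fin 3 → ℤ)
  | Sum.inl _ => Multiplicative.ofAdd ![0, 1, 0]
  | Sum.inr i => Multiplicative.ofAdd (![![1, 0, 0], ![0, 0, 1]] i)

theorem alphaGen_relator (r : FreeGroup D.Gen) (hr : r ∈ Set.range D.relator) :
    FreeGroup.lift D.alphaGen r = 1 := by
  obtain ⟨p, rfl⟩ := hr
  rcases p with _ | ⟨c, i⟩
  · simp [relator, sWord, qWord]
  · have key : ∀ a s : Multiplicative (Fin 3 → ℤ), a * (s * (a * (a⁻¹ * a⁻¹ * s⁻¹))) = 1 := by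
      intro a s
      rw [mul_comm (a⁻¹ * a⁻¹) s⁻¹, mul_left_comm a s⁻¹]
      simp
    rcases hk : D.kind c <;> fin_cases i <;>
      simp [relator, outWord, hk, arcWord, sWord, qWord, alphaGen, mul_comm, key]

/-- The homomorphism `α` from the virtual link group to `ℤ ^ 3`. -/
def alpha : D.VG →* Multiplicative (Fin 3 → ℤ) :=
  PresentedGroup.toGroup D.alphaGen_relator

/-- `f` is a representative of the twisted virtual Alexander polynomial `H^ρ(s, t, q)`, computed
from the Wirtinger-like presentation of the diagram. -/
def IsTwistedVirtualAlexander {n : ℕ} {R : Type*} [CommRing R] [IsDomain R]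
    (ρ : D.VG →* GL (Fin n) R) (f : FractionRing (LaurentRing 3 R)) : Prop :=
  IsTwistedAlexander D.relator (PresentedGroup.mk (Set.range D.relator)) D.alpha ρ f

end SurfaceDiagram

/-- An oriented virtual link diagram in the plane. -/
structure VirtualLinkDiagram : Type 1 extends SurfaceDiagram where
  planar : toSurfaceDiagram.IsPlanar

/-! ### Generalized Reidemeister moves -/

section Moves

/-- `D'` is a relabelling of `D` (the two diagrams are the same up to isotopy). -/
structure IsRelabelling (D D' : SurfaceDiagram) (κ : D.Crossing ≃ D'.Crossing)
    (π : D.Arc ≃ D'.Arc) : Prop where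
  kind_eq : ∀ c, D'.kind (κ c) = D.kind c
  inc_eq : ∀ c i, D'.inc (κ c) i = π (D.inc c i)
  out_eq : ∀ c i, D'.out (κ c) i = π (D.out c i)

/-- `D'` is obtained from `D` by erasing the crossings in `S`, in such a way that both strands pass
straight through: the arc by which a strand enters an erased crossing is merged with the arc by which
it leaves. The map `π` sends every arc of `D` to the arc of `D'` that it becomes a part of. -/
structure IsErasure (D D' : SurfaceDiagram) (S : Set D.Crossing)
    (κ : {c : D.Crossing // c ∉ S} ≃ D'.Crossing) (π : D.Arc → D'.Arc) : Prop where
  kind_eq : ∀ c, D'.kind (κ c) = D.kind c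
  inc_eq : ∀ c i, D'.inc (κ c) i = π (D.inc c i)
  out_eq : ∀ c i, D'.out (κ c) i = π (D.out c i)
  surjective : Function.Surjective π
  merge : ∀ a b, π a = π b ↔
    Relation.EqvGen (fun a b => ∃ c ∈ S, ∃ i, a = D.inc c i ∧ b = D.out c i) a b

/-- `h₁, h₂, h₃` go once around a triangular region with three different corners. -/
def IsTriangle (D : SurfaceDiagram) (h₁ h₂ h₃ : D.HalfEdge) : Prop :=
  D.FaceStep h₁ h₂ ∧ D.FaceStep h₂ h₃ ∧ D.FaceStep h₃ h₁ ∧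
    h₁.1 ≠ h₂.1 ∧ h₂.1 ≠ h₃.1 ∧ h₃.1 ≠ h₁.1

/-- `D'` is obtained from `D` by moving the three strands that bound the triangle across each other.
Each strand runs through two corners of the triangle: it enters the first corner, follows a side
`m` of the triangle to the second corner, and leaves. In `D'` it passes the same two crossings in the
opposite order. Nothing else changes. -/
structure IsTriangleSwap (D D' : SurfaceDiagram) (h₁ h₂ h₃ : D.HalfEdge)
    (κ : D.Crossing ≃ D'.Crossing) (π : D.Arc ≃ D'.Arc) : Prop where
  kind_eq : ∀ c, D'.kind (κ c) = D.kind c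
  inc_eq : ∀ c i, c ≠ h₁.1 → c ≠ h₂.1 → c ≠ h₃.1 → D'.inc (κ c) i = π (D.inc c i)
  out_eq : ∀ c i, c ≠ h₁.1 → c ≠ h₂.1 → c ≠ h₃.1 → D'.out (κ c) i = π (D.out c i)
  swap : ∀ c i c' i', D.out c i = D.inc c' i' →
    (D.out c i = D.arcAt h₁ ∨ D.out c i = D.arcAt h₂ ∨ D.out c i = D.arcAt h₃) →
      D'.inc (κ c') i' = π (D.inc c i) ∧ D'.out (κ c') i' = π (D.out c i) ∧
      D'.inc (κ c) i = π (D.out c i) ∧ D'.out (κ c) i = π (D.out c' i')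

/-- The triangle is one of the move (r3): its corners are classical crossings, and one of the three
strands passes over both of the other two (so that there are a top, a middle and a bottom strand). -/
def IsClassicalTriangle (D : SurfaceDiagram) (h₁ h₂ h₃ : D.HalfEdge) : Prop :=
  D.kind h₁.1 ≠ .virt ∧ D.kind h₂.1 ≠ .virt ∧ D.kind h₃.1 ≠ .virt ∧
  ∃ c i c' i', D.out c i = D.inc c' i' ∧
    (D.out c i = D.arcAt h₁ ∨ D.out c i = D.arcAt h₂ ∨ D.out c i = D.arcAt h₃) ∧
    D.IsOver c i ∧ D.IsOver c' i'

/-- The triangle is one of the moves (v3), (v4): at least two of the corners are virtual. -/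
def IsVirtualTriangle (D : SurfaceDiagram) (h₁ h₂ h₃ : D.HalfEdge) : Prop :=
  (D.kind h₁.1 = .virt ∧ D.kind h₂.1 = .virt) ∨ (D.kind h₂.1 = .virt ∧ D.kind h₃.1 = .virt) ∨
    (D.kind h₃.1 = .virt ∧ D.kind h₁.1 = .virt)

/-- `Move D D' θ`: the diagram `D'` arises from `D` by a relabelling or by one generalized
Reidemeister move, and `θ a b` says that `a` is an arc of `D` that is not inside the disc where the
move takes place, and that it corresponds to the arc `b` of `D'`. The moves (r1), (r2), (v1), (v2)
are only listed in the direction that removes crossings. -/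
inductive Move (D D' : VirtualLinkDiagram) : (D.Arc → D'.Arc → Prop) → Prop
  /-- A planar isotopy. -/
  | relabel (κ : D.Crossing ≃ D'.Crossing) (π : D.Arc ≃ D'.Arc)
      (h : IsRelabelling D.toSurfaceDiagram D'.toSurfaceDiagram κ π) :
      Move D D' (fun a b => π a = b)
  /-- The moves (r1) and (v1): a kink, that is a region with one corner, of any kind. -/
  | kink (h₁ : D.HalfEdge) (hface : D.FaceStep h₁ h₁)
      (κ : {c : D.Crossing // c ∉ ({h₁.1} : Set D.Crossing)} ≃ D'.Crossing) (π : D.Arc → D'.Arc)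
      (h : IsErasure D.toSurfaceDiagram D'.toSurfaceDiagram {h₁.1} κ π) :
      Move D D' (fun a b => a ≠ D.arcAt h₁ ∧ π a = b)
  /-- The moves (r2) and (v2): a bigon whose corners are two classical crossings of opposite sign
  (which means that the same strand is over at both), or two virtual crossings. -/
  | bigon (h₁ h₂ : D.HalfEdge) (hface : D.FaceStep h₁ h₂ ∧ D.FaceStep h₂ h₁ ∧ h₁.1 ≠ h₂.1)
      (hkind : (D.kind h₁.1 = .pos ∧ D.kind h₂.1 = .neg) ∨
        (D.kind h₁.1 = .neg ∧ D.kind h₂.1 = .pos) ∨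
        (D.kind h₁.1 = .virt ∧ D.kind h₂.1 = .virt))
      (κ : {c : D.Crossing // c ∉ ({h₁.1, h₂.1} : Set D.Crossing)} ≃ D'.Crossing)
      (π : D.Arc → D'.Arc)
      (h : IsErasure D.toSurfaceDiagram D'.toSurfaceDiagram {h₁.1, h₂.1} κ π) :
      Move D D' (fun a b => a ≠ D.arcAt h₁ ∧ a ≠ D.arcAt h₂ ∧ π a = b)
  /-- The moves (r3), (v3) and (v4). -/
  | triangle (h₁ h₂ h₃ : D.HalfEdge) (hface : IsTriangle D.toSurfaceDiagram h₁ h₂ h₃)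
      (hkind : IsClassicalTriangle D.toSurfaceDiagram h₁ h₂ h₃ ∨
        IsVirtualTriangle D.toSurfaceDiagram h₁ h₂ h₃)
      (κ : D.Crossing ≃ D'.Crossing) (π : D.Arc ≃ D'.Arc)
      (h : IsTriangleSwap D.toSurfaceDiagram D'.toSurfaceDiagram h₁ h₂ h₃ κ π) :
      Move D D' (fun a b => a ≠ D.arcAt h₁ ∧ a ≠ D.arcAt h₂ ∧ a ≠ D.arcAt h₃ ∧ π a = b)

/-- Two diagrams represent the same oriented virtual link. -/
def VirtuallyEquivalent : VirtualLinkDiagram → VirtualLinkDiagram → Prop :=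
  Relation.EqvGen (fun D D' => ∃ θ, Move D D' θ)

/-- The isomorphisms of virtual link groups induced by sequences of generalized Reidemeister moves.
The one induced by a single move fixes `s` and `q` and sends the generator of every arc outside the
disc of the move to the generator of the corresponding arc. -/
inductive InducedIso : (D D' : VirtualLinkDiagram) → (D.VG ≃* D'.VG) → Prop
  | move {D D' : VirtualLinkDiagram} {θ : D.Arc → D'.Arc → Prop} (h : Move D D' θ)
      (φ : D.VG ≃* D'.VG) (hs : φ D.sGen = D'.sGen) (hq : φ D.qGen = D'.qGen)
      (harc : ∀ a b, θ a b → φ (D.arcGen a) = D'.arcGen b) : InducedIso D D' φ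
  | symm {D D' : VirtualLinkDiagram} {φ : D.VG ≃* D'.VG} (h : InducedIso D D' φ) :
      InducedIso D' D φ.symm
  | trans {D D' D'' : VirtualLinkDiagram} {φ : D.VG ≃* D'.VG} {ψ : D'.VG ≃* D''.VG}
      (h : InducedIso D D' φ) (h' : InducedIso D' D'' ψ) : InducedIso D D'' (φ.trans ψ)

end Moves

/-! Write Ω(g) = α(g)ϱ(g). Fox derivatives are the coefficients of crossed homomorphisms: if every
generator a is sent to the affine map x ↦ Ω(a)x + v_a, then a word w goes to an affine map with
translation part Σ Ω(∂w/∂a) v_a (`sum_Omega_foxDeriv`). Linear algebra with the presentation matrix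
is thus computation in the affine group.

The invariant is essentially one determinant. The blocks Ω(1 - a_j) form a block vector in the
kernel of the presentation matrix, so Q_j / det Ω(1 - a_j) is independent of j up to the n-th power
of a sign (`det_deleteBlockColumn`). For a_j = s the row of [s,q] keeps only the block Ω(s) - 1, in
the column q. What remains is the square matrix `arcMatrix` of the equations "an arc equals the word
prescribed by the crossing where it starts", with translation part 0 for s and q. Hence every value
of the invariant is σ^n times its determinant (`IsTwistedVirtualAlexander.exists_eq`). A component
without crossings gives zero rows, in accordance with Q_j = 0.

A move takes place at a polygon with one, two or three corners. In any group, the relations at the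
corners determine the values on the sides from those on the entering arcs. At a kink or bigon they
force each strand to leave with the value with which it entered; at a triangle, if s and q commute,
they give the same leaving values as the triangle after the move. Used for the groups of the
diagrams, this gives the induced isomorphism (`ColoringTransfer`). Used for the affine group, it
shows that the linear equations agree once the variables of the sides are eliminated
(`DetTransfer`).

The elimination is a Schur complement and costs the determinant of the block of the sides. For
bigons and triangles this block is unitriangular, because a side depends on another one only where
it passes under it (`IsPolygon.det_sides_eq_one`). For a kink it is Ω(g) for some g in the group
(`IsPolygon.det_kink`). After an erasure the equations "leaving = entering" merge variables
(`det_eq_of_merge`). Along a sequence of moves the determinant therefore changes by some det Ω(g),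
which is the n-th power of a monomial times det ϱ(g). -/

/-! ### Crossing relations around triangles, bigons and kinks in an arbitrary group -/

/-- The values of the two outgoing arcs of a crossing whose incoming arcs have values `x`, `y`. -/
def crossingValue {G : Type*} [Group G] (κ : CrossingKind) (s q x y : G) (i : Fin 2) : G :=
  match κ with
  | .pos => ![s * x * s⁻¹, x * y * s * x⁻¹ * s⁻¹] i
  | .neg => ![s⁻¹ * y⁻¹ * s * x * y, s⁻¹ * y * s] i
  | .virt => ![q * x * q⁻¹, q⁻¹ * y * q] i

/-- The crossing relations at a corner of a polygonal region, where the sides number `p` and `p - 1`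
(as half-edges of the crossing) are consecutive sides of the region. The strand through the side `p`
has the values `a, m, b`, and the strand through the other side the values `a', m', b'`, before, on
and after the side of the region. -/
def CornerRel {G : Type*} [Group G] (κ : CrossingKind) (s q : G) (p : Fin 4)
    (a m b a' m' b' : G) : Prop :=
  match p with
  | 0 => b = crossingValue κ s q m a' 0 ∧ m' = crossingValue κ s q m a' 1
  | 1 => b' = crossingValue κ s q m' m 0 ∧ b = crossingValue κ s q m' m 1
  | 2 => m = crossingValue κ s q a m' 0 ∧ b' = crossingValue κ s q a m' 1
  | 3 => m' = crossingValue κ s q a' a 0 ∧ m = crossingValue κ s q a' a 1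

/-- The side that starts at a corner is over the side that ends there. -/
def OverNext (κ : CrossingKind) (p : Fin 4) : Prop :=
  match p with
  | 0 => κ = .pos
  | 1 => κ = .neg
  | 2 => κ = .pos
  | 3 => κ = .neg

/-- The side that ends at a corner is over the side that starts there. -/
def OverPrev (κ : CrossingKind) (p : Fin 4) : Prop :=
  match p with
  | 0 => κ = .neg
  | 1 => κ = .pos
  | 2 => κ = .neg
  | 3 => κ = .pos

/-- The half-edges at two consecutive corners are compatible with an orientation of the side. -/
abbrev CompatibleCorners (p p' : Fin 4) : Prop := (p = 2 ∨ p = 3) ↔ (p' = 1 ∨ p' = 2)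

/-- The eight orientations of the three sides: the first two cases are the cyclic ones, the other
six are acyclic. -/
theorem compatibleCorners_triangle (p₁ p₂ p₃ : Fin 4) (h₁ : CompatibleCorners p₁ p₂)
    (h₂ : CompatibleCorners p₂ p₃) (h₃ : CompatibleCorners p₃ p₁) :
    (p₁ = 2 ∧ p₂ = 2 ∧ p₃ = 2) ∨ (p₁ = 0 ∧ p₂ = 0 ∧ p₃ = 0) ∨ (p₁ = 3 ∧ p₂ = 1 ∧ p₃ = 0) ∨
    (p₁ = 0 ∧ p₂ = 3 ∧ p₃ = 1) ∨ (p₁ = 1 ∧ p₂ = 0 ∧ p₃ = 3) ∨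
    (p₁ = 3 ∧ p₂ = 2 ∧ p₃ = 1) ∨ (p₁ = 1 ∧ p₂ = 3 ∧ p₃ = 2) ∨ (p₁ = 2 ∧ p₂ = 1 ∧ p₃ = 3) := by
  revert p₁ p₂ p₃; decide

/-- The triangles of the moves (r3), (v3) and (v4). -/
def AdmissibleTriangle (κ₁ κ₂ κ₃ : CrossingKind) (p₁ p₂ p₃ : Fin 4) : Prop :=
  (κ₁ ≠ .virt ∧ κ₂ ≠ .virt ∧ κ₃ ≠ .virt ∧
    ((OverNext κ₁ p₁ ∧ OverPrev κ₂ p₂) ∨ (OverNext κ₂ p₂ ∧ OverPrev κ₃ p₃) ∨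
      (OverNext κ₃ p₃ ∧ OverPrev κ₁ p₁))) ∨
  ((κ₁ = .virt ∧ κ₂ = .virt) ∨ (κ₂ = .virt ∧ κ₃ = .virt) ∨ (κ₃ = .virt ∧ κ₁ = .virt))

/-- The crossing relations at the three corners of a triangle. -/
def TriangleRel {G : Type*} [Group G] (κ₁ κ₂ κ₃ : CrossingKind) (s q : G) (p₁ p₂ p₃ : Fin 4)
    (a₁ a₂ a₃ m₁ m₂ m₃ b₁ b₂ b₃ : G) : Prop :=
  CornerRel κ₁ s q p₁ a₁ m₁ b₁ a₃ m₃ b₃ ∧ CornerRel κ₂ s q p₂ a₂ m₂ b₂ a₁ m₁ b₁ ∧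
    CornerRel κ₃ s q p₃ a₃ m₃ b₃ a₂ m₂ b₂

set_option maxHeartbeats 4000000 in
-- The equations for the sides can be solved one after the other. Only a cyclic orientation could
-- make them circular, and there a strand that is over at both its corners, or a virtual corner,
-- breaks the circle.
theorem exists_triangleRel {G : Type*} [Group G] {κ₁ κ₂ κ₃ : CrossingKind} {p₁ p₂ p₃ : Fin 4}
    (h₁ : CompatibleCorners p₁ p₂) (h₂ : CompatibleCorners p₂ p₃) (h₃ : CompatibleCorners p₃ p₁)
    (h : AdmissibleTriangle κ₁ κ₂ κ₃ p₁ p₂ p₃) (s q a₁ a₂ a₃ : G) :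
    ∃ m₁ m₂ m₃ b₁ b₂ b₃, TriangleRel κ₁ κ₂ κ₃ s q p₁ p₂ p₃ a₁ a₂ a₃ m₁ m₂ m₃ b₁ b₂ b₃ := by
  rcases compatibleCorners_triangle p₁ p₂ p₃ h₁ h₂ h₃ with
    ⟨rfl, rfl, rfl⟩ | ⟨rfl, rfl, rfl⟩ | ⟨rfl, rfl, rfl⟩ | ⟨rfl, rfl, rfl⟩ | ⟨rfl, rfl, rfl⟩ |
    ⟨rfl, rfl, rfl⟩ | ⟨rfl, rfl, rfl⟩ | ⟨rfl, rfl, rfl⟩ <;>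
  cases κ₁ <;> cases κ₂ <;> cases κ₃ <;>
  first
  | (exfalso; simp [AdmissibleTriangle, OverNext, OverPrev] at h; done)
  | simp [TriangleRel, CornerRel, crossingValue]

set_option maxHeartbeats 4000000 in
theorem triangleRel_unique {G : Type*} [Group G] {κ₁ κ₂ κ₃ : CrossingKind} {p₁ p₂ p₃ : Fin 4}
    (h₁ : CompatibleCorners p₁ p₂) (h₂ : CompatibleCorners p₂ p₃) (h₃ : CompatibleCorners p₃ p₁)
    (h : AdmissibleTriangle κ₁ κ₂ κ₃ p₁ p₂ p₃) {s q a₁ a₂ a₃ m₁ m₂ m₃ b₁ b₂ b₃ n₁ n₂ n₃ c₁ c₂ c₃ : G}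
    (hm : TriangleRel κ₁ κ₂ κ₃ s q p₁ p₂ p₃ a₁ a₂ a₃ m₁ m₂ m₃ b₁ b₂ b₃)
    (hn : TriangleRel κ₁ κ₂ κ₃ s q p₁ p₂ p₃ a₁ a₂ a₃ n₁ n₂ n₃ c₁ c₂ c₃) :
    m₁ = n₁ ∧ m₂ = n₂ ∧ m₃ = n₃ := by
  obtain ⟨e, e', e''⟩ := hm
  obtain ⟨f, f', f''⟩ := hn
  rcases compatibleCorners_triangle p₁ p₂ p₃ h₁ h₂ h₃ with
    ⟨rfl, rfl, rfl⟩ | ⟨rfl, rfl, rfl⟩ | ⟨rfl, rfl, rfl⟩ | ⟨rfl, rfl, rfl⟩ | ⟨rfl, rfl, rfl⟩ |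
    ⟨rfl, rfl, rfl⟩ | ⟨rfl, rfl, rfl⟩ | ⟨rfl, rfl, rfl⟩ <;>
  cases κ₁ <;> cases κ₂ <;> cases κ₃ <;>
  first
  | (exfalso; simp [AdmissibleTriangle, OverNext, OverPrev] at h; done)
  | (simp only [CornerRel, crossingValue, Matrix.cons_val_zero, Matrix.cons_val_one]
       at e e' e'' f f' f''
     simp [e, e', e'', f, f', f''])

set_option maxHeartbeats 4000000 in
-- Adding 2 to a half-edge number passes to the opposite half-edge, so the second triangle is the
-- one after the move. Commutation of `s` and `q` is what the triangles with one classical and two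
-- virtual corners need.
theorem triangleRel_swap {G : Type*} [Group G] {κ₁ κ₂ κ₃ : CrossingKind} {p₁ p₂ p₃ : Fin 4}
    (h₁ : CompatibleCorners p₁ p₂) (h₂ : CompatibleCorners p₂ p₃) (h₃ : CompatibleCorners p₃ p₁)
    (h : AdmissibleTriangle κ₁ κ₂ κ₃ p₁ p₂ p₃) {s q a₁ a₂ a₃ m₁ m₂ m₃ b₁ b₂ b₃ n₁ n₂ n₃ c₁ c₂ c₃ : G}
    (hsq : s * q = q * s)
    (hm : TriangleRel κ₁ κ₂ κ₃ s q p₁ p₂ p₃ a₁ a₂ a₃ m₁ m₂ m₃ b₁ b₂ b₃)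
    (hn : TriangleRel κ₁ κ₂ κ₃ s q (p₁ + 2) (p₂ + 2) (p₃ + 2) a₁ a₂ a₃ n₁ n₂ n₃ c₁ c₂ c₃) :
    b₁ = c₁ ∧ b₂ = c₂ ∧ b₃ = c₃ := by
  have e1 : ∀ x : G, s * (q * x) = q * (s * x) := fun x => by rw [← mul_assoc, hsq, mul_assoc]
  have e2 : s⁻¹ * q = q * s⁻¹ := by rw [inv_mul_eq_iff_eq_mul, ← mul_assoc, hsq, mul_inv_cancel_right]
  have e3 : s * q⁻¹ = q⁻¹ * s := by rw [eq_inv_mul_iff_mul_eq, ← mul_assoc, ← hsq, mul_inv_cancel_right]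
  have e4 : s⁻¹ * q⁻¹ = q⁻¹ * s⁻¹ := by rw [← mul_inv_rev, ← mul_inv_rev, hsq]
  have e2' : ∀ x : G, s⁻¹ * (q * x) = q * (s⁻¹ * x) := fun x => by rw [← mul_assoc, e2, mul_assoc]
  have e3' : ∀ x : G, s * (q⁻¹ * x) = q⁻¹ * (s * x) := fun x => by rw [← mul_assoc, e3, mul_assoc]
  have e4' : ∀ x : G, s⁻¹ * (q⁻¹ * x) = q⁻¹ * (s⁻¹ * x) := fun x => by
    rw [← mul_assoc, e4, mul_assoc]
  obtain ⟨f, f', f''⟩ := hm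
  obtain ⟨g, g', g''⟩ := hn
  have z0 : (0 : Fin 4) + 2 = 2 := rfl
  have z1 : (1 : Fin 4) + 2 = 3 := rfl
  have z2 : (2 : Fin 4) + 2 = 0 := rfl
  have z3 : (3 : Fin 4) + 2 = 1 := rfl
  rcases compatibleCorners_triangle p₁ p₂ p₃ h₁ h₂ h₃ with
    ⟨rfl, rfl, rfl⟩ | ⟨rfl, rfl, rfl⟩ | ⟨rfl, rfl, rfl⟩ | ⟨rfl, rfl, rfl⟩ | ⟨rfl, rfl, rfl⟩ |
    ⟨rfl, rfl, rfl⟩ | ⟨rfl, rfl, rfl⟩ | ⟨rfl, rfl, rfl⟩ <;>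
  cases κ₁ <;> cases κ₂ <;> cases κ₃ <;>
  first
  | (exfalso; simp [AdmissibleTriangle, OverNext, OverPrev] at h; done)
  | (simp only [z0, z1, z2, z3, CornerRel, crossingValue, Matrix.cons_val_zero,
       Matrix.cons_val_one] at f f' f'' g g' g''
     obtain ⟨f, i⟩ := f
     obtain ⟨f', i'⟩ := f'
     obtain ⟨f'', i''⟩ := f''
     obtain ⟨g, j⟩ := g
     obtain ⟨g', j'⟩ := g'
     obtain ⟨g'', j''⟩ := g''
     clear h
     -- All values become words in the entering values, `s` and `q`. The identities below are then
     -- checked by free reduction, moving powers of `q` to the left of powers of `s`.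
     subst_vars
     refine ⟨?_, ?_, ?_⟩ <;>
     simp only [mul_assoc, mul_inv_rev, inv_inv, mul_inv_cancel_left, inv_mul_cancel_left,
       mul_inv_cancel, inv_mul_cancel, mul_one, hsq, e1, e2, e3, e4, e2', e3', e4'])

/-- The crossing relations at the two corners of a bigon. -/
def BigonRel {G : Type*} [Group G] (κ₁ κ₂ : CrossingKind) (s q : G) (p₁ p₂ : Fin 4)
    (a₁ a₂ m₁ m₂ b₁ b₂ : G) : Prop :=
  CornerRel κ₁ s q p₁ a₁ m₁ b₁ a₂ m₂ b₂ ∧ CornerRel κ₂ s q p₂ a₂ m₂ b₂ a₁ m₁ b₁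

/-- The bigons of the moves (r2) and (v2). -/
def AdmissibleBigon (κ₁ κ₂ : CrossingKind) : Prop :=
  (κ₁ = .pos ∧ κ₂ = .neg) ∨ (κ₁ = .neg ∧ κ₂ = .pos) ∨ (κ₁ = .virt ∧ κ₂ = .virt)

theorem compatibleCorners_bigon (p₁ p₂ : Fin 4) (h₁ : CompatibleCorners p₁ p₂)
    (h₂ : CompatibleCorners p₂ p₁) :
    (p₁ = 2 ∧ p₂ = 2) ∨ (p₁ = 0 ∧ p₂ = 0) ∨ (p₁ = 3 ∧ p₂ = 1) ∨ (p₁ = 1 ∧ p₂ = 3) := by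
  revert p₁ p₂; decide

theorem exists_bigonRel {G : Type*} [Group G] {κ₁ κ₂ : CrossingKind} {p₁ p₂ : Fin 4}
    (h₁ : CompatibleCorners p₁ p₂) (h₂ : CompatibleCorners p₂ p₁)
    (h : AdmissibleBigon κ₁ κ₂) (s q a₁ a₂ : G) :
    ∃ m₁ m₂, BigonRel κ₁ κ₂ s q p₁ p₂ a₁ a₂ m₁ m₂ a₁ a₂ := by
  rcases h with ⟨rfl, rfl⟩ | ⟨rfl, rfl⟩ | ⟨rfl, rfl⟩ <;>
  rcases compatibleCorners_bigon p₁ p₂ h₁ h₂ with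
    ⟨rfl, rfl⟩ | ⟨rfl, rfl⟩ | ⟨rfl, rfl⟩ | ⟨rfl, rfl⟩ <;>
  simp [BigonRel, CornerRel, crossingValue, mul_assoc]

theorem bigonRel_unique {G : Type*} [Group G] {κ₁ κ₂ : CrossingKind} {p₁ p₂ : Fin 4}
    (h₁ : CompatibleCorners p₁ p₂) (h₂ : CompatibleCorners p₂ p₁)
    (h : AdmissibleBigon κ₁ κ₂) {s q a₁ a₂ m₁ m₂ b₁ b₂ n₁ n₂ c₁ c₂ : G}
    (hm : BigonRel κ₁ κ₂ s q p₁ p₂ a₁ a₂ m₁ m₂ b₁ b₂)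
    (hn : BigonRel κ₁ κ₂ s q p₁ p₂ a₁ a₂ n₁ n₂ c₁ c₂) : m₁ = n₁ ∧ m₂ = n₂ := by
  obtain ⟨e, e'⟩ := hm
  obtain ⟨f, f'⟩ := hn
  rcases h with ⟨rfl, rfl⟩ | ⟨rfl, rfl⟩ | ⟨rfl, rfl⟩ <;>
  rcases compatibleCorners_bigon p₁ p₂ h₁ h₂ with
    ⟨rfl, rfl⟩ | ⟨rfl, rfl⟩ | ⟨rfl, rfl⟩ | ⟨rfl, rfl⟩ <;>
  · simp only [CornerRel, crossingValue, Matrix.cons_val_zero, Matrix.cons_val_one] at e e' f f'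
    simp [e, e', f, f']

theorem BigonRel.eq {G : Type*} [Group G] {κ₁ κ₂ : CrossingKind} {p₁ p₂ : Fin 4}
    (h₁ : CompatibleCorners p₁ p₂) (h₂ : CompatibleCorners p₂ p₁)
    (h : AdmissibleBigon κ₁ κ₂) {s q a₁ a₂ m₁ m₂ b₁ b₂ : G}
    (hm : BigonRel κ₁ κ₂ s q p₁ p₂ a₁ a₂ m₁ m₂ b₁ b₂) : b₁ = a₁ ∧ b₂ = a₂ := by
  obtain ⟨e, e'⟩ := hm
  rcases h with ⟨rfl, rfl⟩ | ⟨rfl, rfl⟩ | ⟨rfl, rfl⟩ <;>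
  rcases compatibleCorners_bigon p₁ p₂ h₁ h₂ with
    ⟨rfl, rfl⟩ | ⟨rfl, rfl⟩ | ⟨rfl, rfl⟩ | ⟨rfl, rfl⟩ <;>
  · simp only [CornerRel, crossingValue, Matrix.cons_val_zero, Matrix.cons_val_one] at e e'
    obtain ⟨e, i⟩ := e
    obtain ⟨e', i'⟩ := e'
    subst_vars
    constructor <;> simp [mul_assoc]

/-- The crossing relations at the corner of a kink. -/
def KinkRel {G : Type*} [Group G] (κ : CrossingKind) (s q : G) (p : Fin 4) (a m b : G) : Prop :=
  CornerRel κ s q p a m b a m b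

theorem compatibleCorners_kink (p : Fin 4) (h : CompatibleCorners p p) : p = 2 ∨ p = 0 := by
  revert p; decide

/-- If the strand passes over first, the side is a conjugate of the entering value and the claim is
a substitution. If it passes under first, the side occurs in its own equation, and cancelling it
there leaves a formula for `a` that is also the one for `b`. -/
theorem KinkRel.eq {G : Type*} [Group G] {κ : CrossingKind} {p : Fin 4}
    (h : CompatibleCorners p p) {s q a m b : G} (hm : KinkRel κ s q p a m b) : b = a := by
  obtain rfl | rfl := compatibleCorners_kink p h <;> cases κ <;>
  · simp only [KinkRel, CornerRel, crossingValue, Matrix.cons_val_zero, Matrix.cons_val_one] at hm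
    obtain ⟨h1, h2⟩ := hm
    first
    | (subst h2; subst h1; simp [mul_assoc])
    | (subst h1
       have h3 : a = s * m * s⁻¹ := by
         have : m = m * (a * s * m⁻¹ * s⁻¹) := by simpa [mul_assoc] using h2
         have := (mul_eq_left.mp this.symm)
         rw [mul_assoc, mul_assoc, mul_eq_one_iff_eq_inv] at this
         simpa [mul_assoc] using this
       exact h3.symm)
    | (subst h2
       have : m = s⁻¹ * m⁻¹ * s * a * m := h1
       have := (mul_eq_right.mp this.symm)
       rw [mul_eq_one_iff_inv_eq] at this
       rw [← this]
       simp [mul_assoc])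

theorem exists_kinkRel {G : Type*} [Group G] {κ : CrossingKind} {p : Fin 4}
    (h : CompatibleCorners p p) (s q a : G) : ∃ m, KinkRel κ s q p a m a := by
  obtain rfl | rfl := compatibleCorners_kink p h <;> cases κ
  · exact ⟨s * a * s⁻¹, by simp [KinkRel, CornerRel, crossingValue, mul_assoc]⟩
  · exact ⟨s * a * s⁻¹, by simp [KinkRel, CornerRel, crossingValue, mul_assoc]⟩
  · exact ⟨q * a * q⁻¹, by simp [KinkRel, CornerRel, crossingValue, mul_assoc]⟩
  · exact ⟨s⁻¹ * a * s, by simp [KinkRel, CornerRel, crossingValue, mul_assoc]⟩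
  · exact ⟨s⁻¹ * a * s, by simp [KinkRel, CornerRel, crossingValue, mul_assoc]⟩
  · exact ⟨q⁻¹ * a * q, by simp [KinkRel, CornerRel, crossingValue, mul_assoc]⟩

/-- Once the leaving value is known to be `a`, one of the two relations makes `m` and `a` conjugate
by `s` or `q`. -/
theorem kinkRel_unique {G : Type*} [Group G] {κ : CrossingKind} {p : Fin 4}
    (h : CompatibleCorners p p) {s q a m b n c : G} (hm : KinkRel κ s q p a m b)
    (hn : KinkRel κ s q p a n c) : m = n := by
  have hb := hm.eq h
  have hc := hn.eq h
  subst hb hc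
  have key : ∀ x y z : G, x * y * x⁻¹ = x * z * x⁻¹ → y = z := by simp
  have key' : ∀ x y z : G, x⁻¹ * y * x = x⁻¹ * z * x → y = z := by simp
  obtain rfl | rfl := compatibleCorners_kink p h <;> cases κ <;>
  · simp only [KinkRel, CornerRel, crossingValue, Matrix.cons_val_zero, Matrix.cons_val_one] at hm hn
    first
    | exact hm.1.trans hn.1.symm
    | exact hm.2.trans hn.2.symm
    | exact key _ _ _ (hm.1.symm.trans hn.1)
    | exact key' _ _ _ (hm.2.symm.trans hn.2)

/-! ### The affine group and crossed homomorphisms -/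

section AffineGroup

variable {n : ℕ} {L : Type*} [CommRing L]

/-- The action of the invertible matrices on the vectors. -/
def vecAction (n : ℕ) (L : Type*) [CommRing L] :
    (Matrix (Fin n) (Fin n) L)ˣ →* MulAut (Multiplicative (Fin n → L)) where
  toFun g :=
    { toFun := fun v => Multiplicative.ofAdd ((g : Matrix (Fin n) (Fin n) L).mulVec v.toAdd)
      invFun := fun v => Multiplicative.ofAdd
        ((↑g⁻¹ : Matrix (Fin n) (Fin n) L).mulVec v.toAdd)
      left_inv := fun v => by simp
      right_inv := fun v => by simp
      map_mul' := fun v w => by simp [Matrix.mulVec_add] }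
  map_one' := by ext; simp
  map_mul' g h := by ext; simp

/-- The group of the affine maps `x ↦ g x + v` with `g` invertible. -/
abbrev AffGroup (n : ℕ) (L : Type*) [CommRing L] : Type _ :=
  Multiplicative (Fin n → L) ⋊[vecAction n L] (Matrix (Fin n) (Fin n) L)ˣ

/-- The affine map with linear part `g` and translation part `v`. -/
def affMk (v : Fin n → L) (g : (Matrix (Fin n) (Fin n) L)ˣ) : AffGroup n L :=
  ⟨Multiplicative.ofAdd v, g⟩

/-- The translation part of an affine map. -/
def AffGroup.trans (a : AffGroup n L) : Fin n → L := a.left.toAdd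

/-- The linear part of an affine map. -/
def AffGroup.lin (a : AffGroup n L) : (Matrix (Fin n) (Fin n) L)ˣ := a.right

@[simp] theorem AffGroup.trans_mk (v : Fin n → L) (g : (Matrix (Fin n) (Fin n) L)ˣ) :
    (affMk v g).trans = v := rfl

@[simp] theorem AffGroup.lin_mk (v : Fin n → L) (g : (Matrix (Fin n) (Fin n) L)ˣ) :
    (affMk v g).lin = g := rfl

@[simp] theorem AffGroup.trans_one : (1 : AffGroup n L).trans = 0 := rfl

@[simp] theorem AffGroup.lin_one : (1 : AffGroup n L).lin = 1 := rfl

@[simp] theorem AffGroup.lin_mul (a b : AffGroup n L) : (a * b).lin = a.lin * b.lin := rfl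

@[simp] theorem AffGroup.lin_inv (a : AffGroup n L) : a⁻¹.lin = a.lin⁻¹ := rfl

@[simp] theorem AffGroup.trans_mul (a b : AffGroup n L) :
    (a * b).trans = a.trans + (a.lin : Matrix (Fin n) (Fin n) L).mulVec b.trans := rfl

@[simp] theorem AffGroup.trans_inv (a : AffGroup n L) :
    a⁻¹.trans = -((↑a.lin⁻¹ : Matrix (Fin n) (Fin n) L).mulVec a.trans) := by
  change (↑a.lin⁻¹ : Matrix (Fin n) (Fin n) L).mulVec (-a.trans) = _
  rw [Matrix.mulVec_neg]

theorem AffGroup.ext {a b : AffGroup n L} (h : a.trans = b.trans) (h' : a.lin = b.lin) : a = b :=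
  SemidirectProduct.ext h h'

/-- The homomorphism from the affine maps to their linear parts. -/
def AffGroup.linHom : AffGroup n L →* (Matrix (Fin n) (Fin n) L)ˣ := SemidirectProduct.rightHom

@[simp] theorem AffGroup.linHom_apply (a : AffGroup n L) : AffGroup.linHom a = a.lin := rfl

/-- The homomorphism from a free group to the affine maps that sends the generator `x` to the affine
map with linear part `g x` and translation part `v x`. -/
def affLift {X : Type} (g : X → (Matrix (Fin n) (Fin n) L)ˣ) (v : X → Fin n → L) :
    FreeGroup X →* AffGroup n L :=
  FreeGroup.lift fun x => affMk (v x) (g x)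

@[simp] theorem affLift_of {X : Type} (g : X → (Matrix (Fin n) (Fin n) L)ˣ) (v : X → Fin n → L)
    (x : X) : affLift g v (FreeGroup.of x) = affMk (v x) (g x) := by simp [affLift]

theorem lin_affLift {X : Type} (g : X → (Matrix (Fin n) (Fin n) L)ˣ) (v : X → Fin n → L)
    (w : FreeGroup X) : (affLift g v w).lin = FreeGroup.lift g w := by
  have : AffGroup.linHom.comp (affLift g v) = FreeGroup.lift g := by
    ext x : 1; simp
  exact DFunLike.congr_fun this w

/-- A principal crossed homomorphism. -/
theorem trans_affLift_principal {X : Type} (g : X → (Matrix (Fin n) (Fin n) L)ˣ) (c : Fin n → L)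
    (w : FreeGroup X) :
    (affLift g (fun x => c - (g x : Matrix (Fin n) (Fin n) L).mulVec c) w).trans =
      c - (FreeGroup.lift g w : Matrix (Fin n) (Fin n) L).mulVec c := by
  -- Conjugating a linear map by the translation by `c` gives the translation part c - gc.
  have : affLift g (fun x => c - (g x : Matrix (Fin n) (Fin n) L).mulVec c) =
      (MulAut.conj (affMk c 1)).toMonoidHom.comp (affLift g 0) := by
    ext x : 1
    apply AffGroup.ext <;> simp [sub_eq_add_neg, Matrix.mulVec_neg]
  rw [this]
  have h0 : ∀ w, (affLift g 0 w).trans = 0 := by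
    intro w
    induction w using FreeGroup.induction_on with
    | C1 => simp
    | of x => simp
    | inv_of x h => simp
    | mul x y hx hy => simp [hx, hy]
  simp [lin_affLift, h0, sub_eq_add_neg, Matrix.mulVec_neg]

/-- For the relator [s,q]: differentiating with respect to the second letter gives the coefficient g
- 1. -/
theorem trans_commutator {g h : (Matrix (Fin n) (Fin n) L)ˣ} (hgh : g * h = h * g)
    (v : Fin n → L) : (affMk 0 g * affMk v h * (affMk 0 g)⁻¹ * (affMk v h)⁻¹).trans =
      (g : Matrix (Fin n) (Fin n) L).mulVec v - v := by
  have hc : g * h * g⁻¹ * h⁻¹ = 1 := by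
    rw [mul_inv_eq_one, mul_inv_eq_iff_eq_mul, hgh]
  have h1 : (affMk 0 g * affMk v h * (affMk 0 g)⁻¹ * (affMk v h)⁻¹).trans =
      (g : Matrix (Fin n) (Fin n) L).mulVec v -
        (↑(g * h * g⁻¹ * h⁻¹) : Matrix (Fin n) (Fin n) L).mulVec v := by
    simp [Matrix.mulVec_neg, Matrix.mulVec_add, sub_eq_add_neg, mul_assoc]
  rw [h1, hc, Units.val_one, Matrix.one_mulVec]

end AffineGroup

/-! ### Fox derivatives as crossed homomorphisms -/

section FoxSum

variable {Γ : Type} [Group Γ] {d n : ℕ} {R : Type*} [CommRing R]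

/-- The representation `g ↦ α(g) • ρ(g)` by invertible matrices. -/
noncomputable def unitRep (α : Γ →* Multiplicative (Fin d → ℤ)) (ρ : Γ →* GL (Fin n) R) :
    Γ →* (Matrix (Fin n) (Fin n) (LaurentRing d R))ˣ :=
  (rhoTensorAlpha α ρ).toHomUnits

theorem coe_unitRep (α : Γ →* Multiplicative (Fin d → ℤ)) (ρ : Γ →* GL (Fin n) R) (g : Γ) :
    (unitRep α ρ g : Matrix (Fin n) (Fin n) (LaurentRing d R)) = rhoTensorAlpha α ρ g := rfl

theorem Omega_of {X : Type} (φ : FreeGroup X →* Γ) (α : Γ →* Multiplicative (Fin d → ℤ))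
    (ρ : Γ →* GL (Fin n) R) (w : FreeGroup X) :
    Omega φ α ρ (MonoidAlgebra.of ℤ (FreeGroup X) w) = unitRep α ρ (φ w) := by
  simp [Omega, coe_unitRep]

/-- The Fox derivatives of a word `w` give the crossed homomorphism with prescribed values on the
generators. -/
theorem sum_Omega_foxDeriv {X : Type} [Fintype X] [DecidableEq X] (φ : FreeGroup X →* Γ) (α : Γ →* Multiplicative (Fin d → ℤ))
    (ρ : Γ →* GL (Fin n) R) (v : X → Fin n → LaurentRing d R) (w : FreeGroup X) :
    ∑ x, (Omega φ α ρ (foxDeriv x w)).mulVec (v x) =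
      (affLift (fun x => unitRep α ρ (φ (FreeGroup.of x))) v w).trans := by
  -- The formula holds for all words, reduced or not, so that induction on the letters is possible.
  have key : ∀ l : List (X × Bool), ∑ x, (Omega φ α ρ (foxWord x l)).mulVec (v x) =
      (affLift (fun x => unitRep α ρ (φ (FreeGroup.of x))) v (FreeGroup.mk l)).trans := by
    intro l
    induction l with
    | nil => simp [foxWord, FreeGroup.one_eq_mk.symm]
    | cons a l ih =>
      have hcons : FreeGroup.mk (a :: l) = FreeGroup.mk [a] * FreeGroup.mk l := by
        rw [FreeGroup.mul_mk]; rfl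
      have hone : ∀ i : X, ∑ x, (Omega φ α ρ (if i = x then 1 else 0)).mulVec (v x) = v i := by
        intro i
        rw [Finset.sum_eq_single i]
        · simp
        · intro x _ hx; simp [Ne.symm hx]
        · simp
      obtain ⟨i, _ | _⟩ := a
      · have hi : FreeGroup.mk [(i, false)] = (FreeGroup.of i)⁻¹ := rfl
        rw [hcons, map_mul, hi, map_inv, affLift_of]
        simp only [foxWord, map_mul, map_sub, Omega_of, ← Matrix.mulVec_mulVec, Matrix.sub_mulVec,
          ← Matrix.mulVec_sum, Finset.sum_sub_distrib, hone, ih]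
        simp [sub_eq_add_neg, Matrix.mulVec_add, Matrix.mulVec_neg, add_comm]
      · have hi : FreeGroup.mk [(i, true)] = FreeGroup.of i := rfl
        rw [hcons, map_mul, hi, affLift_of]
        simp only [foxWord, map_mul, map_add, Omega_of, ← Matrix.mulVec_mulVec, Matrix.add_mulVec,
          ← Matrix.mulVec_sum, Finset.sum_add_distrib, hone, ih]
        simp
  rw [← FreeGroup.mk_toWord (x := w), ← key, FreeGroup.mk_toWord]
  rfl

end FoxSum

/-! ### Block columns, Schur complements and merging of variables -/

section Determinants

variable {L : Type*} [CommRing L]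

/-- A permutation of the blocks acts in the same way on each of the `n` positions inside a block, so
its sign enters with exponent `n`. -/
theorem det_submatrix_blockPerm {Y Z : Type*} [Fintype Y] [DecidableEq Y] {n : ℕ}
    (M : Matrix (Y × Fin n) (Z × Fin n) L) (e e' : Y ≃ Z) :
    ∃ σ : ℤˣ, (M.submatrix id (fun p : Y × Fin n => (e p.1, p.2))).det =
      (((σ ^ n : ℤˣ) : ℤ) : L) * (M.submatrix id (fun p : Y × Fin n => (e' p.1, p.2))).det := by
  refine ⟨Equiv.Perm.sign (e.trans e'.symm), ?_⟩
  have h := Matrix.det_permute' (Equiv.prodCongrLeft fun _ : Fin n => e.trans e'.symm)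
    (M.submatrix id (fun p : Y × Fin n => (e' p.1, p.2)))
  rw [Equiv.Perm.sign_prodCongrLeft] at h
  simp only [Finset.prod_const, Finset.card_univ, Fintype.card_fin] at h
  rw [← h]
  congr 1
  ext i j
  simp

/-- The determinants of the matrices obtained by deleting block columns are proportional to the
determinants of the blocks of a block vector in the kernel. -/
theorem det_deleteBlockColumn {X Y : Type*} [Fintype X] [DecidableEq X] [Fintype Y] [DecidableEq Y]
    {n : ℕ} (M : Matrix (Y × Fin n) (X × Fin n) L) (β : X → Matrix (Fin n) (Fin n) L)
    (hβ : ∀ y i i', ∑ x, ∑ k, M (y, i) (x, k) * β x k i' = 0)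
    (j k : X) (e : Y ≃ {x : X // x ≠ j}) (e' : Y ≃ {x : X // x ≠ k}) :
    ∃ σ : ℤˣ, (M.submatrix id (fun p : Y × Fin n => ((e p.1 : X), p.2))).det * (β k).det =
      (((σ ^ n : ℤˣ) : ℤ) : L) *
        ((M.submatrix id (fun p : Y × Fin n => ((e' p.1 : X), p.2))).det * (β j).det) := by
  classical
  by_cases hjk : j = k
  · subst hjk
    obtain ⟨σ, hσ⟩ := det_submatrix_blockPerm
      (M.submatrix id (fun p : {x : X // x ≠ j} × Fin n => ((p.1 : X), p.2))) e e'
    refine ⟨σ, ?_⟩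
    simp only [Matrix.submatrix_submatrix] at hσ
    rw [← mul_assoc]
    congr 1
  · let sw : {x : X // x ≠ j} ≃ {x : X // x ≠ k} :=
      (Equiv.swap j k).subtypeEquiv (fun a => by
        rw [not_iff_not, Equiv.swap_apply_eq_iff, Equiv.swap_apply_right])
    -- `e₁` orders the columns as `e` does, except that the block column `j` takes the place `y₀` of
    -- the block column `k`.
    let e₁ : Y ≃ {x : X // x ≠ k} := e.trans sw
    obtain ⟨σ, hσ⟩ := det_submatrix_blockPerm
      (M.submatrix id (fun p : {x : X // x ≠ k} × Fin n => ((p.1 : X), p.2))) e₁ e'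
    simp only [Matrix.submatrix_submatrix] at hσ
    let y₀ : Y := e.symm ⟨k, Ne.symm hjk⟩
    have hy₀ : (e y₀ : X) = k := by simp [y₀]
    have he₁ : ∀ y, (e₁ y : X) = if y = y₀ then j else (e y : X) := by
      intro y
      change Equiv.swap j k (e y : X) = _
      split_ifs with h
      · rw [h, hy₀, Equiv.swap_apply_right]
      · refine Equiv.swap_apply_of_ne_of_ne (e y).2 fun h' => h ?_
        apply e.injective
        apply Subtype.ext
        rw [h', hy₀]
    let W₀ : Matrix (Fin n) (Y × Fin n) L :=
      Matrix.of fun i p => if p = (y₀, i) then 1 else 0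
    let U₁ : Matrix (Y × Fin n) (Fin n) L := Matrix.of fun p i =>
      if p.1 = y₀ then β j p.2 i - (1 : Matrix (Fin n) (Fin n) L) p.2 i else 0
    let U₂ : Matrix (Y × Fin n) (Fin n) L := Matrix.of fun p i =>
      -β (e p.1) p.2 i - if p = (y₀, i) then 1 else 0
    let N₁ := M.submatrix id (fun p : Y × Fin n => ((e₁ p.1 : X), p.2))
    let N := M.submatrix id (fun p : Y × Fin n => ((e p.1 : X), p.2))
    have hW : ∀ (B : Matrix (Y × Fin n) (Fin n) L) i i', (W₀ * B) i i' = B (y₀, i) i' := by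
      intro B i i'
      simp [W₀, Matrix.mul_apply]
    have hWU₁ : W₀ * U₁ = β j - 1 := by
      ext i i'
      simp [hW, U₁]
    have hWU₂ : W₀ * U₂ = -β k - 1 := by
      ext i i'
      simp [hW, U₂, hy₀, Matrix.one_apply]
    have hUW : ∀ (A : Matrix (Y × Fin n) (Fin n) L) p q,
        (A * W₀) p q = if q.1 = y₀ then A p q.2 else 0 := by
      intro A p q
      rw [Matrix.mul_apply]
      split_ifs with h
      · rw [Finset.sum_eq_single q.2]
        · simp [W₀, Prod.ext_iff, h]
        · intro b _ hb
          simp [W₀, Prod.ext_iff, Ne.symm hb]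
        · simp
      · simp [W₀, Prod.ext_iff, h]
    have hN₁U : ∀ p i, (N₁ * U₁) p i = (∑ k, M p (j, k) * β j k i) - M p (j, i) := by
      intro p i
      rw [Matrix.mul_apply, Fintype.sum_prod_type, Finset.sum_eq_single y₀]
      · simp [N₁, U₁, he₁, mul_sub, Finset.sum_sub_distrib, Matrix.one_apply]
      · intro y _ hy
        simp [U₁, hy]
      · simp
    have hNU : ∀ p i, (N * U₂) p i = (∑ k, M p (j, k) * β j k i) - M p (k, i) := by
      intro p i
      have h0 := hβ p.1 p.2 i
      rw [← Finset.add_sum_erase _ _ (Finset.mem_univ j)] at h0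
      have h1 : ∑ x ∈ Finset.univ.erase j, ∑ k, M (p.1, p.2) (x, k) * β x k i =
          ∑ y, ∑ k, M (p.1, p.2) (e y, k) * β (e y) k i := by
        rw [Finset.sum_subtype (Finset.univ.erase j) (p := fun x => x ≠ j) (by simp)]
        exact (e.sum_comp (fun x : {x : X // x ≠ j} =>
          ∑ k, M (p.1, p.2) (x, k) * β x k i)).symm
      rw [h1] at h0
      rw [Matrix.mul_apply, Fintype.sum_prod_type]
      simp only [N, U₂, Matrix.of_apply, mul_sub, Finset.sum_sub_distrib, Matrix.submatrix_apply, id, mul_neg,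
        Finset.sum_neg_distrib, Prod.mk.injEq, mul_ite, mul_one, mul_zero]
      rw [eq_neg_of_add_eq_zero_left h0]
      congr 1
      rw [Finset.sum_eq_single y₀]
      · simp [hy₀]
      · intro y _ hy; simp [hy]
      · simp
    -- Both sides have M_j β_j as block column `y₀`: on the left the column M_j is multiplied by
    -- β_j, on the right M_j β_j is written as -Σ M_x β_x over the other columns by the kernel
    -- relation. The other columns agree.
    have hmat : N₁ * (1 + U₁ * W₀) = N * (1 + U₂ * W₀) := by
      ext p q
      rw [mul_add, mul_add, ← Matrix.mul_assoc, ← Matrix.mul_assoc, mul_one, mul_one,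
        Matrix.add_apply, Matrix.add_apply, hUW, hUW, hN₁U, hNU]
      obtain ⟨y, i⟩ := q
      simp only [N₁, N, Matrix.submatrix_apply, id, he₁]
      split_ifs with h
      · rw [h, hy₀]; ring
      · rfl
    have hdet := congrArg Matrix.det hmat
    -- By det(1 + UW) = det(1 + WU) the two column operations have determinants det β_j and
    -- det(-β_k).
    rw [Matrix.det_mul, Matrix.det_mul, Matrix.det_one_add_mul_comm U₁,
      Matrix.det_one_add_mul_comm U₂,
      hWU₁, hWU₂, add_sub_cancel, add_sub_cancel, Matrix.det_neg, Fintype.card_fin] at hdet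
    refine ⟨-σ, ?_⟩
    have hN₁ : N₁.det = (((σ ^ n : ℤˣ) : ℤ) : L) *
        (M.submatrix id (fun p : Y × Fin n => ((e' p.1 : X), p.2))).det := hσ
    have hs : ((-1 : L) ^ n) * (-1) ^ n = 1 := by rw [← mul_pow]; simp
    calc N.det * (β k).det = (-1) ^ n * (N.det * ((-1) ^ n * (β k).det)) := by
          linear_combination (-(N.det * (β k).det)) * hs
      _ = _ := by
        rw [← hdet, hN₁, neg_pow]
        push_cast
        ring

/-- The Schur complement of the block of the inner indices. -/
theorem exists_schurComplement {ι : Type*} [Fintype ι] [DecidableEq ι] (M : Matrix ι ι L)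
    (p : ι → Prop) [DecidablePred p] (hp : IsUnit (M.toSquareBlockProp p).det) :
    ∃ W : Matrix {i // ¬p i} {i // ¬p i} L, M.det = (M.toSquareBlockProp p).det * W.det ∧
      ∀ u : {i // ¬p i} → L, ∃ v : ι → L, (∀ i, v i.1 = u i) ∧ (∀ i, p i → M.mulVec v i = 0) ∧
        ∀ i, W.mulVec u i = M.mulVec v i.1 := by
  set A := M.toSquareBlockProp p with hA
  set B : Matrix {i // p i} {i // ¬p i} L := M.toBlock p (fun i => ¬p i)
  set C : Matrix {i // ¬p i} {i // p i} L := M.toBlock (fun i => ¬p i) p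
  set D := M.toSquareBlockProp (fun i => ¬p i)
  have hM : M.det = (Matrix.fromBlocks A B C D).det := by
    rw [Matrix.det_toBlock M p]; rfl
  let := A.invertibleOfIsUnitDet hp
  refine ⟨D - C * ⅟A * B, by rw [hM, Matrix.det_fromBlocks₁₁], fun u => ?_⟩
  -- The inner variables are solved for in terms of the outer ones, so that all inner equations
  -- hold.
  let w : {i // p i} → L := -((⅟A * B).mulVec u)
  let v : ι → L := fun i => if h : p i then w ⟨i, h⟩ else u ⟨i, h⟩
  have hsum : ∀ i, M.mulVec v i = ∑ j : {j // p j}, M i j * w j + ∑ j : {j // ¬p j}, M i j * u j := by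
    intro i
    rw [Matrix.mulVec, dotProduct, ← Fintype.sum_subtype_add_sum_subtype p]
    congr 1 <;> refine Finset.sum_congr rfl fun j _ => ?_ <;> simp [v, j.2]
  refine ⟨v, fun i => by simp [v, i.2], fun i hi => ?_, fun i => ?_⟩
  · rw [hsum]
    change A.mulVec w ⟨i, hi⟩ + B.mulVec u ⟨i, hi⟩ = 0
    simp [w, Matrix.mulVec_neg]
  · rw [hsum]
    change _ = C.mulVec w i + D.mulVec u i
    simp [w, Matrix.mulVec_neg, Matrix.sub_mulVec, Matrix.mul_assoc, neg_add_eq_sub]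

theorem det_eq_of_forall_mulVec {ι ι' : Type*} [Fintype ι] [DecidableEq ι] [Fintype ι']
    [DecidableEq ι'] (M : Matrix ι ι L) (M' : Matrix ι' ι' L) (e : ι ≃ ι')
    (h : ∀ v i, M.mulVec (v ∘ e) i = M'.mulVec v (e i)) : M.det = M'.det := by
  rw [← Matrix.det_submatrix_equiv_self e M']
  congr 1
  apply Matrix.ext_of_mulVec_single
  intro j
  ext i
  rw [Matrix.submatrix_mulVec_equiv, Function.comp_apply, ← h]
  congr 2
  ext k
  simp

/-- A row has off-diagonal entries only in columns of smaller rank, so the matrix is unitriangular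
when ordered by rank. -/
theorem det_eq_one_of_rank {ι : Type*} [Fintype ι] [DecidableEq ι] (M : Matrix ι ι L) (r : ι → ℕ)
    (h : ∀ i j, r i ≤ r j → M i j = (1 : Matrix ι ι L) i j) : M.det = 1 := by
  have hM : M.BlockTriangular (fun i => OrderDual.toDual (r i)) := by
    intro i j hij
    have hij : r i < r j := hij
    rw [h i j hij.le, Matrix.one_apply_ne]
    rintro rfl
    exact lt_irrefl _ hij
  rw [hM.det]
  refine Finset.prod_eq_one fun a _ => ?_
  have : M.toSquareBlock (fun i => OrderDual.toDual (r i)) a = 1 := by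
    ext i j
    rw [Matrix.toSquareBlock_def, Matrix.of_apply, h, Matrix.one_apply, Matrix.one_apply]
    · simp [Subtype.ext_iff]
    · exact (OrderDual.toDual.injective (i.2.trans j.2.symm)).le
  rw [this, Matrix.det_one]

/-- If some of the equations say that variables are equal, then these variables can be identified;
a class in which every variable has such an equation keeps a trivial equation. -/
theorem det_eq_of_merge (N : ℕ) : ∀ {ι ι' : Type} [Fintype ι] [DecidableEq ι] [Fintype ι']
    [DecidableEq ι'], Fintype.card ι = N → ∀ (W : Matrix ι ι L) (W' : Matrix ι' ι' L) (B : ι → Prop)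
    (f : ι → ι) (π : ι → ι'), Function.Surjective π → (∀ b, B b → π b = π (f b)) →
    (∀ a b, π a = π b → ∀ (T : Type) (F : ι → T), (∀ b, B b → F b = F (f b)) → F a = F b) →
    (∀ v b, B b → W.mulVec v b = v b - v (f b)) →
    (∀ v' i, ¬B i → W.mulVec (v' ∘ π) i = W'.mulVec v' (π i)) →
    (∀ v' i', (∀ i, ¬B i → π i ≠ i') → W'.mulVec v' i' = 0) → W.det = W'.det := by
  classical
  induction N with
  | zero =>
    intro ι ι' _ _ _ _ hN W W' B f π hπ _ _ _ _ _
    have : IsEmpty ι := Fintype.card_eq_zero_iff.mp hN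
    have : IsEmpty ι' := ⟨fun i => by obtain ⟨j, -⟩ := hπ i; exact isEmptyElim j⟩
    simp
  | succ N ih =>
    intro ι ι' _ _ _ _ hN W W' B f π hπ hf huniv h1 h2 h3
    -- Each nontrivial equation v b = v (f b) has pivot 1 at `b`. Eliminating `b` keeps the
    -- determinant and lowers the number of variables; pointers to `b` are redirected to `f b`.
    by_cases hB : ∃ b, B b ∧ f b ≠ b
    · obtain ⟨b, hb, hfb⟩ := hB
      have hsq : (W.toSquareBlockProp (· = b)).det = 1 := by
        let _ : Unique {i // i = b} := ⟨⟨⟨b, rfl⟩⟩, fun i => Subtype.ext i.2⟩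
        rw [Matrix.det_unique]
        change W b b = 1
        have := h1 (Pi.single b 1) b hb
        rw [Matrix.mulVec_single_one] at this
        simpa [hfb] using this
      obtain ⟨W₁, hdet, hW₁⟩ := exists_schurComplement W (· = b) (by
        convert isUnit_one (M := L)
        convert hsq)
      have hdet : W.det = W₁.det := by
        rw [hdet]
        convert one_mul W₁.det
        convert hsq
      rw [hdet]
      have hval : ∀ v : ι → L, W.mulVec v b = 0 → v b = v (f b) := fun v hv => by
        rw [h1 v b hb, sub_eq_zero] at hv; exact hv
      have hb₀ : ¬(f b = b) := hfb
      refine ih (ι := {i // ¬i = b}) ?_ W₁ W' (fun i => B i)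
        (fun i => if h : f i = b then ⟨f b, hfb⟩ else ⟨f i, h⟩) (fun i => π i) ?_ ?_ ?_ ?_ ?_ ?_
      · rw [Fintype.card_subtype_compl, Fintype.card_subtype_eq, hN, Nat.add_sub_cancel]
      · intro i'
        obtain ⟨i, rfl⟩ := hπ i'
        by_cases h : i = b
        · exact ⟨⟨f b, hfb⟩, by rw [h]; exact (hf b hb).symm⟩
        · exact ⟨⟨i, h⟩, rfl⟩
      · intro i hi
        split_ifs with h
        · rw [hf i hi, h, hf b hb]
        · exact hf i hi
      · intro i j hij T F hF
        have := huniv i j hij T (fun a => if h : a = b then F ⟨f b, hfb⟩ else F ⟨a, h⟩) ?_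
        · simpa [i.2, j.2] using this
        · intro a ha
          by_cases hab : a = b
          · simp [hab, hfb]
          · have := hF ⟨a, hab⟩ ha
            by_cases hfa : f a = b
            · simpa [hab, hfa] using this
            · simpa [hab, hfa] using this
      · intro v i hi
        obtain ⟨w, hwv, hw0, hw⟩ := hW₁ v
        rw [hw, h1 w i hi, ← hwv]
        congr 1
        split_ifs with h
        · rw [h, hval w (hw0 b rfl), ← hwv]
        · rw [← hwv]
      · intro v' i hi
        obtain ⟨w, hwv, hw0, hw⟩ := hW₁ (v' ∘ fun i => π i)
        have : w = v' ∘ π := by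
          ext a
          by_cases h : a = b
          · rw [h, hval w (hw0 b rfl), hwv ⟨f b, hfb⟩, Function.comp, Function.comp, hf b hb]
          · exact hwv ⟨a, h⟩
        rw [hw, this, h2 v' i hi]
      · intro v' i' hi'
        refine h3 v' i' fun i hi hii' => ?_
        by_cases h : i = b
        · exact hi (h ▸ hb)
        · exact hi' ⟨i, h⟩ hi hii'
    · push Not at hB
      -- No nontrivial identification is left. As `π` identifies only what the equations generate,
      -- testing with the identity function shows that it is injective; the remaining marked rows
      -- vanish on both sides.
      have hinj : Function.Injective π := fun a b hab =>
        huniv a b hab ι id fun c hc => (hB c hc).symm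
      let e : ι ≃ ι' := Equiv.ofBijective π ⟨hinj, hπ⟩
      refine det_eq_of_forall_mulVec W W' e fun v i => ?_
      change W.mulVec (v ∘ π) i = W'.mulVec v (π i)
      by_cases hi : B i
      · rw [h1 _ _ hi, hB i hi, sub_self, h3]
        intro k hk hki
        exact hk (hinj hki ▸ hi)
      · rw [← h2 _ _ hi]

end Determinants

/-! ### The denominators and the arc matrix of a diagram -/

theorem map_crossingValue {G H : Type*} [Group G] [Group H] (f : G →* H) (κ : CrossingKind)
    (s q x y : G) (i : Fin 2) :
    f (crossingValue κ s q x y i) = crossingValue κ (f s) (f q) (f x) (f y) i := by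
  cases κ <;> fin_cases i <;> simp [crossingValue]

/-- The denominator is det(1 - XA) evaluated at a nontrivial monomial X. This polynomial has
constant term 1, and no positive power of X is trivial because ℤ^d is torsion-free, so the
coefficient at 0 is 1. -/
theorem twistedDenominator_ne_zero {X Γ : Type} [Group Γ] {d n : ℕ} {R : Type*} [CommRing R]
    [IsDomain R] (φ : FreeGroup X →* Γ) (α : Γ →* Multiplicative (Fin d → ℤ))
    (ρ : Γ →* GL (Fin n) R) (j : X) (hα : α (φ (FreeGroup.of j)) ≠ 1) :
    twistedDenominator φ α ρ j ≠ 0 := by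
  set e : Fin d → ℤ := (α (φ (FreeGroup.of j))).toAdd with he
  have he0 : e ≠ 0 := hα
  set A : Matrix (Fin n) (Fin n) R := ↑(ρ (φ (FreeGroup.of j)))
  have h1 : twistedDenominator φ α ρ j =
      Polynomial.aeval (laurentMonomial R e) A.charpolyRev := by
    rw [twistedDenominator, Matrix.charpolyRev, AlgHom.map_det, map_sub, map_one, Omega_of]
    congr 1
    refine Matrix.ext fun i k => ?_
    rw [coe_unitRep]
    simp only [rhoTensorAlpha, MonoidHom.coe_mk, OneHom.coe_mk, Matrix.sub_apply, Matrix.smul_apply,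
      Matrix.map_apply, smul_eq_mul, AlgHom.mapMatrix_apply, RingHom.mapMatrix_apply, map_sub,
      map_mul, Polynomial.aeval_X, Polynomial.aeval_C, A, e, Matrix.one_apply, map_one]
  intro h0
  rw [h1, Polynomial.aeval_eq_sum_range] at h0
  have hpow : ∀ k : ℕ, laurentMonomial R e ^ k = AddMonoidAlgebra.single (k • e) 1 := by
    intro k
    simp [laurentMonomial, AddMonoidAlgebra.single_pow]
  have h2 := congrArg (fun f => f.coeff 0) h0
  simp only [hpow, AddMonoidAlgebra.coeff_sum, AddMonoidAlgebra.coeff_smul,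
    AddMonoidAlgebra.coeff_zero, Finsupp.finsetSum_apply, Finsupp.smul_apply,
    AddMonoidAlgebra.coeff_single, Finsupp.single_apply] at h2
  rw [Finset.sum_eq_single 0] at h2
  · have h3 : A.charpolyRev.coeff 0 = 1 := by
      rw [Polynomial.coeff_zero_eq_eval_zero, Matrix.eval_charpolyRev]
    simp [h3] at h2
  · intro k _ hk
    rw [if_neg (smul_ne_zero hk he0), smul_zero]
  · simp

namespace SurfaceDiagram

variable (D : SurfaceDiagram)

theorem lift_outWord {G : Type*} [Group G] (f : D.Gen → G) (c : D.Crossing) (i : Fin 2) :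
    FreeGroup.lift f (D.outWord c i) = crossingValue (D.kind c) (f (Sum.inr 0)) (f (Sum.inr 1))
      (f (Sum.inl (D.inc c 0))) (f (Sum.inl (D.inc c 1))) i := by
  unfold outWord crossingValue
  cases D.kind c <;> fin_cases i <;> simp [arcWord, sWord, qWord]

theorem relator_none_eq_one : PresentedGroup.mk (Set.range D.relator) (D.relator none) = 1 :=
  PresentedGroup.one_of_mem ⟨none, rfl⟩

theorem arcGen_out (c : D.Crossing) (i : Fin 2) :
    D.arcGen (D.out c i) = crossingValue (D.kind c) D.sGen D.qGen
      (D.arcGen (D.inc c 0)) (D.arcGen (D.inc c 1)) i := by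
  have h : PresentedGroup.mk (Set.range D.relator) (D.relator (some (c, i))) = 1 :=
    PresentedGroup.one_of_mem ⟨some (c, i), rfl⟩
  rw [relator, map_mul, map_inv, mul_inv_eq_one] at h
  have h' : PresentedGroup.mk (Set.range D.relator) =
      FreeGroup.lift fun x => (PresentedGroup.of x : D.VG) := by
    ext x
    simp
    rfl
  refine h.trans ?_
  rw [h', lift_outWord]
  rfl

theorem sGen_mul_qGen : D.sGen * D.qGen = D.qGen * D.sGen := by
  have h := D.relator_none_eq_one
  rw [relator, map_mul, map_mul, map_mul, map_inv, map_inv, mul_inv_eq_one, mul_inv_eq_iff_eq_mul]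
    at h
  exact h

open Classical in
/-- The word that the crossing relation assigns to an arc; a closed component without crossings has
the trivial relation. -/
noncomputable def arcEquationWord (a : D.Arc) : FreeGroup D.Gen :=
  if h : ∃ p : D.Crossing × Fin 2, D.out p.1 p.2 = a then D.outWord h.choose.1 h.choose.2
  else D.arcWord a

theorem arcEquationWord_out (c : D.Crossing) (i : Fin 2) :
    D.arcEquationWord (D.out c i) = D.outWord c i := by
  have h : ∃ p : D.Crossing × Fin 2, D.out p.1 p.2 = D.out c i := ⟨(c, i), rfl⟩
  have h' : h.choose = (c, i) := D.out_injective h.choose_spec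
  rw [arcEquationWord, dif_pos h, h']

theorem arcEquationWord_of_forall_ne (a : D.Arc) (ha : ∀ c i, D.out c i ≠ a) :
    D.arcEquationWord a = D.arcWord a := by
  rw [arcEquationWord, dif_neg]
  rintro ⟨p, hp⟩
  exact ha _ _ hp

variable {n : ℕ} {R : Type*} [CommRing R] (ρ : D.VG →* GL (Fin n) R)

/-- The matrix of the linearized crossing relations in the variables of the arcs. -/
noncomputable def arcMatrix :
    Matrix (D.Arc × Fin n) (D.Arc × Fin n) (LaurentRing 3 R) :=
  1 - Matrix.of fun p r => Omega (PresentedGroup.mk (Set.range D.relator)) D.alpha ρ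
    (foxDeriv (Sum.inl r.1) (D.arcEquationWord p.1)) p.2 r.2

/-- The affine map of an arc, with translation part `v`. -/
noncomputable def affArc (v : D.Arc × Fin n → LaurentRing 3 R) (a : D.Arc) :
    AffGroup n (LaurentRing 3 R) :=
  affMk (fun i => v (a, i)) (unitRep D.alpha ρ (D.arcGen a))

/-- The linear map `s`. -/
noncomputable def affS : AffGroup n (LaurentRing 3 R) := affMk 0 (unitRep D.alpha ρ D.sGen)

/-- The linear map `q`. -/
noncomputable def affQ : AffGroup n (LaurentRing 3 R) := affMk 0 (unitRep D.alpha ρ D.qGen)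

theorem affS_mul_affQ : D.affS ρ * D.affQ ρ = D.affQ ρ * D.affS ρ := by
  apply AffGroup.ext
  · simp [affS, affQ]
  · simp only [affS, affQ, AffGroup.lin_mul, AffGroup.lin_mk, ← map_mul, sGen_mul_qGen]

theorem affLift_arc (v : D.Arc × Fin n → LaurentRing 3 R) :
    affLift (fun x => unitRep D.alpha ρ
      (PresentedGroup.mk (Set.range D.relator) (FreeGroup.of x)))
      (Sum.elim (fun a i => v (a, i)) 0) =
      FreeGroup.lift (Sum.elim (D.affArc ρ v) ![D.affS ρ, D.affQ ρ]) := by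
  unfold affLift
  congr 1
  ext x : 1
  obtain a | i := x
  · rfl
  · fin_cases i <;> rfl

/-- The arc matrix measures by how much the affine maps with translation parts `v` fail the arc
equations. The translation parts of `s` and `q` are 0 because their columns are left out. -/
theorem arcMatrix_mulVec (v : D.Arc × Fin n → LaurentRing 3 R) (a : D.Arc) (k : Fin n) :
    (D.arcMatrix ρ).mulVec v (a, k) = v (a, k) -
      (FreeGroup.lift (Sum.elim (D.affArc ρ v) ![D.affS ρ, D.affQ ρ])
        (D.arcEquationWord a)).trans k := by
  have h := sum_Omega_foxDeriv (PresentedGroup.mk (Set.range D.relator)) D.alpha ρ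
    (Sum.elim (fun a i => v (a, i)) 0) (D.arcEquationWord a)
  rw [affLift_arc, Fintype.sum_sum_type] at h
  rw [← h, arcMatrix, Matrix.sub_mulVec, Matrix.one_mulVec, Pi.sub_apply]
  congr 1
  simp [Matrix.mulVec, dotProduct, Fintype.sum_prod_type]

theorem arcMatrix_mulVec_out (v : D.Arc × Fin n → LaurentRing 3 R) (c : D.Crossing) (i : Fin 2)
    (k : Fin n) :
    (D.arcMatrix ρ).mulVec v (D.out c i, k) = v (D.out c i, k) -
      (crossingValue (D.kind c) (D.affS ρ) (D.affQ ρ) (D.affArc ρ v (D.inc c 0))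
        (D.affArc ρ v (D.inc c 1)) i).trans k := by
  rw [arcMatrix_mulVec, arcEquationWord_out, lift_outWord]
  rfl

theorem arcMatrix_mulVec_of_forall_ne (v : D.Arc × Fin n → LaurentRing 3 R) (a : D.Arc)
    (ha : ∀ c i, D.out c i ≠ a) (k : Fin n) : (D.arcMatrix ρ).mulVec v (a, k) = 0 := by
  rw [arcMatrix_mulVec, arcEquationWord_of_forall_ne _ _ ha, arcWord, FreeGroup.lift_apply_of]
  simp [affArc]

/-- The linear parts satisfy the crossing relations in any case, since they come from a
representation of the group; only the translation parts carry a condition. -/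
theorem lin_crossingValue (v : D.Arc × Fin n → LaurentRing 3 R) (c : D.Crossing) (i : Fin 2) :
    (crossingValue (D.kind c) (D.affS ρ) (D.affQ ρ) (D.affArc ρ v (D.inc c 0))
        (D.affArc ρ v (D.inc c 1)) i).lin = unitRep D.alpha ρ (D.arcGen (D.out c i)) := by
  rw [← AffGroup.linHom_apply, map_crossingValue, arcGen_out, map_crossingValue]
  rfl

/-- The block columns satisfy the fundamental formula of the Fox calculus. -/
theorem sum_twistedMatrix_mul (r : Option (D.Crossing × Fin 2)) (i i' : Fin n) :
    ∑ x, ∑ k, twistedMatrix D.relator (PresentedGroup.mk (Set.range D.relator)) D.alpha ρ (r, i)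
      (x, k) * Omega (PresentedGroup.mk (Set.range D.relator)) D.alpha ρ
        (1 - MonoidAlgebra.of ℤ (FreeGroup D.Gen) (FreeGroup.of x)) k i' = 0 := by
  set φ := PresentedGroup.mk (Set.range D.relator)
  let g : D.Gen → (Matrix (Fin n) (Fin n) (LaurentRing 3 R))ˣ := fun x =>
    unitRep D.alpha ρ (φ (FreeGroup.of x))
  have hg : FreeGroup.lift g (D.relator r) = 1 := by
    have : FreeGroup.lift g = (unitRep D.alpha ρ).comp φ := by ext x; simp [g]
    rw [this, MonoidHom.comp_apply,
      show φ (D.relator r) = 1 from PresentedGroup.one_of_mem ⟨r, rfl⟩, map_one]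
  -- A principal crossed homomorphism vanishes on relators; its values (1 - Ω(x))c, for c a basis
  -- vector, are the columns of the blocks.
  have h := sum_Omega_foxDeriv φ D.alpha ρ (fun x => (Pi.single i' 1 : Fin n → LaurentRing 3 R) -
    (g x : Matrix (Fin n) (Fin n) (LaurentRing 3 R)).mulVec (Pi.single i' 1)) (D.relator r)
  rw [trans_affLift_principal g, hg] at h
  have h' := congrFun h i
  rw [Finset.sum_apply] at h'
  simp only [Units.val_one, Matrix.one_mulVec, sub_self, Pi.zero_apply] at h'
  rw [← h']
  refine Finset.sum_congr rfl fun x _ => ?_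
  refine Finset.sum_congr rfl fun k _ => ?_
  congr 1
  rw [map_sub, map_one, Omega_of]
  simp [g, Matrix.one_apply, Pi.single_apply]

theorem Omega_foxDeriv_apply (x : D.Gen) (w : FreeGroup D.Gen) (i k : Fin n) :
    Omega (PresentedGroup.mk (Set.range D.relator)) D.alpha ρ (foxDeriv x w) i k =
      (affLift (fun x => unitRep D.alpha ρ (PresentedGroup.mk (Set.range D.relator)
        (FreeGroup.of x))) (Pi.single x (Pi.single k 1)) w).trans i := by
  rw [← sum_Omega_foxDeriv, Finset.sum_eq_single x]
  · simp
  · intro y _ hy; simp [hy]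
  · simp

/-- In ∂(uv⁻¹) = ∂u - uv⁻¹ ∂v the factor uv⁻¹ acts trivially for a relator, which leaves ∂u - ∂v,
the row of the arc equation. -/
theorem Omega_foxDeriv_relator (r : D.Crossing × Fin 2) (a : D.Arc) (i k : Fin n) :
    Omega (PresentedGroup.mk (Set.range D.relator)) D.alpha ρ
      (foxDeriv (Sum.inl a) (D.relator (some r))) i k =
      D.arcMatrix ρ (D.out r.1 r.2, i) (a, k) := by
  have h1 : D.arcMatrix ρ (D.out r.1 r.2, i) (a, k) =
      (D.arcMatrix ρ).mulVec (Pi.single (a, k) 1) (D.out r.1 r.2, i) := by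
    rw [Matrix.mulVec_single_one]; rfl
  have h2 : (Pi.single (Sum.inl a) (Pi.single k 1) : D.Gen → Fin n → LaurentRing 3 R) =
      Sum.elim (fun b i => (Pi.single (a, k) 1 : D.Arc × Fin n → LaurentRing 3 R) (b, i)) 0 := by
    ext x j
    obtain b | m := x
    · by_cases hb : b = a
      · subst hb; simp [Pi.single_apply]
      · simp [Pi.single_apply, hb]
    · simp
  rw [h1, arcMatrix_mulVec, Omega_foxDeriv_apply, h2, affLift_arc, relator, map_mul, map_inv,
    AffGroup.trans_mul, AffGroup.trans_inv, arcEquationWord_out]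
  set F := FreeGroup.lift (Sum.elim (D.affArc ρ (Pi.single (a, k) 1)) ![D.affS ρ, D.affQ ρ])
  have h3 : (F (D.outWord r.1 r.2)).lin = (F (D.arcWord (D.out r.1 r.2))).lin := by
    rw [lift_outWord]
    refine (D.lin_crossingValue ρ (Pi.single (a, k) 1) r.1 r.2).trans ?_
    simp [F, arcWord, affArc]
  rw [h3]
  simp [F, arcWord, affArc, sub_eq_add_neg, Matrix.mulVec_neg]

theorem Omega_foxDeriv_commutator (x : D.Gen) (hx : x ≠ Sum.inr 0) :
    Omega (PresentedGroup.mk (Set.range D.relator)) D.alpha ρ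
      (foxDeriv x (D.relator none)) = if x = Sum.inr 1 then
      (unitRep D.alpha ρ D.sGen : Matrix (Fin n) (Fin n) (LaurentRing 3 R)) - 1 else 0 := by
  have hS : PresentedGroup.mk (Set.range D.relator) (FreeGroup.of (Sum.inr 0)) = D.sGen := rfl
  have hQ : PresentedGroup.mk (Set.range D.relator) (FreeGroup.of (Sum.inr 1)) = D.qGen := rfl
  have hc : unitRep D.alpha ρ D.sGen * unitRep D.alpha ρ D.qGen =
      unitRep D.alpha ρ D.qGen * unitRep D.alpha ρ D.sGen := by
    rw [← map_mul, ← map_mul, sGen_mul_qGen]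
  refine Matrix.ext fun i k => ?_
  rw [Omega_foxDeriv_apply, relator, sWord, qWord, map_mul, map_mul, map_mul, map_inv, map_inv,
    affLift_of, affLift_of, Pi.single_eq_of_ne (Ne.symm hx), hS, hQ, trans_commutator hc]
  split_ifs with h
  · subst h
    simp [Matrix.one_apply, Pi.single_apply]
  · rw [Pi.single_eq_of_ne (Ne.symm h)]
    simp

end SurfaceDiagram

/-! ### The invariant as the determinant of the arc matrix -/

namespace SurfaceDiagram

variable (D : SurfaceDiagram) {n : ℕ} {R : Type*} [CommRing R] (ρ : D.VG →* GL (Fin n) R)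

theorem twistedDenominator_inr_zero_ne_zero [IsDomain R] :
    twistedDenominator (PresentedGroup.mk (Set.range D.relator)) D.alpha ρ (Sum.inr 0) ≠ 0 := by
  apply twistedDenominator_ne_zero
  intro h
  have h' : D.alphaGen (Sum.inr 0) = 1 := by
    rw [← h]
    exact (PresentedGroup.toGroup.of D.alphaGen_relator).symm
  have h'' := congrFun (congrArg Multiplicative.toAdd h') 0
  simp [alphaGen] at h''

/-- The ordering of the relators and of the generators different from `s` that comes from the
outgoing arcs of the crossings. -/
noncomputable def relatorEquiv (h : Function.Surjective fun p : D.Crossing × Fin 2 => D.out p.1 p.2) :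
    Option (D.Crossing × Fin 2) ≃ {x : D.Gen // x ≠ Sum.inr 0} :=
  Equiv.ofBijective (fun y => match y with
    | none => ⟨Sum.inr 1, by simp⟩
    | some p => ⟨Sum.inl (D.out p.1 p.2), by simp⟩) (by
    constructor
    · rintro (_ | p) (_ | r) hpr
      · rfl
      · simp at hpr
      · simp at hpr
      · simp only [Subtype.mk.injEq, Sum.inl.injEq] at hpr
        rw [D.out_injective hpr]
    · rintro ⟨a | i, hx⟩
      · obtain ⟨p, hp⟩ := h a
        exact ⟨some p, Subtype.ext (congrArg Sum.inl hp)⟩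
      · have : i = 1 := by
          have : i ≠ 0 := fun h => hx (by rw [h])
          omega
        exact ⟨none, Subtype.ext (congrArg Sum.inr this.symm)⟩)

/-- Without the column of `s`, the row of [s,q] is zero except for Ω(s) - 1 in the column of `q`.
The matrix is block triangular, and its other diagonal block is the arc matrix with rows named after
the outgoing arcs. -/
theorem det_relatorEquiv (h : Function.Surjective fun p : D.Crossing × Fin 2 => D.out p.1 p.2) :
    ((twistedMatrix D.relator (PresentedGroup.mk (Set.range D.relator)) D.alpha ρ).submatrix id
      (fun p : Option (D.Crossing × Fin 2) × Fin n => ((D.relatorEquiv h p.1 : D.Gen), p.2))).det =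
      (-1) ^ n * twistedDenominator (PresentedGroup.mk (Set.range D.relator)) D.alpha ρ
        (Sum.inr 0) * (D.arcMatrix ρ).det := by
  set φ := PresentedGroup.mk (Set.range D.relator) with hφ
  set N := ((twistedMatrix D.relator φ D.alpha ρ).submatrix id
      (fun p : Option (D.Crossing × Fin 2) × Fin n => ((D.relatorEquiv h p.1 : D.Gen), p.2)))
  have he0 : (D.relatorEquiv h none : D.Gen) = Sum.inr 1 := rfl
  have he1 : ∀ p, (D.relatorEquiv h (some p) : D.Gen) = Sum.inl (D.out p.1 p.2) := fun p => rfl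
  have hN0 : ∀ i q k, N (none, i) (q, k) = if q = none then
      ((unitRep D.alpha ρ D.sGen : Matrix (Fin n) (Fin n) (LaurentRing 3 R)) - 1) i k else 0 := by
    intro i q k
    simp only [N, twistedMatrix, Matrix.submatrix_apply, Matrix.of_apply, id]
    rw [D.Omega_foxDeriv_commutator ρ _ (D.relatorEquiv h q).2]
    cases q
    · rw [he0, if_pos rfl, if_pos rfl]
    · rw [he1, if_neg (by simp), if_neg (by simp)]; rfl
  have hN1 : ∀ p i q k, N (some p, i) (some q, k) =
      D.arcMatrix ρ (D.out p.1 p.2, i) (D.out q.1 q.2, k) := by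
    intro p i q k
    simp only [N, twistedMatrix, Matrix.submatrix_apply, Matrix.of_apply, id]
    rw [he1]
    exact D.Omega_foxDeriv_relator ρ p _ i k
  let E : (D.Crossing × Fin 2) × Fin n ⊕ Fin n ≃ Option (D.Crossing × Fin 2) × Fin n :=
    { toFun := Sum.elim (fun p => (some p.1, p.2)) (fun i => (none, i))
      invFun := fun p => match p with
        | (none, i) => Sum.inr i
        | (some p, i) => Sum.inl (p, i)
      left_inv := by rintro (p | i) <;> rfl
      right_inv := by rintro ⟨_ | p, i⟩ <;> rfl }
  let O : (D.Crossing × Fin 2) × Fin n ≃ D.Arc × Fin n :=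
    (Equiv.ofBijective _ ⟨D.out_injective, h⟩).prodCongr (Equiv.refl _)
  have hblock : N.submatrix E E = Matrix.fromBlocks ((D.arcMatrix ρ).submatrix O O)
      (Matrix.of fun p i => N (some p.1, p.2) (none, i)) 0
      ((unitRep D.alpha ρ D.sGen : Matrix (Fin n) (Fin n) (LaurentRing 3 R)) - 1) := by
    refine Matrix.ext ?_
    rintro (⟨p, i⟩ | i) (⟨q, k⟩ | k)
    · exact hN1 p i q k
    · rfl
    · exact (hN0 i (some q) k).trans (if_neg (by simp))
    · exact (hN0 i none k).trans (if_pos rfl)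
  have hden : ((unitRep D.alpha ρ D.sGen : Matrix (Fin n) (Fin n) (LaurentRing 3 R)) - 1).det =
      (-1) ^ n * twistedDenominator φ D.alpha ρ (Sum.inr 0) := by
    rw [twistedDenominator, map_sub, map_one, Omega_of, ← neg_sub, Matrix.det_neg, Fintype.card_fin]
    rfl
  rw [← Matrix.det_submatrix_equiv_self E, hblock, Matrix.det_fromBlocks_zero₂₁,
    Matrix.det_submatrix_equiv_self, hden, mul_comm]

theorem det_arcMatrix_eq_zero (hn : 0 < n) (a : D.Arc) (ha : ∀ c i, D.out c i ≠ a) :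
    (D.arcMatrix ρ).det = 0 := by
  apply Matrix.det_eq_zero_of_row_eq_zero (a, ⟨0, hn⟩)
  intro r
  have := D.arcMatrix_mulVec_of_forall_ne ρ (Pi.single r 1) a ha ⟨0, hn⟩
  rwa [Matrix.mulVec_single_one] at this

theorem card_relators_le : Fintype.card (Option (D.Crossing × Fin 2)) + 1 ≤ Fintype.card D.Gen := by
  have := Fintype.card_le_of_injective _ D.out_injective
  simp only [Fintype.card_option, Fintype.card_sum, Fintype.card_fin, Gen] at *
  omega

/-- An arc at which no crossing is left is a closed component without crossings; each of these makes
the number of relators one smaller. -/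
theorem surjective_out_iff : Function.Surjective (fun p : D.Crossing × Fin 2 => D.out p.1 p.2) ↔
    Fintype.card (Option (D.Crossing × Fin 2)) + 1 = Fintype.card D.Gen := by
  have h1 := Fintype.bijective_iff_injective_and_card
    (fun p : D.Crossing × Fin 2 => D.out p.1 p.2)
  have h2 : Fintype.card (Option (D.Crossing × Fin 2)) + 1 = Fintype.card D.Gen ↔
      Fintype.card (D.Crossing × Fin 2) = Fintype.card D.Arc := by
    rw [Fintype.card_option, Fintype.card_sum, Fintype.card_fin]
    omega
  rw [h2]
  exact ⟨fun h => (h1.mp ⟨D.out_injective, h⟩).2, fun h => (h1.mpr ⟨D.out_injective, h⟩).2⟩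

/-- Every value of the twisted virtual Alexander polynomial is the determinant of the linearized
crossing relations. -/
theorem IsTwistedVirtualAlexander.exists_eq [IsDomain R] (hn : 0 < n)
    {f : FractionRing (LaurentRing 3 R)} (hf : D.IsTwistedVirtualAlexander ρ f) :
    ∃ σ : ℤˣ, f = algebraMap (LaurentRing 3 R) (FractionRing (LaurentRing 3 R))
      ((((σ ^ n : ℤˣ) : ℤ) : LaurentRing 3 R) * (D.arcMatrix ρ).det) := by
  obtain ⟨j, Q, hj, hQ, rfl⟩ := hf
  have hle := D.card_relators_le
  have hj' : algebraMap (LaurentRing 3 R) (FractionRing (LaurentRing 3 R))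
      (twistedDenominator (PresentedGroup.mk (Set.range D.relator)) D.alpha ρ j) ≠ 0 := by
    rwa [Ne, FaithfulSMul.algebraMap_eq_zero_iff]
  rcases hQ with ⟨e, hQ⟩ | ⟨hlt, rfl⟩ | ⟨hlt, -⟩
  · have hcard : Fintype.card (Option (D.Crossing × Fin 2)) + 1 = Fintype.card D.Gen := by
      rw [Fintype.card_congr e, Fintype.card_subtype_compl, Fintype.card_subtype_eq]
      have : 0 < Fintype.card D.Gen := Fintype.card_pos_iff.mpr ⟨j⟩
      omega
    have hs := D.surjective_out_iff.mpr hcard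
    obtain ⟨σ, hσ⟩ := det_deleteBlockColumn
      (twistedMatrix D.relator (PresentedGroup.mk (Set.range D.relator)) D.alpha ρ)
      (fun x => Omega (PresentedGroup.mk (Set.range D.relator)) D.alpha ρ
        (1 - MonoidAlgebra.of ℤ (FreeGroup D.Gen) (FreeGroup.of x)))
      (D.sum_twistedMatrix_mul ρ) j (Sum.inr 0) e (D.relatorEquiv hs)
    rw [← hQ, D.det_relatorEquiv ρ hs] at hσ
    have hσ' : Q = ((((-σ) ^ n : ℤˣ) : ℤ) : LaurentRing 3 R) * (D.arcMatrix ρ).det *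
        twistedDenominator (PresentedGroup.mk (Set.range D.relator)) D.alpha ρ j := by
      apply mul_right_cancel₀ (D.twistedDenominator_inr_zero_ne_zero ρ)
      refine hσ.trans ?_
      rw [neg_pow]
      simp only [twistedDenominator]
      push_cast
      ring
    refine ⟨-σ, ?_⟩
    rw [hσ', map_mul _ (_ * _), mul_div_cancel_right₀ _ hj']
  -- Fewer relators than needed: some component has no crossings, so the arc matrix has a zero row,
  -- and both sides are 0.
  · have hns : ¬Function.Surjective (fun p : D.Crossing × Fin 2 => D.out p.1 p.2) := fun h =>
      hlt.ne (D.surjective_out_iff.mp h)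
    simp only [Function.Surjective, not_forall, not_exists] at hns
    obtain ⟨a, ha⟩ := hns
    refine ⟨1, ?_⟩
    rw [D.det_arcMatrix_eq_zero ρ hn a fun c i => ha (c, i)]
    simp
  -- There are never more relators than `card_relators_le` allows, so the case of a greatest common
  -- divisor does not arise.
  · omega

theorem exists_isTwistedVirtualAlexander [IsDomain R] :
    ∃ f : FractionRing (LaurentRing 3 R), D.IsTwistedVirtualAlexander ρ f := by
  by_cases h : Function.Surjective (fun p : D.Crossing × Fin 2 => D.out p.1 p.2)
  · exact ⟨_, Sum.inr 0, _, D.twistedDenominator_inr_zero_ne_zero ρ,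
      Or.inl ⟨D.relatorEquiv h, rfl⟩, rfl⟩
  · refine ⟨_, Sum.inr 0, 0, D.twistedDenominator_inr_zero_ne_zero ρ, Or.inr (Or.inl ⟨?_, rfl⟩), rfl⟩
    exact lt_of_le_of_ne D.card_relators_le fun h' => h (D.surjective_out_iff.mpr h')

end SurfaceDiagram

/-! ### Polygonal regions, their sides and the arcs that continue them -/

namespace SurfaceDiagram

variable {D : SurfaceDiagram}

/-- The half-edge number `p` of the crossing `c` belongs to a strand that passes in turn through the
arcs `a`, `m`, `b`; the half-edge is a part of `m`. -/
def StrandAt (D : SurfaceDiagram) (c : D.Crossing) (p : Fin 4) (a m b : D.Arc) : Prop :=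
  match p with
  | 0 => D.inc c 0 = m ∧ D.out c 0 = b
  | 1 => D.inc c 1 = m ∧ D.out c 1 = b
  | 2 => D.inc c 0 = a ∧ D.out c 0 = m
  | 3 => D.inc c 1 = a ∧ D.out c 1 = m

theorem StrandAt.arcAt_eq {c : D.Crossing} {p : Fin 4} {a m b : D.Arc} (h : D.StrandAt c p a m b) :
    D.arcAt (c, p) = m := by
  fin_cases p
  · exact h.1
  · exact h.1
  · exact h.2
  · exact h.2

theorem StrandAt.arcAt_opposite_of_in {c : D.Crossing} {p : Fin 4} {a m b : D.Arc}
    (h : D.StrandAt c p a m b) (hp : p = 0 ∨ p = 1) : D.arcAt (c, p + 2) = b := by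
  obtain rfl | rfl := hp
  · exact h.2
  · exact h.2

theorem StrandAt.arcAt_opposite_of_out {c : D.Crossing} {p : Fin 4} {a m b : D.Arc}
    (h : D.StrandAt c p a m b) (hp : p = 2 ∨ p = 3) : D.arcAt (c, p + 2) = a := by
  obtain rfl | rfl := hp
  · exact h.1
  · exact h.1

theorem arcAt_injective_of_in {x y : D.HalfEdge} (h : D.arcAt x = D.arcAt y)
    (hx : x.2 = 0 ∨ x.2 = 1) (hy : y.2 = 0 ∨ y.2 = 1) : x = y := by
  obtain ⟨c, p⟩ := x
  obtain ⟨c', p'⟩ := y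
  have key : ∀ i i' : Fin 2, D.inc c i = D.inc c' i' → c = c' ∧ i = i' := fun i i' h' =>
    Prod.ext_iff.mp (@D.inc_injective (c, i) (c', i') h')
  dsimp only at hx hy
  rcases hx with rfl | rfl <;> rcases hy with rfl | rfl <;> have h' := key _ _ h <;> simp_all

theorem arcAt_injective_of_out {x y : D.HalfEdge} (h : D.arcAt x = D.arcAt y)
    (hx : x.2 = 2 ∨ x.2 = 3) (hy : y.2 = 2 ∨ y.2 = 3) : x = y := by
  obtain ⟨c, p⟩ := x
  obtain ⟨c', p'⟩ := y
  have key : ∀ i i' : Fin 2, D.out c i = D.out c' i' → c = c' ∧ i = i' := fun i i' h' =>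
    Prod.ext_iff.mp (@D.out_injective (c, i) (c', i') h')
  dsimp only at hx hy
  rcases hx with rfl | rfl <;> rcases hy with rfl | rfl <;> have h' := key _ _ h <;> simp_all

/-- Of the two ends of a side, one is its head and one its tail. The head determines the next arc
`b` and the tail the previous arc `a`, so one pair describes the strand at both corners. -/
theorem FaceStep.exists_strandAt {h h' : D.HalfEdge} (hh : D.FaceStep h h') :
    CompatibleCorners h.2 h'.2 ∧ ∃ a b, D.StrandAt h.1 h.2 a (D.arcAt h) b ∧
      D.StrandAt h'.1 (h'.2 + 3) a (D.arcAt h) b := by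
  obtain ⟨k, hk, hkh, rfl⟩ := hh
  obtain ⟨c, p⟩ := h
  obtain ⟨c', r⟩ := k
  have hr : ∀ r : Fin 4, r + 1 + 3 = r := by decide
  dsimp only at hk ⊢
  rw [hr]
  by_cases hp : p = 0 ∨ p = 1
  · have hr' : r = 2 ∨ r = 3 := by
      by_contra h
      exact hk (arcAt_injective_of_in hkh (by dsimp only; omega) hp)
    refine ⟨by omega, ?_⟩
    rw [← hkh]
    rcases hp with rfl | rfl <;> rcases hr' with rfl | rfl <;>
      exact ⟨_, _, ⟨hkh.symm, rfl⟩, ⟨rfl, rfl⟩⟩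
  · have hp : p = 2 ∨ p = 3 := by omega
    have hr' : r = 0 ∨ r = 1 := by
      by_contra h
      exact hk (arcAt_injective_of_out hkh (by dsimp only; omega) hp)
    refine ⟨by omega, ?_⟩
    rcases hp with rfl | rfl <;> rcases hr' with rfl | rfl <;>
      exact ⟨_, _, ⟨rfl, rfl⟩, ⟨hkh, rfl⟩⟩

/-- A polygonal region with the corners `c j`, at which the side `m j` starts with the half-edge
number `p j`. The strand of the side `m j` comes from the arc `a j` and continues with `b j`. -/
structure IsPolygon (D : SurfaceDiagram) {N : ℕ} [NeZero N] (c : Fin N → D.Crossing)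
    (p : Fin N → Fin 4) (a m b : Fin N → D.Arc) : Prop where
  injective : Function.Injective c
  compatible : ∀ j, CompatibleCorners (p j) (p (j + 1))
  next : ∀ j, D.StrandAt (c j) (p j) (a j) (m j) (b j)
  prev : ∀ j, D.StrandAt (c (j + 1)) (p (j + 1) + 3) (a j) (m j) (b j)

theorem exists_isPolygon {N : ℕ} [NeZero N] {h : Fin N → D.HalfEdge}
    (hh : ∀ j, D.FaceStep (h j) (h (j + 1))) (hinj : Function.Injective fun j => (h j).1) :
    ∃ a b, D.IsPolygon (fun j => (h j).1) (fun j => (h j).2) a (fun j => D.arcAt (h j)) b := by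
  choose hc a b hn hp using fun j => (hh j).exists_strandAt
  exact ⟨a, b, hinj, hc, hn, hp⟩

namespace IsPolygon

variable {N : ℕ} [NeZero N] {c : Fin N → D.Crossing} {p : Fin N → Fin 4} {a m b : Fin N → D.Arc}
  (P : D.IsPolygon c p a m b)

include P

theorem exists_tail (j : Fin N) : ∃ x : D.HalfEdge,
    (x = (c j, p j) ∨ x = (c (j + 1), p (j + 1) + 3)) ∧ (x.2 = 2 ∨ x.2 = 3) ∧
      D.arcAt x = m j ∧ D.arcAt (x.1, x.2 + 2) = a j := by
  by_cases hp : p j = 2 ∨ p j = 3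
  · exact ⟨(c j, p j), Or.inl rfl, hp, (P.next j).arcAt_eq, (P.next j).arcAt_opposite_of_out hp⟩
  · have hp' : p (j + 1) + 3 = 2 ∨ p (j + 1) + 3 = 3 := by
      have := P.compatible j
      revert hp this
      generalize p j = x
      generalize p (j + 1) = y
      revert x y
      decide
    exact ⟨_, Or.inr rfl, hp', (P.prev j).arcAt_eq, (P.prev j).arcAt_opposite_of_out hp'⟩

theorem exists_head (j : Fin N) : ∃ x : D.HalfEdge,
    (x = (c j, p j) ∨ x = (c (j + 1), p (j + 1) + 3)) ∧ (x.2 = 0 ∨ x.2 = 1) ∧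
      D.arcAt x = m j ∧ D.arcAt (x.1, x.2 + 2) = b j := by
  by_cases hp : p j = 0 ∨ p j = 1
  · exact ⟨(c j, p j), Or.inl rfl, hp, (P.next j).arcAt_eq, (P.next j).arcAt_opposite_of_in hp⟩
  · have hp' : p (j + 1) + 3 = 0 ∨ p (j + 1) + 3 = 1 := by
      have := P.compatible j
      revert hp this
      generalize p j = x
      generalize p (j + 1) = y
      revert x y
      decide
    exact ⟨_, Or.inr rfl, hp', (P.prev j).arcAt_eq, (P.prev j).arcAt_opposite_of_in hp'⟩

theorem eq_of_half_edge_eq {x y : D.HalfEdge} {j k : Fin N}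
    (hx : x = (c j, p j) ∨ x = (c (j + 1), p (j + 1) + 3))
    (hy : y = (c k, p k) ∨ y = (c (k + 1), p (k + 1) + 3)) (hxy : x = y) : j = k := by
  subst hxy
  rcases hx with rfl | rfl <;> rcases hy with h | h <;> obtain ⟨h1, h2⟩ := Prod.ext_iff.mp h <;>
    have h3 := P.injective h1
  · exact h3
  · dsimp only at h2
    rw [h3] at h2
    omega
  · dsimp only at h2
    rw [h3] at h2
    omega
  · exact add_right_cancel h3

/-- At a corner the sides occupy the half-edges p and p - 1, and the opposite ones are p + 2 and p +
1. Hence the arcs that continue a side are never sides themselves. -/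
theorem half_edge_opposite_ne {x y : D.HalfEdge} {j k : Fin N}
    (hx : x = (c j, p j) ∨ x = (c (j + 1), p (j + 1) + 3))
    (hy : y = (c k, p k) ∨ y = (c (k + 1), p (k + 1) + 3)) (hxy : (x.1, x.2 + 2) = y) : False := by
  subst hxy
  rcases hx with rfl | rfl <;> rcases hy with h | h <;> obtain ⟨h1, h2⟩ := Prod.ext_iff.mp h <;>
    have h3 := P.injective h1 <;> dsimp only at h2 <;> rw [h3] at h2 <;> omega

theorem m_injective : Function.Injective m := by
  intro j k hjk
  obtain ⟨x, hx, hx2, hxm, -⟩ := P.exists_tail j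
  obtain ⟨y, hy, hy2, hym, -⟩ := P.exists_tail k
  exact P.eq_of_half_edge_eq hx hy (arcAt_injective_of_out (by rw [hxm, hym, hjk]) hx2 hy2)

theorem b_injective : Function.Injective b := by
  intro j k hjk
  obtain ⟨x, hx, hx2, -, hxm⟩ := P.exists_head j
  obtain ⟨y, hy, hy2, -, hym⟩ := P.exists_head k
  have h := arcAt_injective_of_out (x := (x.1, x.2 + 2)) (y := (y.1, y.2 + 2))
    (by rw [hxm, hym, hjk]) (by dsimp only; omega) (by dsimp only; omega)
  refine P.eq_of_half_edge_eq hx hy ?_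
  obtain ⟨h1, h2⟩ := Prod.ext_iff.mp h
  exact Prod.ext h1 (add_right_cancel h2)

theorem a_ne_m (j k : Fin N) : a j ≠ m k := by
  intro hjk
  obtain ⟨x, hx, hx2, -, hxm⟩ := P.exists_tail j
  obtain ⟨y, hy, hy2, hym, -⟩ := P.exists_head k
  exact P.half_edge_opposite_ne hx hy (arcAt_injective_of_in (x := (x.1, x.2 + 2))
    (by rw [hxm, hym, hjk]) (by dsimp only; omega) hy2)

theorem b_ne_m (j k : Fin N) : b j ≠ m k := by
  intro hjk
  obtain ⟨x, hx, hx2, -, hxm⟩ := P.exists_head j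
  obtain ⟨y, hy, hy2, hym, -⟩ := P.exists_tail k
  exact P.half_edge_opposite_ne hx hy (arcAt_injective_of_out (x := (x.1, x.2 + 2))
    (by rw [hxm, hym, hjk]) (by dsimp only; omega) hy2)

theorem tail (j : Fin N) : ∃ k i, D.inc (c k) i = a j ∧ D.out (c k) i = m j := by
  obtain ⟨x, hx, hx2, hxm, hxa⟩ := P.exists_tail j
  have : ∃ k, x.1 = c k := by rcases hx with rfl | rfl <;> exact ⟨_, rfl⟩
  obtain ⟨k, hk⟩ := this
  obtain ⟨y, r⟩ := x
  dsimp only at *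
  subst hk
  rcases hx2 with rfl | rfl
  · exact ⟨k, 0, hxa, hxm⟩
  · exact ⟨k, 1, hxa, hxm⟩

theorem head (j : Fin N) : ∃ k i, D.inc (c k) i = m j ∧ D.out (c k) i = b j := by
  obtain ⟨x, hx, hx2, hxm, hxa⟩ := P.exists_head j
  have : ∃ k, x.1 = c k := by rcases hx with rfl | rfl <;> exact ⟨_, rfl⟩
  obtain ⟨k, hk⟩ := this
  obtain ⟨y, r⟩ := x
  dsimp only at *
  subst hk
  rcases hx2 with rfl | rfl
  · exact ⟨k, 0, hxm, hxa⟩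
  · exact ⟨k, 1, hxm, hxa⟩

/-- Each of the two strands at a corner runs along a side. -/
theorem strand_at_corner (k : Fin N) (i : Fin 2) : ∃ j,
    (D.inc (c k) i = a j ∧ D.out (c k) i = m j) ∨ (D.inc (c k) i = m j ∧ D.out (c k) i = b j) := by
  have h1 := P.next k
  have h2 := P.prev (k - 1)
  rw [sub_add_cancel] at h2
  revert h1 h2
  generalize p k = r
  intro h1 h2
  fin_cases r <;> fin_cases i
  · exact ⟨_, Or.inr h1⟩
  · exact ⟨_, Or.inl h2⟩
  · exact ⟨_, Or.inr h2⟩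
  · exact ⟨_, Or.inr h1⟩
  · exact ⟨_, Or.inl h1⟩
  · exact ⟨_, Or.inr h2⟩
  · exact ⟨_, Or.inl h2⟩
  · exact ⟨_, Or.inl h1⟩

theorem inc_ne_m {x : D.Crossing} (hx : ∀ k, c k ≠ x) (i : Fin 2) (j : Fin N) :
    D.inc x i ≠ m j := by
  intro h
  obtain ⟨k, i', h1, -⟩ := P.head j
  exact hx k (Prod.ext_iff.mp (@D.inc_injective (c k, i') (x, i) (h1.trans h.symm))).1

theorem out_ne_m {x : D.Crossing} (hx : ∀ k, c k ≠ x) (i : Fin 2) (j : Fin N) :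
    D.out x i ≠ m j := by
  intro h
  obtain ⟨k, i', -, h1⟩ := P.tail j
  exact hx k (Prod.ext_iff.mp (@D.out_injective (c k, i') (x, i) (h1.trans h.symm))).1

theorem out_ne_b {x : D.Crossing} (hx : ∀ k, c k ≠ x) (i : Fin 2) (j : Fin N) :
    D.out x i ≠ b j := by
  intro h
  obtain ⟨k, i', -, h1⟩ := P.head j
  exact hx k (Prod.ext_iff.mp (@D.out_injective (c k, i') (x, i) (h1.trans h.symm))).1

end IsPolygon

/-- A colouring of the arcs by group elements that satisfies the crossing relations. -/
def IsColoring (D : SurfaceDiagram) {G : Type*} [Group G] (s q : G) (γ : D.Arc → G) : Prop :=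
  ∀ c i, γ (D.out c i) = crossingValue (D.kind c) s q (γ (D.inc c 0)) (γ (D.inc c 1)) i

/-- The crossing relations at the corners of a polygon. -/
def PolygonRel {G : Type*} [Group G] {N : ℕ} [NeZero N] (κ : Fin N → CrossingKind) (s q : G)
    (p : Fin N → Fin 4) (a m b : Fin N → G) : Prop :=
  ∀ j, CornerRel (κ (j + 1)) s q (p (j + 1)) (a (j + 1)) (m (j + 1)) (b (j + 1)) (a j) (m j) (b j)

theorem cornerRel_iff {G : Type*} [Group G] {s q : G} {γ : D.Arc → G} {c : D.Crossing} {p : Fin 4}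
    {a m b a' m' b' : D.Arc} (h : D.StrandAt c p a m b) (h' : D.StrandAt c (p + 3) a' m' b') :
    CornerRel (D.kind c) s q p (γ a) (γ m) (γ b) (γ a') (γ m') (γ b') ↔
      ∀ i, γ (D.out c i) = crossingValue (D.kind c) s q (γ (D.inc c 0)) (γ (D.inc c 1)) i := by
  rw [Fin.forall_fin_two]
  fin_cases p <;> obtain ⟨rfl, rfl⟩ := h <;> obtain ⟨rfl, rfl⟩ := h'
  · exact Iff.rfl
  · exact Iff.rfl
  · exact Iff.rfl
  · exact Iff.rfl

/-- The value that the crossing relations assign to an arc. -/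
noncomputable def arcEval (D : SurfaceDiagram) {G : Type*} [Group G] (s q : G) (γ : D.Arc → G)
    (a : D.Arc) : G :=
  FreeGroup.lift (Sum.elim γ ![s, q]) (D.arcEquationWord a)

theorem arcEval_out {G : Type*} [Group G] (s q : G) (γ : D.Arc → G) (c : D.Crossing) (i : Fin 2) :
    D.arcEval s q γ (D.out c i) =
      crossingValue (D.kind c) s q (γ (D.inc c 0)) (γ (D.inc c 1)) i := by
  rw [arcEval, arcEquationWord_out, lift_outWord]
  rfl

theorem arcEval_of_forall_ne {G : Type*} [Group G] (s q : G) (γ : D.Arc → G) (a : D.Arc)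
    (ha : ∀ c i, D.out c i ≠ a) : D.arcEval s q γ a = γ a := by
  rw [arcEval, arcEquationWord_of_forall_ne _ _ ha, arcWord, FreeGroup.lift_apply_of]
  rfl

/-- Only the sides are assumed to satisfy their equations; the leaving arcs get the values
prescribed to them. This is the form needed after elimination of the sides, when the rows of the
leaving arcs are to be computed. -/
theorem cornerRel_arcEval {G : Type*} [Group G] {s q : G} {γ : D.Arc → G} {c : D.Crossing}
    {p : Fin 4} {a m b a' m' b' : D.Arc} (h : D.StrandAt c p a m b)
    (h' : D.StrandAt c (p + 3) a' m' b') (hm : D.arcEval s q γ m = γ m)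
    (hm' : D.arcEval s q γ m' = γ m') :
    CornerRel (D.kind c) s q p (γ a) (γ m) (D.arcEval s q γ b) (γ a') (γ m')
      (D.arcEval s q γ b') := by
  fin_cases p <;> obtain ⟨rfl, rfl⟩ := h <;> obtain ⟨rfl, rfl⟩ := h'
  · exact ⟨D.arcEval_out .., hm'.symm.trans (D.arcEval_out ..)⟩
  · exact ⟨D.arcEval_out .., D.arcEval_out ..⟩
  · exact ⟨hm.symm.trans (D.arcEval_out ..), D.arcEval_out ..⟩
  · exact ⟨hm'.symm.trans (D.arcEval_out ..), hm.symm.trans (D.arcEval_out ..)⟩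

section

variable {N : ℕ} [NeZero N] {c : Fin N → D.Crossing} {p : Fin N → Fin 4} {a m b : Fin N → D.Arc}

theorem IsPolygon.polygonRel_arcEval (P : D.IsPolygon c p a m b) {G : Type*} [Group G] {s q : G}
    {γ : D.Arc → G} (hγ : ∀ j, D.arcEval s q γ (m j) = γ (m j)) :
    PolygonRel (fun j => D.kind (c j)) s q p (fun j => γ (a j)) (fun j => γ (m j))
      (fun j => D.arcEval s q γ (b j)) := fun j =>
  cornerRel_arcEval (P.next (j + 1)) (P.prev j) (hγ _) (hγ _)

theorem IsPolygon.polygonRel_iff (P : D.IsPolygon c p a m b) {G : Type*} [Group G] {s q : G}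
    {γ : D.Arc → G} :
    PolygonRel (fun j => D.kind (c j)) s q p (fun j => γ (a j)) (fun j => γ (m j))
      (fun j => γ (b j)) ↔ ∀ j i, γ (D.out (c j) i) = crossingValue (D.kind (c j)) s q
        (γ (D.inc (c j) 0)) (γ (D.inc (c j) 1)) i := by
  constructor
  · intro h j
    have h1 := h (j - 1)
    have h2 := P.next j
    have h3 := P.prev (j - 1)
    rw [sub_add_cancel] at h1 h3
    exact (cornerRel_iff h2 h3).mp h1
  · intro h j
    exact (cornerRel_iff (P.next (j + 1)) (P.prev j)).mpr (h (j + 1))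

end

end SurfaceDiagram

/-! ### Colourings, induced isomorphisms and comparison of determinants -/

namespace SurfaceDiagram

variable {D D' : SurfaceDiagram}

theorem isColoring_map {G H : Type*} [Group G] [Group H] (f : G →* H) {s q : G} {γ : D.Arc → G}
    (h : D.IsColoring s q γ) : D.IsColoring (f s) (f q) (fun a => f (γ a)) := fun c i =>
  (congrArg f (h c i)).trans (map_crossingValue ..)

theorem isColoring_arcGen (D : SurfaceDiagram) : D.IsColoring D.sGen D.qGen D.arcGen :=
  fun c i => D.arcGen_out c i

/-- The homomorphism given by a colouring. -/
theorem exists_hom_of_isColoring {G : Type*} [Group G] {s q : G} (hsq : s * q = q * s)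
    {γ : D.Arc → G} (h : D.IsColoring s q γ) :
    ∃ f : D.VG →* G, f D.sGen = s ∧ f D.qGen = q ∧ ∀ a, f (D.arcGen a) = γ a := by
  have hr : ∀ r ∈ Set.range D.relator, FreeGroup.lift (Sum.elim γ ![s, q]) r = 1 := by
    rintro _ ⟨_ | ⟨c, i⟩, rfl⟩
    · simp [relator, sWord, qWord, hsq]
    · rw [relator, map_mul, map_inv, mul_inv_eq_one, lift_outWord, arcWord, FreeGroup.lift_apply_of]
      exact h c i
  exact ⟨PresentedGroup.toGroup hr, PresentedGroup.toGroup.of hr, PresentedGroup.toGroup.of hr,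
    fun a => PresentedGroup.toGroup.of hr⟩

theorem hom_ext {G : Type*} [Group G] {f g : D.VG →* G} (hs : f D.sGen = g D.sGen)
    (hq : f D.qGen = g D.qGen) (h : ∀ a, f (D.arcGen a) = g (D.arcGen a)) : f = g := by
  apply PresentedGroup.ext
  rintro (a | i)
  · exact h a
  · fin_cases i
    · exact hs
    · exact hq

/-- The colourings of two diagrams correspond to each other, and a colouring is determined by the
colours of the arcs that correspond to each other under `θ`. -/
structure ColoringTransfer (D D' : SurfaceDiagram) (θ : D.Arc → D'.Arc → Prop) : Prop where
  forward : ∀ {G : Type} [Group G] {s q : G}, s * q = q * s → ∀ {γ : D.Arc → G},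
    D.IsColoring s q γ → ∃ γ' : D'.Arc → G, D'.IsColoring s q γ' ∧ ∀ a b, θ a b → γ' b = γ a
  backward : ∀ {G : Type} [Group G] {s q : G}, s * q = q * s → ∀ {γ' : D'.Arc → G},
    D'.IsColoring s q γ' → ∃ γ : D.Arc → G, D.IsColoring s q γ ∧ ∀ a b, θ a b → γ' b = γ a
  unique_left : ∀ {G : Type} [Group G] {s q : G} {γ₁ γ₂ : D.Arc → G}, D.IsColoring s q γ₁ →
    D.IsColoring s q γ₂ → (∀ a b, θ a b → γ₁ a = γ₂ a) → γ₁ = γ₂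
  unique_right : ∀ {G : Type} [Group G] {s q : G} {γ₁ γ₂ : D'.Arc → G}, D'.IsColoring s q γ₁ →
    D'.IsColoring s q γ₂ → (∀ a b, θ a b → γ₁ b = γ₂ b) → γ₁ = γ₂

variable {θ : D.Arc → D'.Arc → Prop}

/-- The generators are the universal colouring of each diagram. Transferring it gives homomorphisms
in both directions, and uniqueness of colourings makes them inverse to each other. -/
theorem ColoringTransfer.exists_mulEquiv (T : ColoringTransfer D D' θ) :
    ∃ φ : D.VG ≃* D'.VG, φ D.sGen = D'.sGen ∧ φ D.qGen = D'.qGen ∧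
      ∀ a b, θ a b → φ (D.arcGen a) = D'.arcGen b := by
  obtain ⟨γ, hγ, hγθ⟩ := T.backward D'.sGen_mul_qGen D'.isColoring_arcGen
  obtain ⟨γ', hγ', hγθ'⟩ := T.forward D.sGen_mul_qGen D.isColoring_arcGen
  obtain ⟨f, hfs, hfq, hfa⟩ := exists_hom_of_isColoring D'.sGen_mul_qGen hγ
  obtain ⟨g, hgs, hgq, hga⟩ := exists_hom_of_isColoring D.sGen_mul_qGen hγ'
  have h1 : g.comp f = MonoidHom.id _ := by
    refine hom_ext (by simp [hfs, hgs]) (by simp [hfq, hgq]) fun a => ?_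
    refine congrFun (T.unique_left (s := D.sGen) (q := D.qGen)
      (γ₁ := fun a => g.comp f (D.arcGen a)) ?_ D.isColoring_arcGen ?_) a
    · have := isColoring_map (g.comp f) D.isColoring_arcGen
      simpa [hfs, hgs, hfq, hgq] using this
    · intro a b hab
      simp only [MonoidHom.comp_apply]
      rw [hfa, ← hγθ a b hab, hga, hγθ' a b hab]
  have h2 : f.comp g = MonoidHom.id _ := by
    refine hom_ext (by simp [hfs, hgs]) (by simp [hfq, hgq]) fun a => ?_
    refine congrFun (T.unique_right (s := D'.sGen) (q := D'.qGen)
      (γ₁ := fun a => f.comp g (D'.arcGen a)) ?_ D'.isColoring_arcGen ?_) a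
    · have := isColoring_map (f.comp g) D'.isColoring_arcGen
      simpa [hfs, hgs, hfq, hgq] using this
    · intro a b hab
      simp only [MonoidHom.comp_apply]
      rw [hga, hγθ' a b hab, hfa, hγθ a b hab]
  refine ⟨f.toMulEquiv g h1 h2, hfs, hfq, fun a b hab => ?_⟩
  exact (hfa a).trans (hγθ a b hab).symm

theorem alpha_sGen (D : SurfaceDiagram) : D.alpha D.sGen = Multiplicative.ofAdd ![1, 0, 0] :=
  PresentedGroup.toGroup.of D.alphaGen_relator

theorem alpha_qGen (D : SurfaceDiagram) : D.alpha D.qGen = Multiplicative.ofAdd ![0, 0, 1] :=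
  PresentedGroup.toGroup.of D.alphaGen_relator

theorem alpha_arcGen (D : SurfaceDiagram) (a : D.Arc) :
    D.alpha (D.arcGen a) = Multiplicative.ofAdd ![0, 1, 0] :=
  PresentedGroup.toGroup.of D.alphaGen_relator

/-- Both sides are colourings of `D` by ℤ³ that agree outside the disc of the move, hence
everywhere. -/
theorem ColoringTransfer.alpha_comp (T : ColoringTransfer D D' θ) {φ : D.VG →* D'.VG}
    (hs : φ D.sGen = D'.sGen) (hq : φ D.qGen = D'.qGen)
    (harc : ∀ a b, θ a b → φ (D.arcGen a) = D'.arcGen b) : D'.alpha.comp φ = D.alpha := by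
  refine hom_ext ?_ ?_ fun a => ?_
  · rw [MonoidHom.comp_apply, hs, alpha_sGen, alpha_sGen]
  · rw [MonoidHom.comp_apply, hq, alpha_qGen, alpha_qGen]
  · have h1 := isColoring_map (D'.alpha.comp φ) D.isColoring_arcGen
    have h2 := isColoring_map D.alpha D.isColoring_arcGen
    rw [MonoidHom.comp_apply, MonoidHom.comp_apply, hs, hq, alpha_sGen, alpha_qGen] at h1
    rw [alpha_sGen, alpha_qGen] at h2
    refine congrFun (T.unique_left h1 h2 ?_) a
    intro a b hab
    simp only [MonoidHom.comp_apply]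
    rw [harc a b hab, alpha_arcGen, alpha_arcGen]

/-- The determinants of the linearized crossing relations of two diagrams agree up to the
determinant of an element of the virtual link group. -/
def DetTransfer (D D' : SurfaceDiagram) (θ : D.Arc → D'.Arc → Prop) (n : ℕ) (R : Type*)
    [CommRing R] : Prop :=
  ∀ (ρ : D.VG →* GL (Fin n) R) (ρ' : D'.VG →* GL (Fin n) R),
    unitRep D'.alpha ρ' D'.sGen = unitRep D.alpha ρ D.sGen →
    unitRep D'.alpha ρ' D'.qGen = unitRep D.alpha ρ D.qGen →
    (∀ a b, θ a b → unitRep D'.alpha ρ' (D'.arcGen b) = unitRep D.alpha ρ (D.arcGen a)) →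
    ∃ g : D.VG, (D.arcMatrix ρ).det = (rhoTensorAlpha D.alpha ρ g).det * (D'.arcMatrix ρ').det

theorem arcMatrix_mulVec_eq_arcEval {n : ℕ} {R : Type*} [CommRing R] (ρ : D.VG →* GL (Fin n) R)
    (v : D.Arc × Fin n → LaurentRing 3 R) (a : D.Arc) (k : Fin n) :
    (D.arcMatrix ρ).mulVec v (a, k) = v (a, k) -
      (D.arcEval (D.affS ρ) (D.affQ ρ) (D.affArc ρ v) a).trans k :=
  D.arcMatrix_mulVec ρ v a k

theorem lin_arcEval {n : ℕ} {R : Type*} [CommRing R] (ρ : D.VG →* GL (Fin n) R)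
    (v : D.Arc × Fin n → LaurentRing 3 R) (a : D.Arc) :
    (D.arcEval (D.affS ρ) (D.affQ ρ) (D.affArc ρ v) a).lin = unitRep D.alpha ρ (D.arcGen a) := by
  by_cases h : ∃ c i, D.out c i = a
  · obtain ⟨c, i, rfl⟩ := h
    rw [arcEval_out, lin_crossingValue]
  · push Not at h
    rw [arcEval_of_forall_ne _ _ _ _ h]
    rfl

theorem arcEval_eq_of_mulVec_eq_zero {n : ℕ} {R : Type*} [CommRing R] (ρ : D.VG →* GL (Fin n) R)
    {v : D.Arc × Fin n → LaurentRing 3 R} {a : D.Arc}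
    (h : ∀ k, (D.arcMatrix ρ).mulVec v (a, k) = 0) :
    D.arcEval (D.affS ρ) (D.affQ ρ) (D.affArc ρ v) a = D.affArc ρ v a := by
  apply AffGroup.ext
  · funext k
    have := h k
    rw [arcMatrix_mulVec_eq_arcEval, sub_eq_zero] at this
    exact this.symm
  · rw [lin_arcEval]; rfl

end SurfaceDiagram

/-! ### Relabellings -/

section Relabelling

variable {D D' : SurfaceDiagram} {κ : D.Crossing ≃ D'.Crossing} {π : D.Arc ≃ D'.Arc}

theorem IsRelabelling.coloringTransfer (h : IsRelabelling D D' κ π) :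
    SurfaceDiagram.ColoringTransfer D D' (fun a b => π a = b) where
  forward := by
    intro G _ s q _ γ hγ
    refine ⟨fun b => γ (π.symm b), fun c i => ?_, by rintro a _ rfl; simp⟩
    obtain ⟨c, rfl⟩ := κ.surjective c
    simpa [h.kind_eq, h.inc_eq, h.out_eq] using hγ c i
  backward := by
    intro G _ s q _ γ hγ
    refine ⟨fun a => γ (π a), fun c i => ?_, by rintro a _ rfl; simp⟩
    simpa [h.kind_eq, h.inc_eq, h.out_eq] using hγ (κ c) i
  unique_left := fun _ _ h => funext fun a => h a _ rfl
  unique_right := fun _ _ h => funext fun b => h (π.symm b) b (π.apply_symm_apply b)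

theorem IsRelabelling.detTransfer (h : IsRelabelling D D' κ π) (n : ℕ) (R : Type*) [CommRing R] :
    SurfaceDiagram.DetTransfer D D' (fun a b => π a = b) n R := by
  intro ρ ρ' hs hq harc
  refine ⟨1, ?_⟩
  rw [map_one, Matrix.det_one, one_mul]
  refine det_eq_of_forall_mulVec _ _ (π.prodCongr (Equiv.refl (Fin n))) ?_
  rintro v ⟨a, k⟩
  have hS : D'.affS ρ' = D.affS ρ := congrArg (affMk 0) hs
  have hQ : D'.affQ ρ' = D.affQ ρ := congrArg (affMk 0) hq
  have hA : ∀ a, D'.affArc ρ' v (π a) = D.affArc ρ (v ∘ π.prodCongr (Equiv.refl (Fin n))) a :=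
    fun a => congrArg (affMk _) (harc a _ rfl)
  change _ = (D'.arcMatrix ρ').mulVec v (π a, k)
  by_cases ha : ∃ c i, D.out c i = a
  · obtain ⟨c, i, rfl⟩ := ha
    rw [← h.out_eq, D.arcMatrix_mulVec_out, D'.arcMatrix_mulVec_out, hS, hQ, h.kind_eq, h.inc_eq,
      h.inc_eq, hA, hA, h.out_eq]
    rfl
  · push Not at ha
    rw [D.arcMatrix_mulVec_of_forall_ne ρ _ a ha, D'.arcMatrix_mulVec_of_forall_ne]
    intro c i hc
    obtain ⟨c, rfl⟩ := κ.surjective c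
    rw [h.out_eq] at hc
    exact ha c i (π.injective hc)

end Relabelling

/-! ### Erasing the corners of a kink or a bigon -/

open SurfaceDiagram

/-- The relations at the corners of a polygon determine the values on the sides, and force the
strands to have the same values before and after the polygon. -/
structure ErasableRel.{u} {N : ℕ} [NeZero N] (κ : Fin N → CrossingKind) (p : Fin N → Fin 4) :
    Prop where
  exists_sides : ∀ {G : Type u} [Group G] (s q : G) (a : Fin N → G), ∃ m, PolygonRel κ s q p a m a
  unique : ∀ {G : Type u} [Group G] {s q : G} {a m b m' b' : Fin N → G},
    PolygonRel κ s q p a m b → PolygonRel κ s q p a m' b' → m = m'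
  eq : ∀ {G : Type u} [Group G] {s q : G} {a m b : Fin N → G}, PolygonRel κ s q p a m b → b = a

namespace IsErasure

variable {D D' : SurfaceDiagram} {S : Set D.Crossing} {κ : {c : D.Crossing // c ∉ S} ≃ D'.Crossing}
  {π : D.Arc → D'.Arc} (h : IsErasure D D' S κ π) {N : ℕ} [NeZero N] {c : Fin N → D.Crossing}
  {p : Fin N → Fin 4} {a m b : Fin N → D.Arc} (P : D.IsPolygon c p a m b)
  (hS : ∀ x, x ∈ S ↔ ∃ k, c k = x)

include h P hS

theorem proj_a (j : Fin N) : π (a j) = π (m j) := by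
  obtain ⟨k, i, h1, h2⟩ := P.tail j
  exact (h.merge _ _).mpr (Relation.EqvGen.rel _ _ ⟨c k, (hS _).mpr ⟨k, rfl⟩, i, h1.symm, h2.symm⟩)

theorem proj_b (j : Fin N) : π (m j) = π (b j) := by
  obtain ⟨k, i, h1, h2⟩ := P.head j
  exact (h.merge _ _).mpr (Relation.EqvGen.rel _ _ ⟨c k, (hS _).mpr ⟨k, rfl⟩, i, h1.symm, h2.symm⟩)

/-- At an erased crossing each strand passes from some `a j` to `m j` or from some `m j` to `b j`,
so these steps generate the whole merging. -/
theorem eq_of_proj_eq {x y : D.Arc} (hxy : π x = π y) {T : Type*} (F : D.Arc → T)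
    (ha : ∀ j, F (a j) = F (m j)) (hb : ∀ j, F (m j) = F (b j)) : F x = F y := by
  have := (h.merge x y).mp hxy
  induction this with
  | rel x y hr =>
    obtain ⟨z, hz, i, rfl, rfl⟩ := hr
    obtain ⟨k, rfl⟩ := (hS z).mp hz
    obtain ⟨j, ⟨h1, h2⟩ | ⟨h1, h2⟩⟩ := P.strand_at_corner k i
    · rw [h1, h2, ha]
    · rw [h1, h2, hb]
  | refl x => rfl
  | symm x y hr ih => exact (ih ((h.merge x y).mpr hr)).symm
  | trans x y z h1 h2 ih1 ih2 =>
    exact (ih1 ((h.merge x y).mpr h1)).trans (ih2 ((h.merge y z).mpr h2))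

theorem coloringTransfer (hE : ErasableRel.{0} (fun j => D.kind (c j)) p) :
    ColoringTransfer D D' (fun x y => (∀ j, x ≠ m j) ∧ π x = y) where
  forward := by
    classical
    intro G _ s q _ γ hγ
    have hB := hE.eq (P.polygonRel_iff.mpr fun j i => hγ (c j) i)
    -- The side takes the colour of the strand around it; since leaving and entering colours agree,
    -- this is constant on merged arcs and descends to `D'`.
    let F : D.Arc → G := fun x => if hx : ∃ j, x = m j then γ (a hx.choose) else γ x
    have hFo : ∀ x, (∀ j, x ≠ m j) → F x = γ x := fun x hx => by
      simp only [F]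
      rw [dif_neg]
      rintro ⟨j, hj⟩
      exact hx j hj
    have hFm : ∀ j, F (m j) = γ (a j) := fun j => by
      have hx : ∃ k, m j = m k := ⟨j, rfl⟩
      simp only [F]
      rw [dif_pos hx, P.m_injective hx.choose_spec.symm]
    have hF : ∀ x y, π x = π y → F x = F y := fun x y hxy => by
      refine h.eq_of_proj_eq P hS hxy F (fun j => ?_) fun j => ?_
      · rw [hFm, hFo _ (P.a_ne_m j)]
      · rw [hFm, hFo _ (P.b_ne_m j)]
        exact (congrFun hB j).symm
    have hs : ∀ x, F (Function.surjInv h.surjective (π x)) = F x := fun x =>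
      hF _ _ (Function.surjInv_eq h.surjective (π x))
    refine ⟨fun y => F (Function.surjInv h.surjective y), fun x' i => ?_, ?_⟩
    · obtain ⟨x, rfl⟩ := κ.surjective x'
      have hx : ∀ k, c k ≠ x := fun k hk => x.2 ((hS _).mpr ⟨k, hk⟩)
      simp only [h.kind_eq, h.inc_eq, h.out_eq, hs]
      rw [hFo _ (P.inc_ne_m hx 0), hFo _ (P.inc_ne_m hx 1), hFo _ (P.out_ne_m hx i)]
      exact hγ x i
    · rintro x _ ⟨hx, rfl⟩
      exact (hs x).trans (hFo x hx)
  backward := by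
    classical
    intro G _ s q _ γ' hγ'
    obtain ⟨M, hM⟩ := hE.exists_sides s q fun j => γ' (π (a j))
    let γ : D.Arc → G := fun x => if hx : ∃ j, x = m j then M hx.choose else γ' (π x)
    have hγo : ∀ x, (∀ j, x ≠ m j) → γ x = γ' (π x) := fun x hx => by
      simp only [γ]
      rw [dif_neg]
      rintro ⟨j, hj⟩
      exact hx j hj
    have hγm : ∀ j, γ (m j) = M j := fun j => by
      have hx : ∃ k, m j = m k := ⟨j, rfl⟩
      simp only [γ]
      rw [dif_pos hx, P.m_injective hx.choose_spec.symm]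
    refine ⟨γ, fun x i => ?_, fun x y hxy => ?_⟩
    · by_cases hx : x ∈ S
      · obtain ⟨k, rfl⟩ := (hS x).mp hx
        refine P.polygonRel_iff.mp ?_ k i
        have h1 : (fun j => γ (a j)) = fun j => γ' (π (a j)) := funext fun j => hγo _ (P.a_ne_m j)
        have h2 : (fun j => γ (b j)) = fun j => γ' (π (a j)) := funext fun j => by
          rw [hγo _ (P.b_ne_m j), h.proj_a P hS, h.proj_b P hS]
        have h3 : (fun j => γ (m j)) = M := funext hγm
        rw [h1, h2, h3]
        exact hM
      · have hx' : ∀ k, c k ≠ x := fun k hk => hx ((hS _).mpr ⟨k, hk⟩)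
        rw [hγo _ (P.inc_ne_m hx' 0), hγo _ (P.inc_ne_m hx' 1), hγo _ (P.out_ne_m hx' i)]
        simpa only [h.kind_eq, h.inc_eq, h.out_eq] using hγ' (κ ⟨x, hx⟩) i
    · rw [hγo x hxy.1, hxy.2]
  unique_left := by
    intro G _ s q γ₁ γ₂ h₁ h₂ h₁₂
    have ho : ∀ x, (∀ j, x ≠ m j) → γ₁ x = γ₂ x := fun x hx => h₁₂ x _ ⟨hx, rfl⟩
    have r₁ := P.polygonRel_iff.mpr fun j i => h₁ (c j) i
    have r₂ := P.polygonRel_iff.mpr fun j i => h₂ (c j) i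
    rw [show (fun j => γ₁ (a j)) = fun j => γ₂ (a j) from funext fun j => ho _ (P.a_ne_m j)] at r₁
    have hm := hE.unique r₁ r₂
    funext x
    by_cases hx : ∃ j, x = m j
    · obtain ⟨j, rfl⟩ := hx
      exact congrFun hm j
    · push Not at hx
      exact ho x hx
  unique_right := by
    intro G _ s q γ₁ γ₂ h₁ h₂ h₁₂
    funext y
    obtain ⟨x, rfl⟩ := h.surjective y
    by_cases hx : ∃ j, x = m j
    · obtain ⟨j, rfl⟩ := hx
      exact h₁₂ (a j) _ ⟨P.a_ne_m j, h.proj_a P hS j⟩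
    · push Not at hx
      exact h₁₂ x _ ⟨hx, rfl⟩

open Classical in
-- The sides are eliminated at the cost of the determinant of their block. In the affine group the
-- polygon relations then turn the equation of each `b j` into "b j equals a j", and merging these
-- variables yields the arc matrix of `D'`.
theorem detTransfer.{u} (n : ℕ) (R : Type u) [CommRing R]
    (hE : ErasableRel.{u} (fun j => D.kind (c j)) p)
    (hdet : ∀ ρ : D.VG →* GL (Fin n) R, ∃ g : D.VG,
      ((D.arcMatrix ρ).toSquareBlockProp (fun x => ∃ j, x.1 = m j)).det =
        (rhoTensorAlpha D.alpha ρ g).det) :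
    DetTransfer D D' (fun x y => (∀ j, x ≠ m j) ∧ π x = y) n R := by
  intro ρ ρ' hs hq harc
  obtain ⟨g, hg⟩ := hdet ρ
  refine ⟨g, ?_⟩
  have hu : IsUnit ((D.arcMatrix ρ).toSquareBlockProp (fun x => ∃ j, x.1 = m j)).det := by
    rw [hg, ← coe_unitRep]
    exact (Matrix.isUnit_iff_isUnit_det _).mp (Units.isUnit _)
  obtain ⟨W, hdetW, hW⟩ := exists_schurComplement (D.arcMatrix ρ) _ hu
  rw [hdetW, hg]
  congr 1
  have hS' : D'.affS ρ' = D.affS ρ := congrArg (affMk 0) hs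
  have hQ' : D'.affQ ρ' = D.affQ ρ := congrArg (affMk 0) hq
  let f : {x : D.Arc × Fin n // ¬∃ j, x.1 = m j} → {x : D.Arc × Fin n // ¬∃ j, x.1 = m j} :=
    fun x => if hx : ∃ j, x.1.1 = b j then
      ⟨(a hx.choose, x.1.2), fun ⟨k, hk⟩ => P.a_ne_m _ _ hk⟩ else x
  have hf : ∀ (x : {x : D.Arc × Fin n // ¬∃ j, x.1 = m j}) (j : Fin N), x.1.1 = b j →
      (f x).1 = (a j, x.1.2) := by
    intro x j hj
    have hx : ∃ j, x.1.1 = b j := ⟨j, hj⟩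
    simp only [f]
    rw [dif_pos hx]
    exact congrArg (fun i => (a i, x.1.2)) (P.b_injective (hx.choose_spec.symm.trans hj))
  have hout : ∀ y i, (∀ j, D.out y i ≠ m j) → (∀ j, D.out y i ≠ b j) → y ∉ S := by
    intro y i h1 h2 hy
    obtain ⟨k, rfl⟩ := (hS y).mp hy
    obtain ⟨j, ⟨-, h3⟩ | ⟨-, h3⟩⟩ := P.strand_at_corner k i
    · exact h1 j h3
    · exact h2 j h3
  refine det_eq_of_merge _ rfl W (D'.arcMatrix ρ') (fun x => ∃ j, x.1.1 = b j) f
    (fun x => (π x.1.1, x.1.2)) ?_ ?_ ?_ ?_ ?_ ?_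
  · rintro ⟨y, k⟩
    obtain ⟨x, rfl⟩ := h.surjective y
    by_cases hx : ∃ j, x = m j
    · obtain ⟨j, rfl⟩ := hx
      exact ⟨⟨(a j, k), fun ⟨i, hi⟩ => P.a_ne_m _ _ hi⟩, Prod.ext (h.proj_a P hS j) rfl⟩
    · exact ⟨⟨(x, k), hx⟩, rfl⟩
  · rintro x ⟨j, hj⟩
    rw [hf x j hj, hj, h.proj_a P hS, h.proj_b P hS]
  -- A function respecting "b j ~ a j" is extended to the sides by its value at `a j`, and so
  -- factors through the merging of arcs.
  · intro x y hxy T F hF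
    obtain ⟨hxy1, hxy2⟩ := Prod.ext_iff.mp hxy
    dsimp only at hxy1 hxy2
    let F' : D.Arc → T := fun z => if hz : ∃ j, z = m j then
        F ⟨(a hz.choose, x.1.2), fun ⟨k, hk⟩ => P.a_ne_m _ _ hk⟩ else F ⟨(z, x.1.2), hz⟩
    have hFo : ∀ z (hz : ¬∃ j, z = m j), F' z = F ⟨(z, x.1.2), hz⟩ := fun z hz => dif_neg hz
    have hFm : ∀ j, F' (m j) = F ⟨(a j, x.1.2), fun ⟨k, hk⟩ => P.a_ne_m _ _ hk⟩ := fun j => by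
      have hx : ∃ k, m j = m k := ⟨j, rfl⟩
      simp only [F']
      rw [dif_pos hx]
      congr 4
      exact P.m_injective hx.choose_spec.symm
    have := h.eq_of_proj_eq P hS hxy1 F' (fun j => ?_) fun j => ?_
    · rw [hFo _ x.2, hFo _ y.2] at this
      convert this using 2
      exact Subtype.ext (Prod.ext rfl hxy2.symm)
    · rw [hFm, hFo _ (fun ⟨k, hk⟩ => P.a_ne_m _ _ hk)]
    · rw [hFm, hFo _ (fun ⟨k, hk⟩ => P.b_ne_m _ _ hk),
        hF ⟨(b j, x.1.2), fun ⟨k, hk⟩ => P.b_ne_m _ _ hk⟩ ⟨j, rfl⟩]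
      congr 1
      exact Subtype.ext (hf ⟨(b j, x.1.2), fun ⟨k, hk⟩ => P.b_ne_m _ _ hk⟩ j rfl).symm
  · rintro v ⟨⟨x, k⟩, hx⟩ ⟨j, hj⟩
    dsimp only at hj
    subst hj
    obtain ⟨w, hwv, hw0, hw⟩ := hW v
    -- With the eliminated sides filled in, the affine maps satisfy all polygon relations, which
    -- force the value prescribed to `b j` to be that of `a j`.
    have hrel := P.polygonRel_arcEval (γ := D.affArc ρ w) fun i =>
      arcEval_eq_of_mulVec_eq_zero ρ fun l => hw0 (m i, l) ⟨i, rfl⟩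
    rw [hw, arcMatrix_mulVec_eq_arcEval, congrFun (hE.eq hrel) j, ← hwv, ← hwv, hf _ j rfl]
    rfl
  · rintro v' ⟨⟨x, k⟩, hx⟩ hxb
    obtain ⟨w, hwv, hw0, hw⟩ := hW (v' ∘ fun x => (π x.1.1, x.1.2))
    rw [hw]
    have hA : ∀ z, (∀ j, z ≠ m j) → D'.affArc ρ' v' (π z) = D.affArc ρ w z := by
      intro z hz
      rw [affArc, affArc, harc z _ ⟨hz, rfl⟩]
      congr 1
      funext l
      exact (hwv ⟨(z, l), fun ⟨j, hj⟩ => hz j hj⟩).symm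
    have hwx := hwv ⟨(x, k), hx⟩
    dsimp only at hwx hxb ⊢
    by_cases hxo : ∃ y i, D.out y i = x
    · obtain ⟨y, i, rfl⟩ := hxo
      have hyS := hout y i (fun j hj => hx ⟨j, hj⟩) (fun j hj => hxb ⟨j, hj⟩)
      have hy : ∀ k, c k ≠ y := fun k hk => hyS ((hS _).mpr ⟨k, hk⟩)
      have e1 := h.out_eq ⟨y, hyS⟩ i
      have e2 := h.inc_eq ⟨y, hyS⟩
      have e3 := h.kind_eq ⟨y, hyS⟩
      dsimp only at e1 e2 e3
      rw [← e1, arcMatrix_mulVec_out, arcMatrix_mulVec_out, hS', hQ', e1, e2, e2, e3,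
        hA _ (P.inc_ne_m hy 0), hA _ (P.inc_ne_m hy 1), hwx]
      rfl
    · push Not at hxo
      rw [arcMatrix_mulVec_of_forall_ne _ _ _ _ hxo, arcMatrix_mulVec_of_forall_ne]
      intro y' i hy'
      obtain ⟨y, rfl⟩ := κ.surjective y'
      rw [h.out_eq] at hy'
      -- An arc `x` without a starting crossing is none of the `a j`, `m j`, `b j`, as all of these
      -- start at a crossing. It is merged with no other arc and stays a circle in `D'`.
      have hbx : ∀ j, b j ≠ x := fun j hj => by
        obtain ⟨k, i, -, h1⟩ := P.head j
        exact hxo _ _ (h1.trans hj)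
      have hax : ∀ j, a j ≠ x := fun j hj => by
        obtain ⟨k, i, h1, -⟩ := P.tail j
        have : a j ∈ Set.range (fun p : D.Crossing × Fin 2 => D.inc p.1 p.2) := ⟨(c k, i), h1⟩
        rw [D.range_eq] at this
        obtain ⟨z, hz⟩ := this
        exact hxo _ _ (hz.trans hj)
      have hmx : ∀ j, m j ≠ x := fun j hj => hx ⟨j, hj.symm⟩
      have := h.eq_of_proj_eq P hS hy' (fun z => z = x) (fun j => by simp [hax, hmx])
        (fun j => by simp [hbx, hmx])
      exact hxo y i (by simpa using this)
  -- If all remaining parts of an arc of `D'` are leaving arcs, then the strand has closed up to a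
  -- circle without crossings, whose row is zero.
  · rintro v' ⟨y, k⟩ hy
    refine arcMatrix_mulVec_of_forall_ne _ _ _ _ (fun x' i hx' => ?_) k
    obtain ⟨x, rfl⟩ := κ.surjective x'
    have hx : ∀ k, c k ≠ x := fun k hk => x.2 ((hS _).mpr ⟨k, hk⟩)
    rw [h.out_eq] at hx'
    refine hy ⟨(D.out x i, k), fun ⟨j, hj⟩ => P.out_ne_m hx i j hj⟩
      (fun ⟨j, hj⟩ => P.out_ne_b hx i j hj) ?_
    dsimp only
    rw [hx']

end IsErasure

/-! ### Ranking the sides of a polygon by over and under -/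

theorem OverNext.not_overPrev {κ : CrossingKind} {p : Fin 4} (h : OverNext κ p) :
    ¬OverPrev κ p := by
  intro h'
  fin_cases p <;> exact CrossingKind.noConfusion (h.symm.trans h')

theorem overNext_or_overPrev {κ : CrossingKind} (h : κ ≠ .virt) (p : Fin 4) :
    OverNext κ p ∨ OverPrev κ p := by
  cases κ <;> fin_cases p <;> simp_all [OverNext, OverPrev]

theorem not_overNext_virt (p : Fin 4) : ¬OverNext .virt p := by
  fin_cases p <;> simp [OverNext]

theorem not_overPrev_virt (p : Fin 4) : ¬OverPrev .virt p := by
  fin_cases p <;> simp [OverPrev]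

/-- The sides of a polygon can be ranked in such a way that at each classical corner the side that is
over has the smaller rank. -/
def HasRank {N : ℕ} [NeZero N] (κ : Fin N → CrossingKind) (p : Fin N → Fin 4) : Prop :=
  ∃ r : Fin N → ℕ, ∀ j, (OverNext (κ (j + 1)) (p (j + 1)) → r (j + 1) < r j) ∧
    (OverPrev (κ (j + 1)) (p (j + 1)) → r j < r (j + 1))

theorem AdmissibleTriangle.hasRank {κ : Fin 3 → CrossingKind} {p : Fin 3 → Fin 4}
    (h : AdmissibleTriangle (κ 0) (κ 1) (κ 2) (p 0) (p 1) (p 2)) : HasRank κ p := by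
  classical
  -- The rank of a side is the number of its corners where it passes under. A classical triangle
  -- with a top strand has no cyclic pattern, so the over side has the smaller count; in a virtual
  -- triangle at most one corner imposes a condition.
  refine ⟨fun j => (if OverPrev (κ j) (p j) then 1 else 0) +
    if OverNext (κ (j + 1)) (p (j + 1)) then 1 else 0, ?_⟩
  have h1 := fun j => (OverNext.not_overPrev : OverNext (κ j) (p j) → _)
  have e1 : (0 : Fin 3) + 1 = 1 := rfl
  have e2 : (1 : Fin 3) + 1 = 2 := rfl
  have e3 : (2 : Fin 3) + 1 = 0 := rfl
  rw [Fin.forall_fin_succ, Fin.forall_fin_two] at h1 ⊢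
  simp only [Fin.succ_zero_eq_one, Fin.succ_one_eq_two, e1, e2, e3] at h1 ⊢
  obtain ⟨n0, n1, n2⟩ := h1
  rcases h with ⟨k0, k1, k2, h⟩ | h
  · have h2 := overNext_or_overPrev k0 (p 0)
    have h3 := overNext_or_overPrev k1 (p 1)
    have h4 := overNext_or_overPrev k2 (p 2)
    clear k0 k1 k2
    by_cases o0 : OverNext (κ 0) (p 0) <;> by_cases o1 : OverNext (κ 1) (p 1) <;>
    by_cases o2 : OverNext (κ 2) (p 2) <;> simp_all
  · have hv : ∀ j, κ j = .virt → ¬OverNext (κ j) (p j) ∧ ¬OverPrev (κ j) (p j) := fun j hj => by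
      rw [hj]; exact ⟨not_overNext_virt _, not_overPrev_virt _⟩
    rcases h with ⟨h, h'⟩ | ⟨h, h'⟩ | ⟨h, h'⟩ <;>
    · obtain ⟨h1, h2⟩ := hv _ h
      obtain ⟨h3, h4⟩ := hv _ h'
      simp only [h1, h2, h3, h4, if_false, false_implies, true_and, and_true, zero_add, add_zero]
      constructor <;> intro h5 <;> simp_all

theorem AdmissibleBigon.hasRank {κ : Fin 2 → CrossingKind} {p : Fin 2 → Fin 4}
    (h₁ : CompatibleCorners (p 0) (p 1)) (h₂ : CompatibleCorners (p 1) (p 0))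
    (h : AdmissibleBigon (κ 0) (κ 1)) : HasRank κ p := by
  have e1 : (0 : Fin 2) + 1 = 1 := rfl
  have e2 : (1 : Fin 2) + 1 = 0 := rfl
  unfold HasRank
  simp only [Fin.forall_fin_two, e1, e2]
  rcases h with ⟨k0, k1⟩ | ⟨k0, k1⟩ | ⟨k0, k1⟩ <;>
  rcases compatibleCorners_bigon _ _ h₁ h₂ with ⟨h0, h1⟩ | ⟨h0, h1⟩ | ⟨h0, h1⟩ | ⟨h0, h1⟩ <;>
  rw [k0, k1, h0, h1] <;>
  first
  | (refine ⟨![0, 1], ?_⟩; simp [OverNext, OverPrev]; done)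
  | (refine ⟨![1, 0], ?_⟩; simp [OverNext, OverPrev])

/-! ### Kinks and bigons are erasable -/

section ErasableRel

theorem polygonRel_one_iff {G : Type*} [Group G] {κ : Fin 1 → CrossingKind} {s q : G}
    {p : Fin 1 → Fin 4} {a m b : Fin 1 → G} :
    PolygonRel κ s q p a m b ↔ KinkRel (κ 0) s q (p 0) (a 0) (m 0) (b 0) :=
  Fin.forall_fin_one

theorem polygonRel_two_iff {G : Type*} [Group G] {κ : Fin 2 → CrossingKind} {s q : G}
    {p : Fin 2 → Fin 4} {a m b : Fin 2 → G} :
    PolygonRel κ s q p a m b ↔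
      BigonRel (κ 0) (κ 1) s q (p 0) (p 1) (a 0) (a 1) (m 0) (m 1) (b 0) (b 1) :=
  Fin.forall_fin_two.trans and_comm

theorem polygonRel_three_iff {G : Type*} [Group G] {κ : Fin 3 → CrossingKind} {s q : G}
    {p : Fin 3 → Fin 4} {a m b : Fin 3 → G} :
    PolygonRel κ s q p a m b ↔ TriangleRel (κ 0) (κ 1) (κ 2) s q (p 0) (p 1) (p 2)
      (a 0) (a 1) (a 2) (m 0) (m 1) (m 2) (b 0) (b 1) (b 2) := by
  refine (Fin.forall_fin_succ.trans (and_congr_right' Fin.forall_fin_two)).trans ?_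
  exact ⟨fun h => ⟨h.2.2, h.1, h.2.1⟩, fun h => ⟨h.2.1, h.2.2, h.1⟩⟩

theorem erasableRel_kink.{u} {κ : Fin 1 → CrossingKind} {p : Fin 1 → Fin 4}
    (h : CompatibleCorners (p 0) (p 0)) : ErasableRel.{u} κ p where
  exists_sides := by
    intro G _ s q a
    obtain ⟨m, hm⟩ := exists_kinkRel (κ := κ 0) h s q (a 0)
    exact ⟨fun _ => m, polygonRel_one_iff.mpr hm⟩
  unique := by
    intro G _ s q a m b m' b' h1 h2
    funext j
    rw [Subsingleton.elim j 0]
    exact kinkRel_unique h (polygonRel_one_iff.mp h1) (polygonRel_one_iff.mp h2)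
  eq := by
    intro G _ s q a m b h1
    funext j
    rw [Subsingleton.elim j 0]
    exact (polygonRel_one_iff.mp h1).eq h

theorem erasableRel_bigon.{u} {κ : Fin 2 → CrossingKind} {p : Fin 2 → Fin 4}
    (h₁ : CompatibleCorners (p 0) (p 1)) (h₂ : CompatibleCorners (p 1) (p 0))
    (h : AdmissibleBigon (κ 0) (κ 1)) : ErasableRel.{u} κ p where
  exists_sides := by
    intro G _ s q a
    obtain ⟨m, m', hm⟩ := exists_bigonRel h₁ h₂ h s q (a 0) (a 1)
    exact ⟨![m, m'], polygonRel_two_iff.mpr hm⟩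
  unique := by
    intro G _ s q a m b m' b' r1 r2
    obtain ⟨e1, e2⟩ := bigonRel_unique h₁ h₂ h (polygonRel_two_iff.mp r1) (polygonRel_two_iff.mp r2)
    funext j
    fin_cases j
    · exact e1
    · exact e2
  eq := by
    intro G _ s q a m b r
    obtain ⟨e1, e2⟩ := (polygonRel_two_iff.mp r).eq h₁ h₂ h
    funext j
    fin_cases j
    · exact e1
    · exact e2

end ErasableRel

/-! ### Determinants of the blocks of sides -/

namespace SurfaceDiagram

variable {D : SurfaceDiagram}

theorem arcEval_next {G : Type*} [Group G] {s q : G} {γ : D.Arc → G} {c : D.Crossing}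
    {p : Fin 4} {a m b a' m' b' : D.Arc} (h : D.StrandAt c p a m b)
    (h' : D.StrandAt c (p + 3) a' m' b') (hp : p = 2 ∨ p = 3) :
    D.arcEval s q γ m = if p = 2 then crossingValue (D.kind c) s q (γ a) (γ m') 0
      else crossingValue (D.kind c) s q (γ a') (γ a) 1 := by
  rcases hp with rfl | rfl <;> obtain ⟨rfl, rfl⟩ := h <;> obtain ⟨rfl, rfl⟩ := h' <;>
    rw [arcEval_out] <;> rfl

theorem arcEval_prev {G : Type*} [Group G] {s q : G} {γ : D.Arc → G} {c : D.Crossing}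
    {p : Fin 4} {a m b a' m' b' : D.Arc} (h : D.StrandAt c p a m b)
    (h' : D.StrandAt c (p + 3) a' m' b') (hp : p = 0 ∨ p = 3) :
    D.arcEval s q γ m' = if p = 0 then crossingValue (D.kind c) s q (γ m) (γ a') 1
      else crossingValue (D.kind c) s q (γ a') (γ a) 0 := by
  rcases hp with rfl | rfl <;> obtain ⟨rfl, rfl⟩ := h <;> obtain ⟨rfl, rfl⟩ := h' <;>
    rw [arcEval_out] <;> rfl

/-- The value of an outgoing strand involves the other strand only if that one passes over it; at a
virtual crossing it never does. -/
theorem trans_crossingValue_eq_zero {n : ℕ} {L : Type*} [CommRing L] (κ : CrossingKind)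
    {s q x y : AffGroup n L} (hs : s.trans = 0) (hq : q.trans = 0) (i : Fin 2)
    (hx : i = 0 ∨ κ = .pos → x.trans = 0) (hy : i = 1 ∨ κ = .neg → y.trans = 0) :
    (crossingValue κ s q x y i).trans = 0 := by
  cases κ <;> fin_cases i <;> simp_all [crossingValue]

variable {N : ℕ} [NeZero N] {c : Fin N → D.Crossing} {p : Fin N → Fin 4} {a m b : Fin N → D.Arc}
  {n : ℕ} {R : Type*} [CommRing R]

open Classical in
-- Besides outer arcs, the equation of a side involves at most the neighbouring side that passes
-- over it, which has smaller rank. So the block is unitriangular.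
theorem IsPolygon.det_sides_eq_one (P : D.IsPolygon c p a m b) (ρ : D.VG →* GL (Fin n) R)
    (h : HasRank (fun j => D.kind (c j)) p) :
    ((D.arcMatrix ρ).toSquareBlockProp (fun x => ∃ j, x.1 = m j)).det = 1 := by
  obtain ⟨r, hr⟩ := h
  refine det_eq_one_of_rank _ (fun x => r x.2.choose) ?_
  rintro ⟨⟨x, k⟩, hx⟩ ⟨⟨y, l⟩, hy⟩ hxy
  have hxi := hx.choose_spec
  have hyj := hy.choose_spec
  dsimp only at hxy hxi hyj
  generalize hx.choose = i at *
  generalize hy.choose = j at *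
  subst hxi hyj
  set v : D.Arc × Fin n → LaurentRing 3 R := Pi.single (m j, l) 1 with hv
  have h1 : (D.arcMatrix ρ).toSquareBlockProp (fun x => ∃ j, x.1 = m j) ⟨(m i, k), hx⟩
      ⟨(m j, l), hy⟩ = (D.arcMatrix ρ).mulVec v (m i, k) := by
    rw [Matrix.mulVec_single_one]; rfl
  have hzero : ∀ z, z ≠ m j → (D.affArc ρ v z).trans = 0 := by
    intro z hz
    funext k
    simp [affArc, v, hz]
  have hS : (D.affS ρ).trans = 0 := rfl
  have hQ : (D.affQ ρ).trans = 0 := rfl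
  have ha := fun i => hzero _ (P.a_ne_m i j)
  -- The equation of the side belongs to the corner where it starts as an arc: `c i` if it is
  -- outgoing there, otherwise `c (i + 1)`.
  have key : (D.arcEval (D.affS ρ) (D.affQ ρ) (D.affArc ρ v) (m i)).trans = 0 := by
    by_cases hp : p i = 2 ∨ p i = 3
    · obtain ⟨i', rfl⟩ : ∃ i', i = i' + 1 := ⟨i - 1, by rw [sub_add_cancel]⟩
      have hm : OverPrev (D.kind (c (i' + 1))) (p (i' + 1)) → (D.affArc ρ v (m i')).trans = 0 := by
        intro ho
        refine hzero _ fun hm => ?_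
        rw [← P.m_injective hm] at hxy
        exact absurd hxy (not_le.mpr ((hr i').2 ho))
      rw [arcEval_next (P.next (i' + 1)) (P.prev i') hp]
      rcases hp with hp | hp
      · rw [if_pos hp]
        refine trans_crossingValue_eq_zero _ hS hQ _ (fun _ => ha _) fun h => hm ?_
        rw [hp]
        exact h.resolve_left (by simp)
      · rw [if_neg (by rw [hp]; decide)]
        exact trans_crossingValue_eq_zero _ hS hQ _ (fun _ => ha _) fun _ => ha _
    · have hp : p (i + 1) = 0 ∨ p (i + 1) = 3 := by
        have := P.compatible i
        omega
      have hm : OverNext (D.kind (c (i + 1))) (p (i + 1)) →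
          (D.affArc ρ v (m (i + 1))).trans = 0 := by
        intro ho
        refine hzero _ fun hm => ?_
        rw [← P.m_injective hm] at hxy
        exact absurd hxy (not_le.mpr ((hr i).1 ho))
      rw [arcEval_prev (P.next (i + 1)) (P.prev i) hp]
      rcases hp with hp | hp
      · rw [if_pos hp]
        refine trans_crossingValue_eq_zero _ hS hQ _ (fun h => hm ?_) fun _ => ha _
        rw [hp]
        exact h.resolve_left (by simp)
      · rw [if_neg (by rw [hp]; decide)]
        exact trans_crossingValue_eq_zero _ hS hQ _ (fun _ => ha _) fun _ => ha _
  rw [h1, arcMatrix_mulVec_eq_arcEval, key]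
  simp [v, Matrix.one_apply, Pi.single_apply]

open Classical in
-- The block is 1 unless the side occurs in its own equation. In the two remaining cases the
-- coefficient is computed from the affine map with `a` kept linear.
theorem IsPolygon.det_kink {c : Fin 1 → D.Crossing} {p : Fin 1 → Fin 4} {a m b : Fin 1 → D.Arc}
    (P : D.IsPolygon c p a m b) (ρ : D.VG →* GL (Fin n) R) :
    ∃ g : D.VG, ((D.arcMatrix ρ).toSquareBlockProp (fun x => ∃ j, x.1 = m j)).det =
      (rhoTensorAlpha D.alpha ρ g).det := by
  have hc : CompatibleCorners (p 0) (p 0) := P.compatible 0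
  suffices H : ∃ g : D.VG, ∀ v : D.Arc × Fin n → LaurentRing 3 R, (∀ k, v (a 0, k) = 0) →
      (fun k => v (m 0, k)) -
        (D.arcEval (D.affS ρ) (D.affQ ρ) (D.affArc ρ v) (m 0)).trans =
      (unitRep D.alpha ρ g : Matrix (Fin n) (Fin n) (LaurentRing 3 R)).mulVec
        fun k => v (m 0, k) by
    obtain ⟨g, hg⟩ := H
    refine ⟨g, ?_⟩
    let e : Fin n ≃ {x : D.Arc × Fin n // ∃ j, x.1 = m j} :=
      { toFun := fun k => ⟨(m 0, k), 0, rfl⟩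
        invFun := fun x => x.1.2
        left_inv := fun k => rfl
        right_inv := fun x => by
          obtain ⟨⟨y, k⟩, j, hj⟩ := x
          dsimp only at hj
          subst hj
          rw [Subsingleton.elim j 0] }
    rw [← Matrix.det_submatrix_equiv_self e, ← coe_unitRep]
    congr 1
    refine Matrix.ext fun k l => ?_
    have h1 := congrFun (hg (Pi.single (m 0, l) 1) fun k => by simp [P.a_ne_m 0 0]) k
    have h2 : (fun k => (Pi.single (m 0, l) 1 : D.Arc × Fin n → LaurentRing 3 R) (m 0, k)) =
        Pi.single l 1 := by
      funext k
      simp [Pi.single_apply]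
    rw [h2, Matrix.mulVec_single_one, Pi.sub_apply, ← h2] at h1
    refine Eq.trans ?_ h1
    rw [← arcMatrix_mulVec_eq_arcEval, Matrix.mulVec_single_one]
    rfl
  have hS : D.affS ρ = affMk 0 (unitRep D.alpha ρ D.sGen) := rfl
  have hQ : D.affQ ρ = affMk 0 (unitRep D.alpha ρ D.qGen) := rfl
  have hA : ∀ v : D.Arc × Fin n → LaurentRing 3 R, (∀ k, v (a 0, k) = 0) →
      D.affArc ρ v (a 0) = affMk 0 (unitRep D.alpha ρ (D.arcGen (a 0))) :=
    fun v hv => congrArg (fun w => affMk w _) (funext hv)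
  have hM : ∀ v : D.Arc × Fin n → LaurentRing 3 R, D.affArc ρ v (m 0) =
      affMk (fun k => v (m 0, k)) (unitRep D.alpha ρ (D.arcGen (m 0))) := fun v => rfl
  have hrel := polygonRel_one_iff.mp (P.polygonRel_iff.mpr fun j i => D.isColoring_arcGen (c j) i)
  have hba := hrel.eq hc
  rcases compatibleCorners_kink _ hc with hp | hp
  · have heval := fun v => arcEval_next (s := D.affS ρ) (q := D.affQ ρ) (γ := D.affArc ρ v)
      (P.next 0) (P.prev 0) (Or.inl hp)
    have heval : ∀ v, D.arcEval (D.affS ρ) (D.affQ ρ) (D.affArc ρ v) (m 0) =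
        crossingValue (D.kind (c 0)) (D.affS ρ) (D.affQ ρ) (D.affArc ρ v (a 0))
          (D.affArc ρ v (m 0)) 0 := fun v => (heval v).trans (if_pos hp)
    rw [hba, hp] at hrel
    have hrel2 := hrel.2
    rcases hk : D.kind (c 0) <;> rw [hk] at hrel2
    · refine ⟨1, fun v hv => ?_⟩
      rw [heval, hA v hv, hM, hk, hS]
      simp [crossingValue]
    -- Linearizing m = s⁻¹m⁻¹sam gives v + s⁻¹m⁻¹v - (s⁻¹m⁻¹sa)v, and s⁻¹m⁻¹sa = 1 because a =
    -- s⁻¹ms.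
    · refine ⟨D.sGen⁻¹ * (D.arcGen (m 0))⁻¹, fun v hv => ?_⟩
      have hrel2 : D.arcGen (a 0) = D.sGen⁻¹ * D.arcGen (m 0) * D.sGen := hrel2
      rw [heval, hA v hv, hM, hk, hS, hrel2]
      simp [crossingValue, mul_assoc, Matrix.mulVec_add, Matrix.mulVec_neg, -Matrix.coe_units_inv]
    · refine ⟨1, fun v hv => ?_⟩
      rw [heval, hA v hv, hM, hk, hQ]
      simp [crossingValue]
  · have heval := fun v => arcEval_prev (s := D.affS ρ) (q := D.affQ ρ) (γ := D.affArc ρ v)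
      (P.next 0) (P.prev 0) (Or.inl hp)
    have heval : ∀ v, D.arcEval (D.affS ρ) (D.affQ ρ) (D.affArc ρ v) (m 0) =
        crossingValue (D.kind (c 0)) (D.affS ρ) (D.affQ ρ) (D.affArc ρ v (m 0))
          (D.affArc ρ v (a 0)) 1 := fun v => (heval v).trans (if_pos hp)
    rcases hk : D.kind (c 0)
    -- Linearizing m = m a s m⁻¹ s⁻¹ gives v - (v - masm⁻¹ v).
    · refine ⟨D.arcGen (m 0) * D.arcGen (a 0) * D.sGen * (D.arcGen (m 0))⁻¹, fun v hv => ?_⟩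
      rw [heval, hA v hv, hM, hk, hS]
      simp [crossingValue, Matrix.mulVec_neg]
    · refine ⟨1, fun v hv => ?_⟩
      rw [heval, hA v hv, hM, hk, hS]
      simp [crossingValue]
    · refine ⟨1, fun v hv => ?_⟩
      rw [heval, hA v hv, hM, hk, hQ]
      simp [crossingValue]

end SurfaceDiagram

/-! ### Moving the strands of a triangle across each other -/

theorem overNext_add_two {κ : CrossingKind} {p : Fin 4} : OverNext κ (p + 2) ↔ OverNext κ p := by
  fin_cases p <;> exact Iff.rfl

theorem overPrev_add_two {κ : CrossingKind} {p : Fin 4} : OverPrev κ (p + 2) ↔ OverPrev κ p := by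
  fin_cases p <;> exact Iff.rfl

theorem overNext_add_three {κ : CrossingKind} {p : Fin 4} : OverNext κ (p + 3) ↔ OverPrev κ p := by
  fin_cases p <;> exact Iff.rfl

theorem CompatibleCorners.add_two {p p' : Fin 4} (h : CompatibleCorners p p') :
    CompatibleCorners (p + 2) (p' + 2) := by
  revert p p'
  decide

theorem AdmissibleTriangle.add_two {κ₁ κ₂ κ₃ : CrossingKind} {p₁ p₂ p₃ : Fin 4}
    (h : AdmissibleTriangle κ₁ κ₂ κ₃ p₁ p₂ p₃) :
    AdmissibleTriangle κ₁ κ₂ κ₃ (p₁ + 2) (p₂ + 2) (p₃ + 2) := by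
  simpa only [AdmissibleTriangle, overNext_add_two, overPrev_add_two] using h

/-- The relations at the corners of a polygon determine the values on the sides, and they have the
same solutions outside the polygon as those for the polygon with each side on the other side of all
the crossings. -/
structure SwappableRel.{u} {N : ℕ} [NeZero N] (κ : Fin N → CrossingKind) (p : Fin N → Fin 4) :
    Prop where
  exists_sides : ∀ {G : Type u} [Group G] {s q : G} {a m b : Fin N → G}, s * q = q * s →
    PolygonRel κ s q p a m b → ∃ m', PolygonRel κ s q (fun j => p j + 2) a m' b
  unique : ∀ {G : Type u} [Group G] {s q : G} {a m b m' b' : Fin N → G},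
    PolygonRel κ s q p a m b → PolygonRel κ s q p a m' b' → m = m'
  eq : ∀ {G : Type u} [Group G] {s q : G} {a m b m' b' : Fin N → G}, s * q = q * s →
    PolygonRel κ s q p a m b → PolygonRel κ s q (fun j => p j + 2) a m' b' → b' = b

theorem Fin.funext_three {T : Type*} {f g : Fin 3 → T} (h : f 0 = g 0 ∧ f 1 = g 1 ∧ f 2 = g 2) :
    f = g := by
  funext j
  fin_cases j
  · exact h.1
  · exact h.2.1
  · exact h.2.2

theorem swappableRel_triangle.{u} {κ : Fin 3 → CrossingKind} {p : Fin 3 → Fin 4}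
    (h₁ : CompatibleCorners (p 0) (p 1)) (h₂ : CompatibleCorners (p 1) (p 2))
    (h₃ : CompatibleCorners (p 2) (p 0))
    (h : AdmissibleTriangle (κ 0) (κ 1) (κ 2) (p 0) (p 1) (p 2)) : SwappableRel.{u} κ p where
  exists_sides := by
    intro G _ s q a m b hsq hm
    -- The triangle after the move is solved from the entering values; its leaving values agree with
    -- `b` by the swap identity.
    obtain ⟨m₁, m₂, m₃, b₁, b₂, b₃, hr⟩ :=
      exists_triangleRel h₁.add_two h₂.add_two h₃.add_two h.add_two s q (a 0) (a 1) (a 2)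
    have hb : b = ![b₁, b₂, b₃] := Fin.funext_three
      (triangleRel_swap h₁ h₂ h₃ h hsq (polygonRel_three_iff.mp hm) hr)
    exact ⟨![m₁, m₂, m₃], polygonRel_three_iff.mpr (by rw [hb]; exact hr)⟩
  unique hm hn := Fin.funext_three
    (triangleRel_unique h₁ h₂ h₃ h (polygonRel_three_iff.mp hm) (polygonRel_three_iff.mp hn))
  eq hsq hm hn := (Fin.funext_three (triangleRel_swap h₁ h₂ h₃ h hsq
    (polygonRel_three_iff.mp hm) (polygonRel_three_iff.mp hn))).symm

/-- `D'` is obtained from `D` by moving the strands that bound a polygon with the corners `c j` and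
the sides `m j` across each other. -/
structure IsPolygonSwap (D D' : SurfaceDiagram) {N : ℕ} (c : Fin N → D.Crossing) (m : Fin N → D.Arc)
    (κ : D.Crossing ≃ D'.Crossing) (π : D.Arc ≃ D'.Arc) : Prop where
  kind_eq : ∀ c, D'.kind (κ c) = D.kind c
  inc_eq : ∀ x i, (∀ k, c k ≠ x) → D'.inc (κ x) i = π (D.inc x i)
  out_eq : ∀ x i, (∀ k, c k ≠ x) → D'.out (κ x) i = π (D.out x i)
  swap : ∀ y i z i' j, D.out y i = m j → D.inc z i' = m j →
    D'.inc (κ z) i' = π (D.inc y i) ∧ D'.out (κ z) i' = π (m j) ∧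
    D'.inc (κ y) i = π (m j) ∧ D'.out (κ y) i = π (D.out z i')

namespace IsPolygonSwap

variable {D D' : SurfaceDiagram} {N : ℕ} [NeZero N] {c : Fin N → D.Crossing} {p : Fin N → Fin 4}
  {a m b : Fin N → D.Arc} {κ : D.Crossing ≃ D'.Crossing} {π : D.Arc ≃ D'.Arc}
  (h : IsPolygonSwap D D' c m κ π) (P : D.IsPolygon c p a m b)

include h P

/-- The strand meets its two crossings in the opposite order, so at each of them its side now lies
on the opposite half-edge. -/
theorem strandAt {x : D.Crossing} {r : Fin 4} {j : Fin N} (hx : D.StrandAt x r (a j) (m j) (b j)) :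
    D'.StrandAt (κ x) (r + 2) (π (a j)) (π (m j)) (π (b j)) := by
  obtain ⟨k, i, h1, h2⟩ := P.tail j
  obtain ⟨k', i', h3, h4⟩ := P.head j
  obtain ⟨e1, e2, e3, e4⟩ := h.swap _ _ _ _ j h2 h3
  rw [h1] at e1
  rw [h4] at e4
  have hin : ∀ i₀, D.inc x i₀ = m j →
      D'.inc (κ x) i₀ = π (a j) ∧ D'.out (κ x) i₀ = π (m j) := fun i₀ hi => by
    obtain ⟨rfl, rfl⟩ :=
      Prod.ext_iff.mp (@D.inc_injective (c k', i') (x, i₀) (h3.trans hi.symm))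
    exact ⟨e1, e2⟩
  have hout : ∀ i₀, D.out x i₀ = m j →
      D'.inc (κ x) i₀ = π (m j) ∧ D'.out (κ x) i₀ = π (b j) := fun i₀ hi => by
    obtain ⟨rfl, rfl⟩ :=
      Prod.ext_iff.mp (@D.out_injective (c k, i) (x, i₀) (h2.trans hi.symm))
    exact ⟨e3, e4⟩
  fin_cases r
  · exact hin 0 hx.1
  · exact hin 1 hx.1
  · exact hout 0 hx.2
  · exact hout 1 hx.2

theorem isPolygon : D'.IsPolygon (fun j => κ (c j)) (fun j => p j + 2) (fun j => π (a j))
    (fun j => π (m j)) (fun j => π (b j)) where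
  injective := κ.injective.comp P.injective
  compatible j := (P.compatible j).add_two
  next j := h.strandAt P (P.next j)
  prev j := by
    have := h.strandAt P (P.prev j)
    rwa [add_right_comm] at this

theorem symm : IsPolygonSwap D' D (fun j => κ (c j)) (fun j => π (m j)) κ.symm π.symm where
  kind_eq x := by rw [← h.kind_eq, κ.apply_symm_apply]
  inc_eq x i hx := by
    obtain ⟨x, rfl⟩ := κ.surjective x
    rw [h.inc_eq x i fun k hk => hx k (congrArg κ hk), κ.symm_apply_apply, π.symm_apply_apply]
  out_eq x i hx := by
    obtain ⟨x, rfl⟩ := κ.surjective x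
    rw [h.out_eq x i fun k hk => hx k (congrArg κ hk), κ.symm_apply_apply, π.symm_apply_apply]
  swap y₀ i₀ z₀ i₀' j hy hz := by
    obtain ⟨k, i, h1, h2⟩ := P.tail j
    obtain ⟨k', i', h3, h4⟩ := P.head j
    obtain ⟨e1, e2, e3, e4⟩ := h.swap _ _ _ _ j h2 h3
    obtain ⟨rfl, rfl⟩ :=
      Prod.mk.inj (@D'.out_injective (y₀, i₀) (κ (c k'), i') (hy.trans e2.symm))
    obtain ⟨rfl, rfl⟩ :=
      Prod.mk.inj (@D'.inc_injective (z₀, i₀') (κ (c k), i) (hz.trans e3.symm))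
    rw [e1, e4]
    simp only [Equiv.symm_apply_apply]
    exact ⟨trivial, h2, h3, trivial⟩

theorem exists_coloring (hE : SwappableRel.{0} (fun j => D.kind (c j)) p) {G : Type} [Group G]
    {s q : G} (hsq : s * q = q * s) {γ : D.Arc → G} (hγ : D.IsColoring s q γ) :
    ∃ γ' : D'.Arc → G, D'.IsColoring s q γ' ∧ ∀ x, (∀ j, x ≠ m j) → γ' (π x) = γ x := by
  classical
  obtain ⟨M, hM⟩ := hE.exists_sides hsq (P.polygonRel_iff.mpr fun j i => hγ (c j) i)
  let γ' : D'.Arc → G := fun y => if hx : ∃ j, y = π (m j) then M hx.choose else γ (π.symm y)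
  have hγo : ∀ x, (∀ j, x ≠ m j) → γ' (π x) = γ x := fun x hx => by
    simp only [γ']
    rw [dif_neg, π.symm_apply_apply]
    rintro ⟨j, hj⟩
    exact hx j (π.injective hj)
  have hγm : ∀ j, γ' (π (m j)) = M j := fun j => by
    have hx : ∃ k, π (m j) = π (m k) := ⟨j, rfl⟩
    simp only [γ']
    rw [dif_pos hx, P.m_injective (π.injective hx.choose_spec.symm)]
  refine ⟨γ', fun x i => ?_, hγo⟩
  obtain ⟨x, rfl⟩ := κ.surjective x
  by_cases hx : ∃ k, c k = x
  · obtain ⟨k, rfl⟩ := hx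
    refine (h.isPolygon P).polygonRel_iff.mp ?_ k i
    simp only [hγm, hγo _ (P.a_ne_m _), hγo _ (P.b_ne_m _), h.kind_eq]
    exact hM
  · push Not at hx
    rw [h.out_eq x i hx, h.inc_eq x _ hx, h.inc_eq x _ hx, h.kind_eq, hγo _ (P.inc_ne_m hx 0),
      hγo _ (P.inc_ne_m hx 1), hγo _ (P.out_ne_m hx i)]
    exact hγ x i

omit h in
theorem coloring_unique (hE : SwappableRel.{0} (fun j => D.kind (c j)) p) {G : Type} [Group G]
    {s q : G} {γ₁ γ₂ : D.Arc → G} (h₁ : D.IsColoring s q γ₁) (h₂ : D.IsColoring s q γ₂)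
    (ho : ∀ x, (∀ j, x ≠ m j) → γ₁ x = γ₂ x) : γ₁ = γ₂ := by
  have r₁ := P.polygonRel_iff.mpr fun j i => h₁ (c j) i
  have r₂ := P.polygonRel_iff.mpr fun j i => h₂ (c j) i
  rw [show (fun j => γ₁ (a j)) = fun j => γ₂ (a j) from funext fun j => ho _ (P.a_ne_m j)] at r₁
  have hm := hE.unique r₁ r₂
  funext x
  by_cases hx : ∃ j, x = m j
  · obtain ⟨j, rfl⟩ := hx
    exact congrFun hm j
  · push Not at hx
    exact ho x hx

theorem coloringTransfer (hE : SwappableRel.{0} (fun j => D.kind (c j)) p)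
    (hE' : SwappableRel.{0} (fun j => D.kind (c j)) fun j => p j + 2) :
    ColoringTransfer D D' (fun x y => (∀ j, x ≠ m j) ∧ π x = y) := by
  have hk : (fun j => D'.kind (κ (c j))) = fun j => D.kind (c j) := funext fun j => h.kind_eq _
  rw [← hk] at hE'
  have hne : ∀ y, (∀ j, y ≠ π (m j)) → ∀ j, π.symm y ≠ m j := fun y hy j hj =>
    hy j (π.symm_apply_eq.mp hj)
  have hne' : ∀ x, (∀ j, x ≠ m j) → ∀ j, π x ≠ π (m j) := fun x hx j hj => hx j (π.injective hj)
  refine ⟨fun hsq γ hγ => ?_, fun hsq γ' hγ' => ?_, fun h₁ h₂ h₁₂ => ?_, fun h₁ h₂ h₁₂ => ?_⟩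
  · obtain ⟨γ', hγ', h1⟩ := h.exists_coloring P hE hsq hγ
    exact ⟨γ', hγ', by rintro x _ ⟨hx, rfl⟩; exact h1 x hx⟩
  · obtain ⟨γ, hγ, h1⟩ := (h.symm P).exists_coloring (h.isPolygon P) hE' hsq hγ'
    refine ⟨γ, hγ, ?_⟩
    rintro x _ ⟨hx, rfl⟩
    rw [← h1 (π x) (hne' x hx), π.symm_apply_apply]
  · exact coloring_unique P hE h₁ h₂ fun x hx => h₁₂ x _ ⟨hx, rfl⟩
  · exact coloring_unique (h.isPolygon P) hE' h₁ h₂ fun y hy =>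
      h₁₂ (π.symm y) y ⟨hne y hy, π.apply_symm_apply y⟩

/-- Both blocks of sides have determinant 1, so the determinants are those of the Schur complements.
These have the same rows: at the leaving arcs by the swap identity in the affine group, elsewhere
because nothing changes. -/
theorem detTransfer.{u} (n : ℕ) (R : Type u) [CommRing R]
    (hE : SwappableRel.{u} (fun j => D.kind (c j)) p) (hR : HasRank (fun j => D.kind (c j)) p)
    (hR' : HasRank (fun j => D.kind (c j)) fun j => p j + 2) :
    DetTransfer D D' (fun x y => (∀ j, x ≠ m j) ∧ π x = y) n R := by
  classical
  intro ρ ρ' hs hq harc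
  refine ⟨1, ?_⟩
  rw [map_one, Matrix.det_one, one_mul]
  have P' := h.isPolygon P
  have hk : (fun j => D'.kind (κ (c j))) = fun j => D.kind (c j) := funext fun j => h.kind_eq _
  have hdet := P.det_sides_eq_one ρ hR
  have hdet' := P'.det_sides_eq_one ρ' (hk ▸ hR')
  obtain ⟨W, hdetW, hW⟩ := exists_schurComplement (D.arcMatrix ρ) _ (hdet ▸ isUnit_one)
  obtain ⟨W', hdetW', hW'⟩ := exists_schurComplement (D'.arcMatrix ρ') _ (hdet' ▸ isUnit_one)
  rw [hdetW, hdetW', hdet, hdet', one_mul, one_mul]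
  have hS' : D'.affS ρ' = D.affS ρ := congrArg (affMk 0) hs
  have hQ' : D'.affQ ρ' = D.affQ ρ := congrArg (affMk 0) hq
  let e : {x : D.Arc × Fin n // ¬∃ j, x.1 = m j} ≃ {y : D'.Arc × Fin n // ¬∃ j, y.1 = π (m j)} :=
    (π.prodCongr (Equiv.refl (Fin n))).subtypeEquiv fun x => by simp
  refine det_eq_of_forall_mulVec W W' e ?_
  rintro v ⟨⟨x, k⟩, hx⟩
  obtain ⟨w, hwv, hw0, hw⟩ := hW (v ∘ e)
  obtain ⟨w', hwv', hw0', hw'⟩ := hW' v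
  rw [hw, hw']
  have hww : ∀ z l, (∀ j, z ≠ m j) → w' (π z, l) = w (z, l) := fun z l hz => by
    have hz' : ¬∃ j, (z, l).1 = m j := fun ⟨j, hj⟩ => hz j hj
    exact (hwv' (e ⟨(z, l), hz'⟩)).trans (hwv ⟨(z, l), hz'⟩).symm
  have hA : ∀ z, (∀ j, z ≠ m j) → D'.affArc ρ' w' (π z) = D.affArc ρ w z := by
    intro z hz
    rw [affArc, affArc, harc z _ ⟨hz, rfl⟩]
    congr 1
    funext l
    exact hww z l hz
  have hx' : ∀ j, x ≠ m j := fun j hj => hx ⟨j, hj⟩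
  change (D.arcMatrix ρ).mulVec w (x, k) = (D'.arcMatrix ρ').mulVec w' (π x, k)
  by_cases hxb : ∃ j, x = b j
  · obtain ⟨j, rfl⟩ := hxb
    have hrel := P.polygonRel_arcEval (γ := D.affArc ρ w) fun i =>
      arcEval_eq_of_mulVec_eq_zero ρ fun l => hw0 (m i, l) ⟨i, rfl⟩
    have hrel' := P'.polygonRel_arcEval (γ := D'.affArc ρ' w') fun i =>
      arcEval_eq_of_mulVec_eq_zero ρ' fun l => hw0' (π (m i), l) ⟨i, rfl⟩
    simp only [hA _ (P.a_ne_m _), hS', hQ', h.kind_eq] at hrel'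
    rw [arcMatrix_mulVec_eq_arcEval, arcMatrix_mulVec_eq_arcEval, hww _ _ hx', hS', hQ',
      congrFun (hE.eq (D.affS_mul_affQ ρ) hrel hrel') j]
  · push Not at hxb
    by_cases hxo : ∃ y i, D.out y i = x
    · obtain ⟨y, i, rfl⟩ := hxo
      have hy : ∀ k, c k ≠ y := by
        rintro k rfl
        obtain ⟨j, ⟨-, h3⟩ | ⟨-, h3⟩⟩ := P.strand_at_corner k i
        · exact hx' j h3
        · exact hxb j h3
      rw [← h.out_eq y i hy, arcMatrix_mulVec_out, arcMatrix_mulVec_out, hS', hQ', h.inc_eq y 0 hy,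
        h.inc_eq y 1 hy, h.kind_eq, hA _ (P.inc_ne_m hy 0), hA _ (P.inc_ne_m hy 1),
        h.out_eq y i hy, hww _ _ hx']
    · push Not at hxo
      rw [arcMatrix_mulVec_of_forall_ne _ _ _ _ hxo, arcMatrix_mulVec_of_forall_ne]
      intro y i hy
      obtain ⟨y, rfl⟩ := κ.surjective y
      by_cases hyc : ∃ k, c k = y
      · obtain ⟨k, rfl⟩ := hyc
        obtain ⟨j, ⟨-, h3⟩ | ⟨-, h3⟩⟩ := P'.strand_at_corner k i
        · exact hx' j (π.injective (hy.symm.trans h3))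
        · exact hxb j (π.injective (hy.symm.trans h3))
      · push Not at hyc
        rw [h.out_eq y i hyc] at hy
        exact hxo y i (π.injective hy)

end IsPolygonSwap

namespace SurfaceDiagram

variable {D : SurfaceDiagram}

theorem StrandAt.overNext {x y z : D.Crossing} {r : Fin 4} {a m b : D.Arc} {i i' : Fin 2}
    (h : D.StrandAt x r a m b) (hy : D.out y i = m) (hz : D.inc z i' = m) (hyo : D.IsOver y i)
    (hzo : D.IsOver z i') : OverNext (D.kind x) r := by
  have hin : ∀ i₀, D.inc x i₀ = m → D.IsOver x i₀ := fun i₀ hi => by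
    obtain ⟨rfl, rfl⟩ := Prod.ext_iff.mp (@D.inc_injective (z, i') (x, i₀) (hz.trans hi.symm))
    exact hzo
  have hout : ∀ i₀, D.out x i₀ = m → D.IsOver x i₀ := fun i₀ hi => by
    obtain ⟨rfl, rfl⟩ := Prod.ext_iff.mp (@D.out_injective (y, i) (x, i₀) (hy.trans hi.symm))
    exact hyo
  fin_cases r
  · simpa [IsOver, OverNext] using hin 0 h.1
  · simpa [IsOver, OverNext] using hin 1 h.1
  · simpa [IsOver, OverNext] using hout 0 h.2
  · simpa [IsOver, OverNext] using hout 1 h.2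

theorem IsPolygon.admissibleTriangle {h : Fin 3 → D.HalfEdge} {a b : Fin 3 → D.Arc}
    (P : D.IsPolygon (fun j => (h j).1) (fun j => (h j).2) a (fun j => D.arcAt (h j)) b)
    (hkind : IsClassicalTriangle D (h 0) (h 1) (h 2) ∨ IsVirtualTriangle D (h 0) (h 1) (h 2)) :
    AdmissibleTriangle (D.kind (h 0).1) (D.kind (h 1).1) (D.kind (h 2).1)
      (h 0).2 (h 1).2 (h 2).2 := by
  refine hkind.imp ?_ id
  rintro ⟨h1, h2, h3, y, i, z, i', hyz, hy, hyo, hzo⟩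
  refine ⟨h1, h2, h3, ?_⟩
  have key : ∀ j, D.out y i = D.arcAt (h j) → OverNext (D.kind (h j).1) (h j).2 ∧
      OverPrev (D.kind (h (j + 1)).1) (h (j + 1)).2 := fun j hj =>
    ⟨(P.next j).overNext hj (hyz.symm.trans hj) hyo hzo,
      overNext_add_three.mp ((P.prev j).overNext hj (hyz.symm.trans hj) hyo hzo)⟩
  rcases hy with hy | hy | hy
  · exact Or.inl (key 0 hy)
  · exact Or.inr (Or.inl (key 1 hy))
  · exact Or.inr (Or.inr (key 2 hy))

end SurfaceDiagram

theorem IsTriangleSwap.isPolygonSwap {D D' : SurfaceDiagram} {h : Fin 3 → D.HalfEdge}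
    {κ : D.Crossing ≃ D'.Crossing} {π : D.Arc ≃ D'.Arc}
    (hT : IsTriangleSwap D D' (h 0) (h 1) (h 2) κ π) :
    IsPolygonSwap D D' (fun j => (h j).1) (fun j => D.arcAt (h j)) κ π where
  kind_eq := hT.kind_eq
  inc_eq x i hx := hT.inc_eq x i (hx 0).symm (hx 1).symm (hx 2).symm
  out_eq x i hx := hT.out_eq x i (hx 0).symm (hx 1).symm (hx 2).symm
  swap y i z i' j hy hz := by
    rw [← hy]
    refine hT.swap y i z i' (hy.trans hz.symm) ?_
    rw [hy]
    fin_cases j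
    · exact Or.inl rfl
    · exact Or.inr (Or.inl rfl)
    · exact Or.inr (Or.inr rfl)

/-! ### Invariance under single moves and sequences of moves -/

theorem Move.transfer {D D' : VirtualLinkDiagram} {θ : D.Arc → D'.Arc → Prop} (hM : Move D D' θ)
    (n : ℕ) (R : Type*) [CommRing R] :
    ColoringTransfer D.toSurfaceDiagram D'.toSurfaceDiagram θ ∧
      DetTransfer D.toSurfaceDiagram D'.toSurfaceDiagram θ n R := by
  cases hM with
  | relabel κ π h => exact ⟨h.coloringTransfer, h.detTransfer n R⟩
  | kink h₁ hface κ π h =>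
    obtain ⟨a, b, P⟩ := exists_isPolygon (h := fun _ : Fin 1 => h₁) (fun _ => hface)
      (Function.injective_of_subsingleton _)
    have hθ : (fun (x : D.Arc) (y : D'.Arc) => x ≠ D.arcAt h₁ ∧ π x = y) =
        fun x y => (∀ _ : Fin 1, x ≠ D.arcAt h₁) ∧ π x = y := by
      simp only [forall_const]
    have hS : ∀ x, x ∈ ({h₁.1} : Set D.Crossing) ↔ ∃ _ : Fin 1, h₁.1 = x := fun x => by
      simp [eq_comm]
    rw [hθ]
    have hc : CompatibleCorners h₁.2 h₁.2 := P.compatible 0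
    exact ⟨h.coloringTransfer P hS (erasableRel_kink hc),
      h.detTransfer P hS n R (erasableRel_kink hc) P.det_kink⟩
  | bigon h₁ h₂ hface hkind κ π h =>
    obtain ⟨a, b, P⟩ := exists_isPolygon (h := ![h₁, h₂])
      (Fin.forall_fin_two.mpr ⟨hface.1, hface.2.1⟩) (by
        intro i j
        fin_cases i <;> fin_cases j <;> simp [hface.2.2, hface.2.2.symm])
    have hθ : (fun (x : D.Arc) (y : D'.Arc) => x ≠ D.arcAt h₁ ∧ x ≠ D.arcAt h₂ ∧ π x = y) =
        fun x y => (∀ j, x ≠ D.arcAt (![h₁, h₂] j)) ∧ π x = y := by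
      simp [Fin.forall_fin_two, and_assoc]
    have hS : ∀ x, x ∈ ({h₁.1, h₂.1} : Set D.Crossing) ↔ ∃ k, (![h₁, h₂] k).1 = x := fun x => by
      simp [Fin.exists_fin_two, eq_comm]
    rw [hθ]
    exact ⟨h.coloringTransfer P hS (erasableRel_bigon (P.compatible 0) (P.compatible 1) hkind),
      h.detTransfer P hS n R (erasableRel_bigon (P.compatible 0) (P.compatible 1) hkind)
        fun ρ => ⟨1, by
          rw [map_one, Matrix.det_one]
          exact P.det_sides_eq_one ρ
            (AdmissibleBigon.hasRank (P.compatible 0) (P.compatible 1) hkind)⟩⟩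
  | triangle h₁ h₂ h₃ hface hkind κ π h =>
    obtain ⟨f1, f2, f3, n1, n2, n3⟩ := hface
    obtain ⟨a, b, P⟩ := exists_isPolygon (h := ![h₁, h₂, h₃])
      (by
        intro j
        fin_cases j
        · exact f1
        · exact f2
        · exact f3) (by
        intro i j
        fin_cases i <;> fin_cases j <;> simp [n1, n2, n3, n1.symm, n2.symm, n3.symm])
    have hθ : (fun (x : D.Arc) (y : D'.Arc) =>
        x ≠ D.arcAt h₁ ∧ x ≠ D.arcAt h₂ ∧ x ≠ D.arcAt h₃ ∧ π x = y) =
        fun x y => (∀ j, x ≠ D.arcAt (![h₁, h₂, h₃] j)) ∧ π x = y := by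
      simp [Fin.forall_fin_succ, and_assoc]
    rw [hθ]
    have hadm := P.admissibleTriangle hkind
    have hsw := IsTriangleSwap.isPolygonSwap (h := ![h₁, h₂, h₃]) h
    have c1 := P.compatible 0
    have c2 := P.compatible 1
    have c3 := P.compatible 2
    exact ⟨hsw.coloringTransfer P (swappableRel_triangle c1 c2 c3 hadm)
        (swappableRel_triangle c1.add_two c2.add_two c3.add_two hadm.add_two),
      hsw.detTransfer P n R (swappableRel_triangle c1 c2 c3 hadm)
        (AdmissibleTriangle.hasRank hadm) (AdmissibleTriangle.hasRank hadm.add_two)⟩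

theorem VirtuallyEquivalent.exists_inducedIso {D D' : VirtualLinkDiagram}
    (h : VirtuallyEquivalent D D') : ∃ φ : D.VG ≃* D'.VG, InducedIso D D' φ := by
  induction h with
  | rel D D' h =>
    obtain ⟨θ, hM⟩ := h
    -- Only the transfer of colourings is used, which does not involve `n` and `R`; 0 and ℤ are
    -- dummies.
    obtain ⟨φ, hs, hq, harc⟩ := (hM.transfer 0 ℤ).1.exists_mulEquiv
    exact ⟨φ, .move hM φ hs hq harc⟩
  | refl D =>
    exact ⟨MulEquiv.refl _, .move (.relabel (Equiv.refl _) (Equiv.refl _)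
      ⟨fun _ => rfl, fun _ _ => rfl, fun _ _ => rfl⟩) _ rfl rfl (by rintro a _ rfl; rfl)⟩
  | symm D D' _ ih =>
    obtain ⟨φ, hφ⟩ := ih
    exact ⟨φ.symm, hφ.symm⟩
  | trans D D' D'' _ _ ih ih' =>
    obtain ⟨φ, hφ⟩ := ih
    obtain ⟨ψ, hψ⟩ := ih'
    exact ⟨φ.trans ψ, hφ.trans hψ⟩

theorem rhoTensorAlpha_apply {Γ : Type} [Group Γ] {d n : ℕ} {R : Type*} [CommRing R]
    (α : Γ →* Multiplicative (Fin d → ℤ)) (ρ : Γ →* GL (Fin n) R) (g : Γ) :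
    rhoTensorAlpha α ρ g = laurentMonomial R (Multiplicative.toAdd (α g)) •
      (algebraMap R (LaurentRing d R)).mapMatrix (ρ g : Matrix (Fin n) (Fin n) R) := rfl

theorem rhoTensorAlpha_congr {Γ Γ' : Type} [Group Γ] [Group Γ'] {d n : ℕ} {R : Type*} [CommRing R]
    {α : Γ →* Multiplicative (Fin d → ℤ)} {α' : Γ' →* Multiplicative (Fin d → ℤ)}
    {ρ : Γ →* GL (Fin n) R} {ρ' : Γ' →* GL (Fin n) R} {g : Γ} {g' : Γ'} (hα : α' g' = α g)
    (hρ : ρ' g' = ρ g) : rhoTensorAlpha α' ρ' g' = rhoTensorAlpha α ρ g := by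
  rw [rhoTensorAlpha_apply, rhoTensorAlpha_apply, hα, hρ]

theorem unitRep_congr {Γ Γ' : Type} [Group Γ] [Group Γ'] {d n : ℕ} {R : Type*} [CommRing R]
    {α : Γ →* Multiplicative (Fin d → ℤ)} {α' : Γ' →* Multiplicative (Fin d → ℤ)}
    {ρ : Γ →* GL (Fin n) R} {ρ' : Γ' →* GL (Fin n) R} {g : Γ} {g' : Γ'} (hα : α' g' = α g)
    (hρ : ρ' g' = ρ g) : unitRep α' ρ' g' = unitRep α ρ g := by
  apply Units.ext
  rw [coe_unitRep, coe_unitRep, rhoTensorAlpha_congr hα hρ]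

theorem det_rhoTensorAlpha {Γ : Type} [Group Γ] {d n : ℕ} {R : Type*} [CommRing R]
    (α : Γ →* Multiplicative (Fin d → ℤ)) (ρ : Γ →* GL (Fin n) R) (g : Γ) :
    (rhoTensorAlpha α ρ g).det = laurentMonomial R (Multiplicative.toAdd (α g)) ^ n *
      algebraMap R (LaurentRing d R) (Matrix.GeneralLinearGroup.det (ρ g) : Rˣ) := by
  rw [rhoTensorAlpha_apply, Matrix.det_smul, Fintype.card_fin, ← RingHom.map_det]
  rfl

theorem InducedIso.alpha_comp {D D' : VirtualLinkDiagram} {φ : D.VG ≃* D'.VG}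
    (h : InducedIso D D' φ) (g : D.VG) : D'.alpha (φ g) = D.alpha g := by
  induction h with
  | move hM φ hs hq harc =>
    exact DFunLike.congr_fun ((hM.transfer 0 ℤ).1.alpha_comp (φ := φ.toMonoidHom) hs hq harc) g
  | @symm D D' φ _ ih => rw [← ih, MulEquiv.apply_symm_apply]
  | trans _ _ ih ih' => exact (ih' _).trans (ih _)

theorem InducedIso.exists_det_eq {D D' : VirtualLinkDiagram} {φ : D.VG ≃* D'.VG}
    (h : InducedIso D D' φ) {n : ℕ} {R : Type*} [CommRing R] (ρ : D.VG →* GL (Fin n) R)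
    (ρ' : D'.VG →* GL (Fin n) R) (hρ : ∀ g, ρ' (φ g) = ρ g) :
    ∃ g : D.VG, (D'.arcMatrix ρ').det = (rhoTensorAlpha D.alpha ρ g).det * (D.arcMatrix ρ).det := by
  have hinv : ∀ (D : VirtualLinkDiagram) (ρ : D.VG →* GL (Fin n) R) (g : D.VG),
      (rhoTensorAlpha D.alpha ρ g⁻¹).det * (rhoTensorAlpha D.alpha ρ g).det = 1 := by
    intro D ρ g
    rw [← Matrix.det_mul, ← map_mul, inv_mul_cancel, map_one, Matrix.det_one]
  induction h with
  | @move D D' θ hM φ hs hq harc =>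
    have hu : ∀ g, unitRep D'.alpha ρ' (φ g) = unitRep D.alpha ρ g := fun g =>
      unitRep_congr ((InducedIso.move hM φ hs hq harc).alpha_comp g) (hρ g)
    obtain ⟨g, hg⟩ := (hM.transfer n R).2 ρ ρ' (hs ▸ hu _) (hq ▸ hu _)
      fun a b hab => harc a b hab ▸ hu _
    exact ⟨g⁻¹, by rw [hg, ← mul_assoc, hinv, one_mul]⟩
  | @symm D D' φ h ih =>
    obtain ⟨g, hg⟩ := ih ρ' ρ fun g => by rw [← hρ, MulEquiv.symm_apply_apply]
    refine ⟨(φ g)⁻¹, ?_⟩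
    have := rhoTensorAlpha_congr (α := D.alpha) (α' := D'.alpha) (ρ := ρ') (ρ' := ρ) (g := g)
      (g' := φ g) (h.alpha_comp g) (by rw [← hρ, MulEquiv.symm_apply_apply])
    rw [hg, ← this, ← mul_assoc, hinv, one_mul]
  | @trans D D' D'' φ ψ h h' ih ih' =>
    -- The middle diagram carries the pullback of `ρ'`; the factor of the second step is moved back
    -- to `D` along `φ`, which preserves α and the representation.
    obtain ⟨g, hg⟩ := ih ρ (ρ'.comp ψ.toMonoidHom) hρ
    obtain ⟨g', hg'⟩ := ih' (ρ'.comp ψ.toMonoidHom) ρ' fun g => rfl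
    refine ⟨φ.symm g' * g, ?_⟩
    have := rhoTensorAlpha_congr (α := D.alpha) (α' := D'.alpha) (ρ := ρ)
      (ρ' := ρ'.comp ψ.toMonoidHom) (g := φ.symm g') (g' := g')
      (by rw [← h.alpha_comp, MulEquiv.apply_symm_apply])
      (by rw [← hρ, MulEquiv.trans_apply, MulEquiv.apply_symm_apply]; rfl)
    rw [hg', hg, map_mul, Matrix.det_mul, this, mul_assoc]

theorem mainTheorem11 {R : Type*} [CommRing R] [IsDomain R] [UniqueFactorizationMonoid R]
    (n : ℕ) (hn : 0 < n) (D D' : VirtualLinkDiagram) (hD : VirtuallyEquivalent D D') :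
    (∃ φ : D.VG ≃* D'.VG, InducedIso D D' φ) ∧
    ∀ φ : D.VG ≃* D'.VG, InducedIso D D' φ →
      ∀ (ρ : D.VG →* GL (Fin n) R) (ρ' : D'.VG →* GL (Fin n) R), (∀ g, ρ' (φ g) = ρ g) →
        (∃ f : FractionRing (LaurentRing 3 R), D.IsTwistedVirtualAlexander ρ f) ∧
        (∃ f' : FractionRing (LaurentRing 3 R), D'.IsTwistedVirtualAlexander ρ' f') ∧
        ∀ f f' : FractionRing (LaurentRing 3 R),
          D.IsTwistedVirtualAlexander ρ f → D'.IsTwistedVirtualAlexander ρ' f' →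
            (∃ (ε : Rˣ) (e₁ e₂ e₃ : ℤ),
              f' = algebraMap (LaurentRing 3 R) (FractionRing (LaurentRing 3 R))
                (algebraMap R (LaurentRing 3 R) ε * laurentMonomial R ![e₁, e₂, e₃] ^ n) * f) ∧
            ((∀ g, Matrix.GeneralLinearGroup.det (ρ g) = 1) →
              (Odd n → ∃ e₁ e₂ e₃ : ℤ,
                f' = algebraMap (LaurentRing 3 R) (FractionRing (LaurentRing 3 R))
                  (laurentMonomial R ![e₁, e₂, e₃] ^ n) * f ∨
                f' = -(algebraMap (LaurentRing 3 R) (FractionRing (LaurentRing 3 R))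
                  (laurentMonomial R ![e₁, e₂, e₃] ^ n) * f)) ∧
              (Even n → ∃ e₁ e₂ e₃ : ℤ,
                f' = algebraMap (LaurentRing 3 R) (FractionRing (LaurentRing 3 R))
                  (laurentMonomial R ![e₁, e₂, e₃] ^ n) * f)) := by 
  refine ⟨hD.exists_inducedIso, fun φ hφ ρ ρ' hρ => ⟨D.exists_isTwistedVirtualAlexander ρ,
    D'.exists_isTwistedVirtualAlexander ρ', fun f f' hf hf' => ?_⟩⟩
  obtain ⟨σ, rfl⟩ := IsTwistedVirtualAlexander.exists_eq D.toSurfaceDiagram ρ hn hf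
  obtain ⟨σ', rfl⟩ := IsTwistedVirtualAlexander.exists_eq D'.toSurfaceDiagram ρ' hn hf'
  obtain ⟨g, hg⟩ := hφ.exists_det_eq ρ ρ' hρ
  obtain ⟨e₁, e₂, e₃, he⟩ : ∃ e₁ e₂ e₃ : ℤ, Multiplicative.toAdd (D.alpha g) = ![e₁, e₂, e₃] :=
    ⟨_, _, _, List.ofFn_inj.mp rfl⟩
  rw [det_rhoTensorAlpha, he] at hg
  -- As σ² = 1, the signs of the two values combine to (σ'σ)^n, which is 1 for even `n`.
  have hσ : ((((σ' ^ n : ℤˣ) : ℤ)) : LaurentRing 3 R) =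
      (((((σ' * σ) ^ n : ℤˣ) : ℤ)) : LaurentRing 3 R) * (((σ ^ n : ℤˣ) : ℤ) : LaurentRing 3 R) := by
    rw [← Int.cast_mul, ← Units.val_mul, ← mul_pow, mul_assoc, Int.units_mul_self, mul_one]
  rw [hg, hσ]
  refine ⟨⟨Units.map (Int.castRingHom R) ((σ' * σ) ^ n) * Matrix.GeneralLinearGroup.det (ρ g),
    e₁, e₂, e₃, ?_⟩, fun hdet => ?_⟩
  · rw [← map_mul]
    congr 1
    rw [Units.val_mul, map_mul, Units.coe_map, MonoidHom.coe_coe, eq_intCast, map_intCast]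
    ring
  · rw [hdet, Units.val_one, map_one, mul_one]
    refine ⟨fun _ => ⟨e₁, e₂, e₃, ?_⟩, fun hev => ⟨e₁, e₂, e₃, ?_⟩⟩
    · rcases Int.units_eq_one_or ((σ' * σ) ^ n) with h | h <;> rw [h]
      · left
        rw [← map_mul]
        congr 1
        push_cast
        ring
      · right
        rw [← map_mul, ← map_neg]
        congr 1
        push_cast
        ring
    · have h : (σ' * σ) ^ n = 1 := by
        obtain ⟨k, rfl⟩ := hev
        rw [pow_add, Int.units_mul_self]
      rw [h, ← map_mul]
      congr 1
      push_cast
      ring
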